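/- Let $d\ge 1$, $K\ge 1$ and $F=\{f_1,\dots,f_K\}\subset L^2(\mathbb R^d)$. For a set $G\subset L^2(\mathbb R^d)$ let $V(G)=\overline{\operatorname{span}}\{g(\cdot-n): g\in G,\ n\in\mathbb Z^d\}$, the closure being taken in $L^2(\mathbb R^d)$, and let $J$ be the smallest cardinality of a set $G\subset L^2(\mathbb R^d)$ with $V(G)=V(F)$. Suppose that $V(F)$ has non-trivial extra invariance: there is $\gamma\in\mathbb R^d\setminus\mathbb Z^d$ such that $h(\cdot-\gamma)\in V(F)$ for every $h\in V(F)$, and $J\gamma\notin\mathbb Z^d$. Let $1/2<s\le 1$ and suppose that the Fourier transforms satisfy $\widehat f_k\in W^{s,2}(\mathbb R^d)$ for $k=1,\dots,K$. Here $\widehat f(\xi)=\int_{\mathbb R^d} f(x)e^{-2\pi i\langle x,\xi\rangle}\,dx$, extended to $L^2(\mathbb R^d)$ as a unitary operator, and $W^{s,2}(\mathbb R^d)$ is the Sobolev–Slobodeckij space: for $0<s<1$ the space of all $g\in L^2(\mathbb R^d)$ with $\int_{\mathbb R^d}\int_{\mathbb R^d}\frac{|g(x)-g(y)|^2}{|x-y|^{d+2s}}\,dy\,dx<\infty$,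 and for $s=1$ the space of all $g\in L^2(\mathbb R^d)$ whose first-order weak partial derivatives all belong to $L^2(\mathbb R^d)$. Let $\widehat F=(\widehat f_1,\dots,\widehat f_K)^T$ and let $P(\widehat F)(x)=\sum_{n\in\mathbb Z^d}\widehat F(x+n)\widehat F(x+n)^*$ be the Gramian of $F$, a $\mathbb Z^d$-periodic, positive-semidefinite $K\times K$ matrix-valued function, with eigenvalues $\zeta_1(x)\ge\cdots\ge\zeta_K(x)\ge 0$ listed with multiplicity. Then $1\le J\le K$ and $$\mathcal H^{d-1}(\Sigma(\zeta_J))>0,$$ where $\mathcal H^{d-1}$ is the $(d-1)$-dimensional Hausdorff measure (the counting measure if $d=1$) and, for a $\mathbb Z^d$-periodic, locally integrable function $w$ on $\mathbb R^d$, with the torus $\mathbb R^d/\mathbb Z^d$ identified with $[-1/2,1/2)^d$, $$\Sigma(w)=\Big\{x\in[-1/2,1/2)^d:\ \limsup_{\tau\to0^+}\frac1{|I_\tau(x)|}\int_{I_\tau(x)}|w(y)|\,dy=0\Big\},\qquad I_\tau(x)=x+[-\tau,\tau]^d.$$ -/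

import Mathlib

open MeasureTheory Filter Topology
open scoped FourierTransform ENNReal ContDiff

noncomputable section

/-- Euclidean space `ℝ^d`. -/
abbrev Rd (d : ℕ) : Type := EuclideanSpace ℝ (Fin d)

/-- The Hilbert space `L²(ℝ^d)` of complex-valued functions (Lebesgue measure). -/
abbrev L2 (d : ℕ) : Type := Lp ℂ 2 (volume : Measure (Rd d))

/-- A point of `ℤ^d`, viewed in `ℝ^d`. -/
def latticePoint {d : ℕ} (n : Fin d → ℤ) : Rd d := WithLp.toLp 2 (fun i => (n i : ℝ))

/-- The integer lattice `ℤ^d ⊆ ℝ^d`. -/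
def integerLattice (d : ℕ) : Set (Rd d) := Set.range latticePoint

/-! ### Shift-invariant spaces -/

/-- The translate `x ↦ f (x - a)` of `f ∈ L²(ℝ^d)`. -/
def translateL2 {d : ℕ} (a : Rd d) (f : L2 d) : L2 d :=
  Lp.compMeasurePreserving (fun x : Rd d => x - a) (measurePreserving_sub_right volume a) f

/-- The shift-invariant space `V(G)` generated by a set `G ⊆ L²(ℝ^d)`: the closed linear span
of the integer translates of the elements of `G`. -/
def shiftInvariantSpace {d : ℕ} (G : Set (L2 d)) : Submodule ℂ (L2 d) :=
  (Submodule.span ℂ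
    {h : L2 d | ∃ g ∈ G, ∃ n : Fin d → ℤ, h = translateL2 (latticePoint n) g}).topologicalClosure

/-- The smallest cardinality of a finite set `G ⊆ L²(ℝ^d)` with `V(G) = V`. -/
def minGenerators {d : ℕ} (V : Submodule ℂ (L2 d)) : ℕ :=
  sInf {n : ℕ | ∃ G : Finset (L2 d), G.card = n ∧ shiftInvariantSpace (G : Set (L2 d)) = V}

/-- `V` has non-trivial extra invariance: it is invariant under the translation by some
`γ ∈ ℝ^d \ ℤ^d` such that `J γ ∉ ℤ^d`, where `J` is the minimal number of generators of `V`. -/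
def HasNontrivialExtraInvariance {d : ℕ} (V : Submodule ℂ (L2 d)) : Prop :=
  ∃ γ : Rd d, γ ∉ integerLattice d ∧ (∀ h ∈ V, translateL2 γ h ∈ V) ∧
    minGenerators V • γ ∉ integerLattice d

/-! ### Sobolev–Slobodeckij spaces `W^{s,2}(ℝ^d)` -/

/-- `h` is the weak (distributional) partial derivative `D_i g`; used for `g, h ∈ L²(ℝ^d)`. -/
def IsWeakPartialDeriv {d : ℕ} (i : Fin d) (g h : Rd d → ℂ) : Prop :=
  ∀ φ : Rd d → ℝ, ContDiff ℝ ∞ φ → HasCompactSupport φ →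
    ∫ x, (fderiv ℝ φ x (EuclideanSpace.single i 1)) • g x = - ∫ x, φ x • h x

/-- The square of the Slobodeckij semi-norm:
`∫ ∫ |g x - g y|² / |x - y|^(d + 2θ) dy dx`, for `0 < θ < 1`. -/
def slobodeckijSeminormSq {d : ℕ} (θ : ℝ) (g : Rd d → ℂ) : ℝ≥0∞ :=
  ∫⁻ x : Rd d, ∫⁻ y : Rd d, ‖g x - g y‖ₑ ^ 2 / ‖x - y‖ₑ ^ ((d : ℝ) + 2 * θ)

/-- Membership in `W^{n+θ,2}(ℝ^d)` for `n ∈ ℕ`, `0 ≤ θ < 1`: all weak derivatives of order at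
most `n` are in `L²`, and those of order `n` have finite Slobodeckij semi-norm of order `θ`
if `θ > 0`. -/
def MemSlobodeckijAux {d : ℕ} (θ : ℝ) : ℕ → (Rd d → ℂ) → Prop
  | 0, g => MemLp g 2 volume ∧ (0 < θ → slobodeckijSeminormSq θ g < ⊤)
  | n + 1, g => MemLp g 2 volume ∧
      ∀ i : Fin d, ∃ h : Rd d → ℂ, IsWeakPartialDeriv i g h ∧ MemSlobodeckijAux θ n h

/-- Membership in the Sobolev–Slobodeckij space `W^{s,2}(ℝ^d)`, for `s > 0`. -/
def MemSlobodeckij {d : ℕ} (s : ℝ) (g : Rd d → ℂ) : Prop :=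
  MemSlobodeckijAux (s - ⌊s⌋₊) ⌊s⌋₊ g

/-! ### The Gramian and its eigenvalues -/

/-- The Gramian `P(H)(x) = ∑_{n ∈ ℤ^d} H(x+n) H(x+n)^*` of `H = (h_1, …, h_K)^T`. -/
def gramian {d K : ℕ} (H : Fin K → Rd d → ℂ) (x : Rd d) : Matrix (Fin K) (Fin K) ℂ :=
  ∑' n : Fin d → ℤ,
    Matrix.vecMulVec (fun k => H k (x + latticePoint n))
      (star (fun k => H k (x + latticePoint n)))

theorem gramian_isHermitian {d K : ℕ} (H : Fin K → Rd d → ℂ) (x : Rd d) :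
    (gramian H x).IsHermitian := by
  unfold Matrix.IsHermitian gramian
  rw [Matrix.conjTranspose_tsum]
  refine tsum_congr fun n => ?_
  rw [Matrix.conjTranspose_vecMulVec, star_star]

/-- The eigenvalues `ζ_1(x) ≥ ⋯ ≥ ζ_K(x)` of the Gramian `P(H)(x)`, listed in decreasing order
with multiplicity; the index `j : Fin K` starts at `0`, so that `j` stands for `ζ_{j+1}`. -/
def gramianEigenvalue {d K : ℕ} (H : Fin K → Rd d → ℂ) (j : Fin K) (x : Rd d) : ℝ :=
  (gramian_isHermitian H x).eigenvalues₀ (Fin.cast (Fintype.card_fin K).symm j)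

/-! ### The generalized zero set -/

/-- The cube `x + [-τ, τ]^d`. -/
def cube {d : ℕ} (x : Rd d) (τ : ℝ) : Set (Rd d) := {y | ∀ i, |y i - x i| ≤ τ}

/-- The fundamental domain `[-1/2, 1/2)^d`, identified with the torus `ℝ^d / ℤ^d`. -/
def torusDomain (d : ℕ) : Set (Rd d) := {x | ∀ i, x i ∈ Set.Ico (-(1 / 2) : ℝ) (1 / 2)}

/-- The generalized zero set `Σ(w)` of a `ℤ^d`-periodic function `w` on `ℝ^d`: the set of all
points of the torus, at which the averages of `|w|` over cubes of width `2τ` have upper limit `0`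
as `τ → 0`. -/
def zeroSet {d : ℕ} (w : Rd d → ℝ) : Set (Rd d) :=
  {x | x ∈ torusDomain d ∧
    limsup (fun τ : ℝ => (∫⁻ y in cube x τ, ‖w y‖ₑ) / volume (cube x τ)) (𝓝[>] (0 : ℝ)) = 0}

end

/-!
The `n`-th fiber of `H = F̂` at `x` is the vector `H(x + n) ∈ ℂ^K`, and the Gramian at `x` is the
sum of the rank-one operators attached to the fibers. Its eigenvalues are the squared singular
values of the fiber sequence, so each `√ζ_j` is `1`-Lipschitz for the `ℓ²`-distance of fiber
sequences, and `ζ_{r+1}` at one point is at most the squared distance to any point whose fibers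
span a space of dimension at most `r`. For almost every `x` the fibers span a space of dimension
at most `J`.

Extra invariance by `γ` provides, for almost every `x`, a linear map multiplying the `n`-th fiber
by `e^{-2πi⟨γ,n⟩}`, so the span of the fibers is the direct sum of the spans over the classes of
`n` with equal character. Passing from `x` to `x + e_i` multiplies the class labels by
`l = e^{-2πiγ_i}`. If `ζ_J` stayed away from zero along a line in the direction `e_i`, any change of
the rank of a class along this line would cost a fixed amount of distance. Along a line of finite
fractional energy these ranks are therefore constant, hence invariant under multiplication of the
label by `l`, and as they add up to `J` this forces `l ^ J = 1`. Choosing `i` with `J γ_i ∉ ℤ`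
excludes this.

Since `s > 1/2`, almost every line in the direction `e_i` carries a finite fractional energy, so
`√ζ_J` is Hölder continuous along it and has an honest zero. The Hölder bound majorizes `ζ_J` on a
whole line segment near its zero by one integrable function of the line, to which the Lebesgue
differentiation theorem applies; the averages of `ζ_J` over cubes at the zero therefore tend to
zero. So `Σ(ζ_J)` meets almost every line in the direction `e_i`, and its projection along `e_i`,
which is `1`-Lipschitz, has positive `(d - 1)`-dimensional measure.
-/

noncomputable section

open scoped InnerProductSpace

section SpectralTheorem

variable {𝕜 E : Type*} [RCLike 𝕜] [NormedAddCommGroup E] [InnerProductSpace 𝕜 E]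

theorem exists_norm_eq_one_of_mem_inf [FiniteDimensional 𝕜 E] {U V : Submodule 𝕜 E}
    (h : Module.finrank 𝕜 E < Module.finrank 𝕜 U + Module.finrank 𝕜 V) :
    ∃ v ∈ U ⊓ V, ‖v‖ = 1 := by
  have hUV : U ⊓ V ≠ ⊥ := fun hbot =>
    h.not_ge (Submodule.finrank_add_finrank_le_of_disjoint (disjoint_iff.2 hbot))
  obtain ⟨v, hv, hv0⟩ := (Submodule.ne_bot_iff _).1 hUV
  exact ⟨_, Submodule.smul_mem _ _ hv, norm_smul_inv_norm (𝕜 := 𝕜) hv0⟩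

theorem repr_apply_eq_zero_of_mem_span {ι : Type*} [Fintype ι] (b : OrthonormalBasis ι 𝕜 E)
    {s : Set ι} {v : E} (hv : v ∈ Submodule.span 𝕜 (b '' s)) {i : ι} (hi : i ∉ s) :
    b.repr v i = 0 := by
  rw [← b.coe_toBasis, Module.Basis.mem_span_image] at hv
  simpa using fun h => hi (hv (Finsupp.mem_support_iff.2 h))

theorem finrank_span_image_orthonormalBasis {ι : Type*} [Fintype ι]
    (b : OrthonormalBasis ι 𝕜 E) (s : Finset ι) :
    Module.finrank 𝕜 (Submodule.span 𝕜 (b '' (s : Set ι))) = s.card := by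
  rw [Set.image_eq_range]
  exact (finrank_span_eq_card
    (b.orthonormal.linearIndependent.comp _ Subtype.val_injective)).trans (by simp)

variable [FiniteDimensional 𝕜 E] {n : ℕ} {S T : E →ₗ[𝕜] E}

theorem re_inner_apply_self_eq_sum_eigenvalues (hS : S.IsSymmetric)
    (hn : Module.finrank 𝕜 E = n) (v : E) :
    RCLike.re ⟪v, S v⟫_𝕜 =
      ∑ i, hS.eigenvalues hn i * ‖(hS.eigenvectorBasis hn).repr v i‖ ^ 2 := by
  rw [← (hS.eigenvectorBasis hn).repr.inner_map_map, PiLp.inner_apply, map_sum]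
  refine Finset.sum_congr rfl fun i _ => ?_
  rw [hS.eigenvectorBasis_apply_self_apply hn, RCLike.inner_apply, mul_assoc,
    RCLike.re_ofReal_mul, RCLike.mul_conj, ← RCLike.ofReal_pow, RCLike.ofReal_re]

theorem eigenvalues_mul_sq_norm_le_of_mem_span_Iic (hS : S.IsSymmetric)
    (hn : Module.finrank 𝕜 E = n) {j : Fin n} {v : E}
    (hv : v ∈ Submodule.span 𝕜 (hS.eigenvectorBasis hn '' Set.Iic j)) :
    hS.eigenvalues hn j * ‖v‖ ^ 2 ≤ RCLike.re ⟪v, S v⟫_𝕜 := by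
  rw [re_inner_apply_self_eq_sum_eigenvalues hS hn, ← (hS.eigenvectorBasis hn).repr.norm_map v,
    EuclideanSpace.norm_sq_eq, Finset.mul_sum]
  refine Finset.sum_le_sum fun i _ => ?_
  rcases le_or_gt i j with hij | hij
  · gcongr
    exact hS.eigenvalues_antitone hn hij
  · simp [repr_apply_eq_zero_of_mem_span _ hv (i := i) (by simpa using hij)]

theorem re_inner_apply_self_le_of_mem_span_Ici (hS : S.IsSymmetric)
    (hn : Module.finrank 𝕜 E = n) {j : Fin n} {v : E}
    (hv : v ∈ Submodule.span 𝕜 (hS.eigenvectorBasis hn '' Set.Ici j)) :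
    RCLike.re ⟪v, S v⟫_𝕜 ≤ hS.eigenvalues hn j * ‖v‖ ^ 2 := by
  rw [re_inner_apply_self_eq_sum_eigenvalues hS hn, ← (hS.eigenvectorBasis hn).repr.norm_map v,
    EuclideanSpace.norm_sq_eq, Finset.mul_sum]
  refine Finset.sum_le_sum fun i _ => ?_
  rcases le_or_gt j i with hij | hij
  · gcongr
    exact hS.eigenvalues_antitone hn hij
  · simp [repr_apply_eq_zero_of_mem_span _ hv (i := i) (by simpa using hij)]

/-- The first `j + 1` eigenvectors of `S` and the last `n - j` eigenvectors of `T` span subspaces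
whose dimensions add up to `n + 1`. -/
theorem exists_eigenvalues_le_re_inner_and_re_inner_le (hS : S.IsSymmetric) (hT : T.IsSymmetric)
    (hn : Module.finrank 𝕜 E = n) (j : Fin n) :
    ∃ v : E, ‖v‖ = 1 ∧ hS.eigenvalues hn j ≤ RCLike.re ⟪v, S v⟫_𝕜 ∧
      RCLike.re ⟪v, T v⟫_𝕜 ≤ hT.eigenvalues hn j := by
  have hfin : Module.finrank 𝕜 E <
      Module.finrank 𝕜 (Submodule.span 𝕜 (hS.eigenvectorBasis hn '' Set.Iic j)) +
      Module.finrank 𝕜 (Submodule.span 𝕜 (hT.eigenvectorBasis hn '' Set.Ici j)) := by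
    rw [← Finset.coe_Iic, ← Finset.coe_Ici, finrank_span_image_orthonormalBasis,
      finrank_span_image_orthonormalBasis, Fin.card_Iic, Fin.card_Ici, hn]
    omega
  obtain ⟨v, ⟨hvS, hvT⟩, hv⟩ := exists_norm_eq_one_of_mem_inf hfin
  refine ⟨v, hv, ?_, ?_⟩
  · simpa [hv] using eigenvalues_mul_sq_norm_le_of_mem_span_Iic hS hn hvS
  · simpa [hv] using re_inner_apply_self_le_of_mem_span_Ici hT hn hvT

theorem eigenvectorBasis_mem_of_eigenvalues_ne_zero (hS : S.IsSymmetric)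
    (hn : Module.finrank 𝕜 E = n) {i : Fin n} (hi : hS.eigenvalues hn i ≠ 0)
    {R : Submodule 𝕜 E} (hR : ∀ v, S v ∈ R) : hS.eigenvectorBasis hn i ∈ R := by
  rw [← R.smul_mem_iff (RCLike.ofReal_ne_zero (K := 𝕜).2 hi), ← hS.apply_eigenvectorBasis hn]
  exact hR _

theorem span_eigenvectorBasis_Iic_le_of_eigenvalues_pos (hS : S.IsSymmetric)
    (hn : Module.finrank 𝕜 E = n) {j : Fin n} (hj : 0 < hS.eigenvalues hn j)
    {R : Submodule 𝕜 E} (hR : ∀ v, S v ∈ R) :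
    Submodule.span 𝕜 (hS.eigenvectorBasis hn '' Set.Iic j) ≤ R := by
  rw [Submodule.span_le]
  rintro _ ⟨i, hi, rfl⟩
  exact eigenvectorBasis_mem_of_eigenvalues_ne_zero hS hn
    (hj.trans_le (hS.eigenvalues_antitone hn hi)).ne' hR

theorem finrank_span_eigenvectorBasis_Iic (hS : S.IsSymmetric) (hn : Module.finrank 𝕜 E = n)
    (j : Fin n) :
    Module.finrank 𝕜 (Submodule.span 𝕜 (hS.eigenvectorBasis hn '' Set.Iic j)) = j + 1 := by
  rw [← Finset.coe_Iic, finrank_span_image_orthonormalBasis, Fin.card_Iic]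

theorem lt_finrank_of_eigenvalues_pos (hS : S.IsSymmetric) (hn : Module.finrank 𝕜 E = n)
    {j : Fin n} (hj : 0 < hS.eigenvalues hn j) {R : Submodule 𝕜 E} (hR : ∀ v, S v ∈ R) :
    (j : ℕ) < Module.finrank 𝕜 R := by
  have := Submodule.finrank_mono (span_eigenvectorBasis_Iic_le_of_eigenvalues_pos hS hn hj hR)
  rwa [finrank_span_eigenvectorBasis_Iic] at this

theorem eigenvalues_mul_sq_norm_le_of_finrank_le (hS : S.IsPositive)
    (hn : Module.finrank 𝕜 E = n) {R : Submodule 𝕜 E} (hR : ∀ v, S v ∈ R) {j : Fin n}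
    (hj : Module.finrank 𝕜 R ≤ j + 1) {v : E} (hv : v ∈ R) :
    hS.isSymmetric.eigenvalues hn j * ‖v‖ ^ 2 ≤ RCLike.re ⟪v, S v⟫_𝕜 := by
  rcases (hS.nonneg_eigenvalues hn j).eq_or_lt' with h0 | hpos
  · rw [h0, zero_mul]
    exact hS.re_inner_nonneg_right v
  · have hle := span_eigenvectorBasis_Iic_le_of_eigenvalues_pos hS.isSymmetric hn hpos hR
    rw [← Submodule.eq_of_le_of_finrank_le hle
      (hj.trans_eq (finrank_span_eigenvectorBasis_Iic hS.isSymmetric hn j).symm)] at hv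
    exact eigenvalues_mul_sq_norm_le_of_mem_span_Iic hS.isSymmetric hn hv

end SpectralTheorem

section ClassSpan

variable {k M ι : Type*} [Field k] [AddCommGroup M] [Module k M]

/-- The span of the members `φ n` of a family of vectors whose colour `c n` is `a`. If the colours
are eigenvalues of an operator for the eigenvectors `φ n`, this is the `a`-eigenspace of that
operator on the span of `φ`. -/
def classSpan (c : ι → k) (φ : ι → M) (a : k) : Submodule k M :=
  Submodule.span k (φ '' {n | c n = a})

variable {c : ι → k} {φ : ι → M}

theorem iSup_classSpan (c : ι → k) (φ : ι → M) :
    ⨆ a, classSpan c φ a = Submodule.span k (Set.range φ) := by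
  simp only [classSpan]
  rw [← Submodule.span_iUnion, ← Set.image_iUnion, ← Set.image_univ]
  congr 2
  ext n
  simp

theorem classSpan_eq_bot_of_notMem_range {a : k} (ha : a ∉ Set.range c) :
    classSpan c φ a = ⊥ := by
  have hclass : {n | c n = a} = ∅ := Set.eq_empty_of_forall_notMem fun n hn => ha ⟨n, hn⟩
  rw [classSpan, hclass, Set.image_empty, Submodule.span_empty]

theorem classSpan_add_right {G : Type*} [AddGroup G] {c : G → k} {φ : G → M} {m : G} {l : k}
    (hl : l ≠ 0) (hc : ∀ n, c (n + m) = c n * l) (a : k) :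
    classSpan c (fun n => φ (n + m)) a = classSpan c φ (a * l) := by
  have hclass : {n | c n = a * l} = (· + m) '' {n | c n = a} := by
    ext n
    have hcn := hc (n - m)
    rw [sub_add_cancel] at hcn
    simp [Set.image_add_right, ← sub_eq_add_neg, hcn, hl]
  rw [classSpan, classSpan, hclass, Set.image_image]

theorem iSupIndep_classSpan {B : M →ₗ[k] M} (hB : ∀ n, B (φ n) = c n • φ n) :
    iSupIndep (classSpan c φ) := by
  refine (Module.End.eigenspaces_iSupIndep B).mono fun a => ?_
  rw [classSpan, Submodule.span_le]
  rintro _ ⟨n, rfl, rfl⟩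
  exact Module.End.mem_eigenspace_iff.2 (hB n)

theorem disjoint_classSpan_span_image_ne {B : M →ₗ[k] M} (hB : ∀ n, B (φ n) = c n • φ n) (a : k) :
    Disjoint (classSpan c φ a) (Submodule.span k (φ '' {n | c n ≠ a})) := by
  refine (iSupIndep_classSpan hB a).mono_right (Submodule.span_le.2 ?_)
  rintro _ ⟨n, hn, rfl⟩
  exact Submodule.mem_iSup_of_mem (c n) (Submodule.mem_iSup_of_mem hn
    (Submodule.subset_span ⟨n, rfl, rfl⟩))

theorem classSpan_sup_span_image_ne (c : ι → k) (φ : ι → M) (a : k) :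
    classSpan c φ a ⊔ Submodule.span k (φ '' {n | c n ≠ a}) =
      Submodule.span k (Set.range φ) := by
  rw [classSpan, ← Submodule.span_union, ← Set.image_union, ← Set.image_univ]
  congr 2
  ext n
  simp [em]

theorem finrank_finsetSup_of_supIndep {α : Type*} [FiniteDimensional k M]
    {p : α → Submodule k M} {s : Finset α} (hp : s.SupIndep p) :
    Module.finrank k (s.sup p : Submodule k M) = ∑ a ∈ s, Module.finrank k (p a) := by
  classical
  induction s using Finset.induction_on with
  | empty => simp
  | insert a s ha ih =>
    have hdisj : Disjoint (p a) (s.sup p) :=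
      hp (Finset.subset_insert a s) (Finset.mem_insert_self a s) ha
    have hsum := Submodule.finrank_sup_add_finrank_inf_eq (p a) (s.sup p)
    rw [hdisj.eq_bot, finrank_bot, add_zero] at hsum
    rw [Finset.sup_insert, hsum, ih (hp.subset (Finset.subset_insert a s)),
      Finset.sum_insert ha]

theorem finrank_iSup_eq_sum_of_iSupIndep {α : Type*} [FiniteDimensional k M]
    {p : α → Submodule k M} (hp : iSupIndep p) {s : Finset α} (hs : ∀ a ∉ s, p a = ⊥) :
    Module.finrank k (⨆ a, p a : Submodule k M) = ∑ a ∈ s, Module.finrank k (p a) := by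
  classical
  have hsup : ⨆ a, p a = s.sup p := by
    refine le_antisymm (iSup_le fun a => ?_) (Finset.sup_le fun a _ => le_iSup p a)
    by_cases ha : a ∈ s
    · exact Finset.le_sup ha
    · simp [hs a ha]
  rw [hsup, finrank_finsetSup_of_supIndep (hp.supIndep' s)]

/-- Compare the product of `a ^ r a` over all `a` with its reindexing along `a ↦ a * l`. -/
theorem pow_sum_eq_one_of_forall_mul_right_eq {r : k → ℕ} {s : Finset k}
    (hs : ∀ a, a ∈ s ↔ r a ≠ 0) (h0 : r 0 = 0) {l : k} (hl : l ≠ 0)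
    (hr : ∀ a, r (a * l) = r a) : l ^ ∑ a ∈ s, r a = 1 := by
  have hreindex : ∏ a ∈ s, (a * l) ^ r a = ∏ a ∈ s, a ^ r a :=
    Finset.prod_equiv (Equiv.mulRight₀ l hl) (fun a => by simp [hs, hr]) fun a _ => by simp [hr]
  simp_rw [mul_pow, Finset.prod_mul_distrib, Finset.prod_pow_eq_pow_sum] at hreindex
  refine (mul_eq_left₀ (Finset.prod_ne_zero_iff.2 fun a ha => pow_ne_zero _ ?_)).1 hreindex
  rintro rfl
  exact (hs 0).1 ha h0

theorem pow_finrank_eq_one_of_finrank_classSpan_mul_eq [FiniteDimensional k M] {B : M →ₗ[k] M}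
    (hB : ∀ n, B (φ n) = c n • φ n) (hc : ∀ n, c n ≠ 0) {l : k} (hl : l ≠ 0)
    (h : ∀ a, Module.finrank k (classSpan c φ (a * l)) = Module.finrank k (classSpan c φ a)) :
    l ^ Module.finrank k (Submodule.span k (Set.range φ)) = 1 := by
  have hfin := WellFoundedGT.finite_ne_bot_of_iSupIndep (iSupIndep_classSpan hB)
  rw [← iSup_classSpan c φ, finrank_iSup_eq_sum_of_iSupIndep (iSupIndep_classSpan hB)
    (s := hfin.toFinset) (by simp)]
  exact pow_sum_eq_one_of_forall_mul_right_eq (by simp [Submodule.finrank_eq_zero])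
    (by rw [classSpan_eq_bot_of_notMem_range fun ⟨n, hn⟩ => hc n hn, finrank_bot]) hl h

end ClassSpan

section FrameOperator

variable {𝕜 E ι : Type*} [RCLike 𝕜] [NormedAddCommGroup E] [InnerProductSpace 𝕜 E]

/-- `Q` is the frame operator `v ↦ ∑ ⟪φ n, v⟫ φ n` of the family `φ`; the series is required to
converge unconditionally for every `v`. -/
def IsFrameOperator (φ : ι → E) (Q : E →ₗ[𝕜] E) : Prop :=
  ∀ v, HasSum (fun n => ⟪φ n, v⟫_𝕜 • φ n) (Q v)

variable {φ ψ : ι → E} {P Q : E →ₗ[𝕜] E}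

namespace IsFrameOperator

theorem hasSum_inner_mul_inner (hQ : IsFrameOperator φ Q) (u v : E) :
    HasSum (fun n => ⟪φ n, v⟫_𝕜 * ⟪u, φ n⟫_𝕜) ⟪u, Q v⟫_𝕜 := by
  simpa only [innerSL_apply_apply, inner_smul_right] using (hQ v).mapL (innerSL 𝕜 u)

theorem hasSum_norm_inner_sq (hQ : IsFrameOperator φ Q) (v : E) :
    HasSum (fun n => ‖⟪φ n, v⟫_𝕜‖ ^ 2) (RCLike.re ⟪v, Q v⟫_𝕜) := by
  refine ((hQ.hasSum_inner_mul_inner v v).mapL RCLike.reCLM).congr_fun fun n => ?_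
  rw [RCLike.reCLM_apply, ← inner_conj_symm v (φ n), RCLike.mul_conj, ← RCLike.ofReal_pow,
    RCLike.ofReal_re]

theorem isSymmetric (hQ : IsFrameOperator φ Q) : Q.IsSymmetric := by
  intro u v
  refine HasSum.unique ?_ (hQ.hasSum_inner_mul_inner u v)
  rw [← inner_conj_symm]
  refine ((hQ.hasSum_inner_mul_inner v u).map (starRingEnd 𝕜) RCLike.continuous_conj).congr_fun
    fun n => ?_
  simp [mul_comm]

theorem isPositive (hQ : IsFrameOperator φ Q) : Q.IsPositive := by
  refine ⟨hQ.isSymmetric, fun v => ?_⟩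
  rw [← inner_conj_symm, RCLike.conj_re]
  exact (hQ.hasSum_norm_inner_sq v).nonneg fun n => sq_nonneg _

theorem apply_mem_span_range [FiniteDimensional 𝕜 E] (hQ : IsFrameOperator φ Q) (v : E) :
    Q v ∈ Submodule.span 𝕜 (Set.range φ) :=
  (Submodule.closed_of_finiteDimensional _).mem_of_tendsto (hQ v) (.of_forall fun _ =>
    Submodule.sum_mem _ fun n _ => Submodule.smul_mem _ _ (Submodule.subset_span ⟨n, rfl⟩))

end IsFrameOperator

theorem norm_inner_sq_le_of_norm_eq_one {v : E} (hv : ‖v‖ = 1) (u : E) :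
    ‖⟪u, v⟫_𝕜‖ ^ 2 ≤ ‖u‖ ^ 2 := by
  have := norm_inner_le_norm (𝕜 := 𝕜) u v
  rw [hv, mul_one] at this
  gcongr

theorem summable_norm_inner_sq_of_norm_eq_one {v : E} (hv : ‖v‖ = 1)
    (hφ : Summable fun n => ‖φ n‖ ^ 2) : Summable fun n => ‖⟪φ n, v⟫_𝕜‖ ^ 2 :=
  hφ.of_nonneg_of_le (fun _ => sq_nonneg _) fun n => norm_inner_sq_le_of_norm_eq_one hv (φ n)

theorem tsum_norm_inner_sq_le_of_norm_eq_one {v : E} (hv : ‖v‖ = 1)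
    (hφ : Summable fun n => ‖φ n‖ ^ 2) : ∑' n, ‖⟪φ n, v⟫_𝕜‖ ^ 2 ≤ ∑' n, ‖φ n‖ ^ 2 :=
  (summable_norm_inner_sq_of_norm_eq_one hv hφ).tsum_le_tsum
    (fun n => norm_inner_sq_le_of_norm_eq_one hv (φ n)) hφ

theorem sqrt_tsum_norm_sq_le_add {F : Type*} [SeminormedAddCommGroup F] {a b : ι → F}
    (hb : Summable fun n => ‖b n‖ ^ 2) (hab : Summable fun n => ‖a n - b n‖ ^ 2) :
    √(∑' n, ‖a n‖ ^ 2) ≤ √(∑' n, ‖b n‖ ^ 2) + √(∑' n, ‖a n - b n‖ ^ 2) := by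
  obtain ⟨hsum, hle⟩ := Real.Lp_add_le_tsum_of_nonneg (p := 2) one_le_two
    (fun n => norm_nonneg (b n)) (fun n => norm_nonneg (a n - b n))
    (by simpa using hb) (by simpa using hab)
  simp only [Real.rpow_ofNat, ← Real.sqrt_eq_rpow] at hsum hle
  have htri (n : ι) : ‖a n‖ ^ 2 ≤ (‖b n‖ + ‖a n - b n‖) ^ 2 := by
    gcongr
    exact norm_le_insert' (a n) (b n)
  exact (Real.sqrt_le_sqrt
    ((hsum.of_nonneg_of_le (fun _ => sq_nonneg _) htri).tsum_le_tsum htri hsum)).trans hle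

variable [FiniteDimensional 𝕜 E]

theorem IsFrameOperator.sqrt_eigenvalues_le_add (hQ : IsFrameOperator φ Q)
    (hP : IsFrameOperator ψ P) (hφψ : Summable fun n => ‖φ n - ψ n‖ ^ 2) {n : ℕ}
    (hn : Module.finrank 𝕜 E = n) (j : Fin n) :
    √(hQ.isSymmetric.eigenvalues hn j) ≤
      √(hP.isSymmetric.eigenvalues hn j) + √(∑' n, ‖φ n - ψ n‖ ^ 2) := by
  obtain ⟨v, hv, hQv, hPv⟩ :=
    exists_eigenvalues_le_re_inner_and_re_inner_le hQ.isSymmetric hP.isSymmetric hn j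
  have htri := sqrt_tsum_norm_sq_le_add (a := fun n => ⟪φ n, v⟫_𝕜)
    (hP.hasSum_norm_inner_sq v).summable
    (by simpa only [inner_sub_left] using summable_norm_inner_sq_of_norm_eq_one hv hφψ)
  simp only [← inner_sub_left, (hQ.hasSum_norm_inner_sq v).tsum_eq,
    (hP.hasSum_norm_inner_sq v).tsum_eq] at htri
  calc √(hQ.isSymmetric.eigenvalues hn j) ≤ √(RCLike.re ⟪v, Q v⟫_𝕜) := Real.sqrt_le_sqrt hQv
    _ ≤ √(RCLike.re ⟪v, P v⟫_𝕜) + √(∑' n, ‖⟪φ n - ψ n, v⟫_𝕜‖ ^ 2) := htri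
    _ ≤ √(hP.isSymmetric.eigenvalues hn j) + √(∑' n, ‖φ n - ψ n‖ ^ 2) :=
      add_le_add (Real.sqrt_le_sqrt hPv)
        (Real.sqrt_le_sqrt (tsum_norm_inner_sq_le_of_norm_eq_one hv hφψ))

theorem finrank_orthogonal_span_image_ne_inf_span_range {c : ι → 𝕜} {B : E →ₗ[𝕜] E}
    (hB : ∀ n, B (φ n) = c n • φ n) (a : 𝕜) :
    Module.finrank 𝕜 ((Submodule.span 𝕜 (φ '' {n | c n ≠ a}))ᗮ ⊓
      Submodule.span 𝕜 (Set.range φ) : Submodule 𝕜 E) = Module.finrank 𝕜 (classSpan c φ a) := by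
  have hcompl := Submodule.finrank_add_inf_finrank_orthogonal
    (Submodule.span_mono (R := 𝕜) (Set.image_subset_range φ {n | c n ≠ a}))
  have hsum := Submodule.finrank_sup_add_finrank_inf_eq (classSpan c φ a)
    (Submodule.span 𝕜 (φ '' {n | c n ≠ a}))
  rw [classSpan_sup_span_image_ne, (disjoint_classSpan_span_image_ne hB a).eq_bot,
    finrank_bot] at hsum
  omega

/-- Some unit vector `v` of the span of `φ` is orthogonal to all `φ n` of colour `≠ a` and to all
`ψ n` of colour `a`, so that `|⟪φ n, v⟫| ≤ |⟪φ n - ψ n, v⟫|` for all `n`. -/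
theorem IsFrameOperator.eigenvalues_le_of_finrank_classSpan_lt (hQ : IsFrameOperator φ Q)
    {c : ι → 𝕜} {B : E →ₗ[𝕜] E} (hB : ∀ n, B (φ n) = c n • φ n)
    (hφψ : Summable fun n => ‖φ n - ψ n‖ ^ 2) {n : ℕ} (hn : Module.finrank 𝕜 E = n) {j : Fin n}
    (hj : Module.finrank 𝕜 (Submodule.span 𝕜 (Set.range φ)) ≤ j + 1) {a : 𝕜}
    (ha : Module.finrank 𝕜 (classSpan c ψ a) < Module.finrank 𝕜 (classSpan c φ a)) :
    hQ.isSymmetric.eigenvalues hn j ≤ ∑' n, ‖φ n - ψ n‖ ^ 2 := by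
  have hdim : Module.finrank 𝕜 E <
      Module.finrank 𝕜 ((Submodule.span 𝕜 (φ '' {n | c n ≠ a}))ᗮ ⊓
        Submodule.span 𝕜 (Set.range φ) : Submodule 𝕜 E) +
      Module.finrank 𝕜 ((classSpan c ψ a)ᗮ : Submodule 𝕜 E) := by
    rw [finrank_orthogonal_span_image_ne_inf_span_range hB,
      ← Submodule.finrank_add_finrank_orthogonal (classSpan c ψ a)]
    gcongr
  obtain ⟨v, ⟨⟨hvφ, hvrange⟩, hvψ⟩, hv⟩ := exists_norm_eq_one_of_mem_inf hdim
  have hterm (n : ι) : ‖⟪φ n, v⟫_𝕜‖ ^ 2 ≤ ‖⟪φ n - ψ n, v⟫_𝕜‖ ^ 2 := by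
    by_cases hn : c n = a
    · have : ⟪ψ n, v⟫_𝕜 = 0 := hvψ _ (Submodule.subset_span ⟨n, hn, rfl⟩)
      rw [inner_sub_left, this, sub_zero]
    · have : ⟪φ n, v⟫_𝕜 = 0 := hvφ _ (Submodule.subset_span ⟨n, hn, rfl⟩)
      simp [this]
  calc hQ.isSymmetric.eigenvalues hn j = hQ.isSymmetric.eigenvalues hn j * ‖v‖ ^ 2 := by simp [hv]
    _ ≤ RCLike.re ⟪v, Q v⟫_𝕜 :=
      eigenvalues_mul_sq_norm_le_of_finrank_le hQ.isPositive hn hQ.apply_mem_span_range hj hvrange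
    _ = ∑' n, ‖⟪φ n, v⟫_𝕜‖ ^ 2 := (hQ.hasSum_norm_inner_sq v).tsum_eq.symm
    _ ≤ ∑' n, ‖⟪φ n - ψ n, v⟫_𝕜‖ ^ 2 := (hQ.hasSum_norm_inner_sq v).summable.tsum_le_tsum hterm
      (summable_norm_inner_sq_of_norm_eq_one hv hφψ)
    _ ≤ ∑' n, ‖φ n - ψ n‖ ^ 2 := tsum_norm_inner_sq_le_of_norm_eq_one hv hφψ

end FrameOperator

section Fiber

theorem toReal_tsum_enorm_sq {ι E : Type*} [SeminormedAddCommGroup E] (f : ι → E) :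
    (∑' n, ‖f n‖ₑ ^ 2).toReal = ∑' n, ‖f n‖ ^ 2 := by
  simp [ENNReal.tsum_toReal_eq]

theorem summable_norm_sq_of_tsum_enorm_sq_ne_top {ι E : Type*} [SeminormedAddCommGroup E]
    {f : ι → E} (h : ∑' n, ‖f n‖ₑ ^ 2 ≠ ⊤) : Summable fun n => ‖f n‖ ^ 2 := by
  simpa using ENNReal.summable_toReal h

/-- The sequence of vectors `(H_1(x + n), …, H_K(x + n))`, `n ∈ ℤ^d`: the fiber at `x` of the family
`H`, of which the Gramian `P(H)(x)` is the frame operator. -/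
def fiber {d K : ℕ} (H : Fin K → Rd d → ℂ) (x : Rd d) (n : Fin d → ℤ) :
    EuclideanSpace ℂ (Fin K) :=
  WithLp.toLp 2 fun k => H k (x + latticePoint n)

/-- The squared `ℓ²`-norm of the fiber of `H` at `x`, with value `⊤` if the fiber is not in `ℓ²`. -/
def fiberNormSq {d K : ℕ} (H : Fin K → Rd d → ℂ) (x : Rd d) : ℝ≥0∞ :=
  ∑' n, ‖fiber H x n‖ₑ ^ 2

/-- The squared `ℓ²`-distance of the fibers of `H` at `x` and `y`, which controls the variation of
the eigenvalues of the Gramian. -/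
def fiberDistSq {d K : ℕ} (H : Fin K → Rd d → ℂ) (x y : Rd d) : ℝ≥0∞ :=
  ∑' n, ‖fiber H x n - fiber H y n‖ₑ ^ 2

variable {d K : ℕ} {H : Fin K → Rd d → ℂ} {x y : Rd d}

theorem fiberDistSq_comm (H : Fin K → Rd d → ℂ) (x y : Rd d) :
    fiberDistSq H x y = fiberDistSq H y x :=
  tsum_congr fun _ => by rw [← edist_eq_enorm_sub, ← edist_eq_enorm_sub, edist_comm]

theorem measurable_fiber (hH : ∀ k, Measurable (H k)) (n : Fin d → ℤ) :
    Measurable fun x => fiber H x n :=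
  (WithLp.measurable_toLp 2 _).comp
    (measurable_pi_lambda _ fun k => (hH k).comp (measurable_id.add_const _))

theorem measurable_fiberNormSq (hH : ∀ k, Measurable (H k)) : Measurable (fiberNormSq H) :=
  Measurable.tsum fun n => (measurable_fiber hH n).enorm.pow_const 2

theorem measurable_fiberDistSq (hH : ∀ k, Measurable (H k)) :
    Measurable fun p : Rd d × Rd d => fiberDistSq H p.1 p.2 :=
  Measurable.tsum fun n => (((measurable_fiber hH n).comp measurable_fst).sub
    ((measurable_fiber hH n).comp measurable_snd)).enorm.pow_const 2

theorem le_finrank_span_image_iff {k M ι : Type*} [Field k] [AddCommGroup M] [Module k M]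
    [FiniteDimensional k M] {φ : ι → M} {s : Set ι} {r : ℕ} :
    r ≤ Module.finrank k (Submodule.span k (φ '' s)) ↔
      ∃ m : Fin r → s, LinearIndependent k fun i => φ (m i) := by
  constructor
  · intro hr
    obtain ⟨f, hf, -, hli⟩ := Submodule.exists_fun_fin_finrank_span_eq k (φ '' s)
    choose g hg hgf using hf
    refine ⟨fun i => ⟨g (Fin.castLE hr i), hg _⟩, ?_⟩
    simpa only [Function.comp_def, hgf] using hli.comp (Fin.castLE hr) (Fin.castLE_injective hr)
  · rintro ⟨m, hm⟩
    rw [← Fintype.card_fin r, ← finrank_span_eq_card hm]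
    refine Submodule.finrank_mono (Submodule.span_mono ?_)
    rintro _ ⟨i, rfl⟩
    exact ⟨m i, (m i).2, rfl⟩

theorem measurable_finrank_span_image {α ι V : Type*} [MeasurableSpace α] [Countable ι]
    [NormedAddCommGroup V] [NormedSpace ℂ V] [FiniteDimensional ℂ V] [MeasurableSpace V]
    [BorelSpace V] {φ : α → ι → V} (hφ : ∀ n, Measurable fun x => φ x n) (s : Set ι) :
    Measurable fun x => Module.finrank ℂ (Submodule.span ℂ (φ x '' s)) := by
  have : SecondCountableTopology V := secondCountable_of_proper
  refine measurable_of_Ici fun r => ?_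
  simp only [Set.preimage, Set.mem_Ici, le_finrank_span_image_iff, Set.ofPred_exists]
  refine MeasurableSet.iUnion fun m => ?_
  exact (measurable_pi_lambda (fun x i => φ x (m i)) fun i => hφ (m i))
    isOpen_setOfPred_linearIndependent.measurableSet

end Fiber

section Gramian

variable {d K : ℕ} {H : Fin K → Rd d → ℂ} {x y : Rd d}

theorem hasSum_gramian (hx : fiberNormSq H x ≠ ⊤) :
    HasSum (fun n : Fin d → ℤ => Matrix.vecMulVec (fun k => H k (x + latticePoint n))
      (star (fun k => H k (x + latticePoint n)))) (gramian H x) := by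
  refine Summable.hasSum (Pi.summable.2 fun i => Pi.summable.2 fun j =>
    (summable_norm_sq_of_tsum_enorm_sq_ne_top hx).of_norm_bounded fun n => ?_)
  have hentry (k : Fin K) : ‖H k (x + latticePoint n)‖ ≤ ‖fiber H x n‖ :=
    PiLp.norm_apply_le (fiber H x n) k
  rw [Matrix.vecMulVec_apply, Pi.star_apply, norm_mul, norm_star, sq]
  gcongr <;> exact hentry _

theorem isFrameOperator_gramian (hx : fiberNormSq H x ≠ ⊤) :
    IsFrameOperator (fiber H x) (Matrix.toEuclideanLin (gramian H x)) := by
  intro v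
  let L : Matrix (Fin K) (Fin K) ℂ →ₗ[ℂ] EuclideanSpace ℂ (Fin K) :=
    LinearMap.applyₗ v ∘ₗ (Matrix.toEuclideanLin (𝕜 := ℂ)).toLinearMap
  refine ((hasSum_gramian hx).map L L.continuous_of_finiteDimensional).congr_fun fun n => ?_
  ext k
  simp [L, fiber, Matrix.vecMulVec_mulVec, PiLp.inner_apply, dotProduct, Finset.mul_sum, mul_comm,
    mul_left_comm]

theorem gramianEigenvalue_nonneg (hx : fiberNormSq H x ≠ ⊤) (j : Fin K) :
    0 ≤ gramianEigenvalue H j x :=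
  (isFrameOperator_gramian hx).isPositive.nonneg_eigenvalues _ _

theorem ofReal_gramianEigenvalue_le_fiberNormSq (hx : fiberNormSq H x ≠ ⊤) (j : Fin K) :
    ENNReal.ofReal (gramianEigenvalue H j x) ≤ fiberNormSq H x := by
  have hG := isFrameOperator_gramian hx
  obtain ⟨v, hv, hle, -⟩ := exists_eigenvalues_le_re_inner_and_re_inner_le hG.isSymmetric
    hG.isSymmetric finrank_euclideanSpace (Fin.cast (Fintype.card_fin K).symm j)
  refine ENNReal.ofReal_le_of_le_toReal (hle.trans ?_)
  rw [← (hG.hasSum_norm_inner_sq v).tsum_eq, fiberNormSq, toReal_tsum_enorm_sq]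
  exact tsum_norm_inner_sq_le_of_norm_eq_one hv (summable_norm_sq_of_tsum_enorm_sq_ne_top hx)

theorem sqrt_gramianEigenvalue_le_add (hx : fiberNormSq H x ≠ ⊤) (hy : fiberNormSq H y ≠ ⊤)
    (hxy : fiberDistSq H x y ≠ ⊤) (j : Fin K) :
    √(gramianEigenvalue H j x) ≤ √(gramianEigenvalue H j y) + √(fiberDistSq H x y).toReal := by
  rw [fiberDistSq, toReal_tsum_enorm_sq]
  exact (isFrameOperator_gramian hx).sqrt_eigenvalues_le_add (isFrameOperator_gramian hy)
    (summable_norm_sq_of_tsum_enorm_sq_ne_top hxy) finrank_euclideanSpace _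

theorem ofReal_sq_sqrt_gramianEigenvalue_sub_le (hx : fiberNormSq H x ≠ ⊤)
    (hy : fiberNormSq H y ≠ ⊤) (j : Fin K) :
    ENNReal.ofReal ((√(gramianEigenvalue H j x) - √(gramianEigenvalue H j y)) ^ 2) ≤
      fiberDistSq H x y := by
  rcases eq_or_ne (fiberDistSq H x y) ⊤ with hD | hD
  · exact hD ▸ le_top
  have hxy := sqrt_gramianEigenvalue_le_add hx hy hD j
  have hyx := sqrt_gramianEigenvalue_le_add hy hx (fiberDistSq_comm H x y ▸ hD) j
  rw [fiberDistSq_comm H y x] at hyx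
  refine ENNReal.ofReal_le_of_le_toReal ?_
  rw [← Real.sq_sqrt (ENNReal.toReal_nonneg (a := fiberDistSq H x y))]
  exact sq_le_sq' (by linarith) (by linarith)

theorem ofReal_gramianEigenvalue_le_fiberDistSq (hx : fiberNormSq H x ≠ ⊤)
    {c : (Fin d → ℤ) → ℂ} {B : EuclideanSpace ℂ (Fin K) →ₗ[ℂ] EuclideanSpace ℂ (Fin K)}
    (hB : ∀ n, B (fiber H x n) = c n • fiber H x n) {j : Fin K}
    (hj : Module.finrank ℂ (Submodule.span ℂ (Set.range (fiber H x))) ≤ j + 1) {a : ℂ}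
    (ha : Module.finrank ℂ (classSpan c (fiber H y) a) <
      Module.finrank ℂ (classSpan c (fiber H x) a)) :
    ENNReal.ofReal (gramianEigenvalue H j x) ≤ fiberDistSq H x y := by
  rcases eq_or_ne (fiberDistSq H x y) ⊤ with hD | hD
  · exact hD ▸ le_top
  refine ENNReal.ofReal_le_of_le_toReal ?_
  rw [fiberDistSq, toReal_tsum_enorm_sq]
  exact (isFrameOperator_gramian hx).eigenvalues_le_of_finrank_classSpan_lt hB
    (summable_norm_sq_of_tsum_enorm_sq_ne_top hD) finrank_euclideanSpace hj ha

theorem gramianEigenvalue_eq_zero_of_finrank_le (hx : fiberNormSq H x ≠ ⊤) {j : Fin K}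
    (hj : Module.finrank ℂ (Submodule.span ℂ (Set.range (fiber H x))) ≤ j) :
    gramianEigenvalue H j x = 0 := by
  have hG := isFrameOperator_gramian hx
  by_contra hne
  exact hj.not_gt (lt_finrank_of_eigenvalues_pos hG.isSymmetric finrank_euclideanSpace
    (j := Fin.cast (Fintype.card_fin K).symm j)
    ((gramianEigenvalue_nonneg hx j).lt_of_ne' hne) hG.apply_mem_span_range)

end Gramian

section Measurability

variable {𝕜 n : Type*} [RCLike 𝕜] [Fintype n] [DecidableEq n]

theorem eigenvalues₀_le_add_norm_sub {A B : Matrix n n 𝕜} (hA : A.IsHermitian)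
    (hB : B.IsHermitian) (j : Fin (Fintype.card n)) :
    hA.eigenvalues₀ j ≤ hB.eigenvalues₀ j + ‖Matrix.toEuclideanCLM (𝕜 := 𝕜) (A - B)‖ := by
  obtain ⟨v, hv, hAv, hBv⟩ := exists_eigenvalues_le_re_inner_and_re_inner_le
    (Matrix.isSymmetric_toEuclideanLin_iff.2 hA) (Matrix.isSymmetric_toEuclideanLin_iff.2 hB)
    finrank_euclideanSpace j
  have hnorm : RCLike.re ⟪v, Matrix.toEuclideanCLM (𝕜 := 𝕜) (A - B) v⟫_𝕜 ≤
      ‖Matrix.toEuclideanCLM (𝕜 := 𝕜) (A - B)‖ := by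
    refine (re_inner_le_norm _ _).trans ?_
    simpa [hv] using (Matrix.toEuclideanCLM (𝕜 := 𝕜) (A - B)).le_opNorm v
  have hsub : Matrix.toEuclideanCLM (𝕜 := 𝕜) (A - B) v =
      Matrix.toEuclideanLin A v - Matrix.toEuclideanLin B v := by
    rw [← LinearMap.sub_apply, ← map_sub]
    rfl
  rw [hsub, inner_sub_right, map_sub] at hnorm
  change hA.eigenvalues₀ j ≤ _ at hAv
  change _ ≤ hB.eigenvalues₀ j at hBv
  linarith

theorem abs_eigenvalues₀_sub_le {A B : Matrix n n 𝕜} (hA : A.IsHermitian)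
    (hB : B.IsHermitian) (j : Fin (Fintype.card n)) :
    |hA.eigenvalues₀ j - hB.eigenvalues₀ j| ≤ ‖Matrix.toEuclideanCLM (𝕜 := 𝕜) (A - B)‖ := by
  have hAB := eigenvalues₀_le_add_norm_sub hA hB j
  have hBA := eigenvalues₀_le_add_norm_sub hB hA j
  rw [← neg_sub, map_neg, norm_neg] at hBA
  exact abs_sub_le_iff.2 ⟨by linarith, by linarith⟩

theorem continuous_eigenvalues₀ (j : Fin (Fintype.card n)) :
    Continuous fun A : {A : Matrix n n 𝕜 // A.IsHermitian} => A.2.eigenvalues₀ j := by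
  let L : Matrix n n 𝕜 →ₗ[𝕜] (EuclideanSpace 𝕜 n →L[𝕜] EuclideanSpace 𝕜 n) :=
    (Matrix.toEuclideanCLM (n := n) (𝕜 := 𝕜)).toAlgEquiv.toLinearEquiv.toLinearMap
  have hL : Continuous L := L.continuous_of_finiteDimensional
  refine continuous_iff_continuousAt.2 fun A => tendsto_iff_norm_sub_tendsto_zero.2 ?_
  refine squeeze_zero (fun _ => norm_nonneg _) (fun B => abs_eigenvalues₀_sub_le B.2 A.2 j) ?_
  have hnorm : Continuous fun B : {B : Matrix n n 𝕜 // B.IsHermitian} => ‖L (B.1 - A.1)‖ := by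
    fun_prop
  have hlim := hnorm.tendsto A
  rwa [sub_self, map_zero, norm_zero] at hlim

theorem measurable_eigenvalues₀ {α : Type*} [MeasurableSpace α] {A : α → Matrix n n 𝕜}
    (hA : ∀ i k, Measurable fun x => A x i k) (hherm : ∀ x, (A x).IsHermitian)
    (j : Fin (Fintype.card n)) : Measurable fun x => (hherm x).eigenvalues₀ j := by
  borelize (Matrix n n 𝕜)
  have hmeas : Measurable A :=
    (show Continuous fun B : n → n → 𝕜 => Matrix.of B from continuous_id).measurable.comp
      (measurable_pi_lambda _ fun i => measurable_pi_lambda _ fun k => hA i k)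
  have heig : Measurable fun B : {B : Matrix n n 𝕜 // B.IsHermitian} => B.2.eigenvalues₀ j :=
    (continuous_eigenvalues₀ j).measurable
  have hcomp := heig.comp (hmeas.subtype_mk (h := hherm))
  simpa only [Function.comp_def] using hcomp

theorem measurable_gramianEigenvalue {d K : ℕ} {H : Fin K → Rd d → ℂ}
    (hH : ∀ k, Measurable (H k)) (j : Fin K) : Measurable (gramianEigenvalue H j) := by
  have hshift (n : Fin d → ℤ) (k : Fin K) : Measurable fun x => H k (x + latticePoint n) :=
    (hH k).comp (measurable_id.add_const _)
  have hgram : Measurable fun x => ∑' n : Fin d → ℤ, fun i k : Fin K =>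
      H i (x + latticePoint n) * star (H k (x + latticePoint n)) :=
    Measurable.tsum fun n => measurable_pi_lambda _ fun i => measurable_pi_lambda _ fun k =>
      (hshift n i).mul (continuous_star.measurable.comp (hshift n k))
  exact measurable_eigenvalues₀ (fun i k => (measurable_pi_apply k).comp
    ((measurable_pi_apply i).comp hgram)) (gramian_isHermitian H) _

end Measurability

section Jensen

variable {α E : Type*} [MeasurableSpace α] {μ : Measure α} [NormedAddCommGroup E]

theorem sq_eLpNorm_two (f : α → E) (μ : Measure α) :
    eLpNorm f 2 μ ^ 2 = ∫⁻ x, ‖f x‖ₑ ^ 2 ∂μ := by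
  rw [← ENNReal.rpow_natCast]
  simpa using eLpNorm_nnreal_pow_eq_lintegral (f := f) (μ := μ) two_ne_zero

variable [NormedSpace ℝ E]

theorem sq_enorm_integral_le_lintegral [IsProbabilityMeasure μ] {f : α → E}
    (hf : AEStronglyMeasurable f μ) : ‖∫ x, f x ∂μ‖ₑ ^ 2 ≤ ∫⁻ x, ‖f x‖ₑ ^ 2 ∂μ := by
  rw [← sq_eLpNorm_two]
  gcongr
  calc ‖∫ x, f x ∂μ‖ₑ ≤ ∫⁻ x, ‖f x‖ₑ ∂μ := enorm_integral_le_lintegral_enorm f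
    _ = eLpNorm f 1 μ := eLpNorm_one_eq_lintegral_enorm.symm
    _ ≤ eLpNorm f 2 μ := eLpNorm_le_eLpNorm_of_exponent_le one_le_two hf

theorem sq_enorm_integral_sub_integral_le [CompleteSpace E] {ν : Measure α}
    [IsProbabilityMeasure μ] [IsProbabilityMeasure ν] {f : α → E} (hμ : Integrable f μ)
    (hν : Integrable f ν) :
    ‖∫ x, f x ∂μ - ∫ y, f y ∂ν‖ₑ ^ 2 ≤ ∫⁻ x, ∫⁻ y, ‖f x - f y‖ₑ ^ 2 ∂ν ∂μ := by
  have hsub : Integrable (fun z : α × α => f z.1 - f z.2) (μ.prod ν) :=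
    (hμ.comp_fst ν).sub (hν.comp_snd μ)
  have heq : ∫ x, f x ∂μ - ∫ y, f y ∂ν = ∫ z, (f z.1 - f z.2) ∂μ.prod ν := by
    rw [integral_sub (hμ.comp_fst ν) (hν.comp_snd μ), integral_fun_fst, integral_fun_snd]
    simp
  rw [heq, ← lintegral_prod (fun z : α × α => ‖f z.1 - f z.2‖ₑ ^ 2)
    (hsub.aestronglyMeasurable.enorm.pow_const 2)]
  exact sq_enorm_integral_le_lintegral hsub.aestronglyMeasurable

theorem sq_enorm_average_sub_average_le [CompleteSpace E] {f : α → E} {A B : Set α}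
    (hfA : IntegrableOn f A μ) (hfB : IntegrableOn f B μ) (hA : μ A ≠ 0) (hA' : μ A ≠ ⊤)
    (hB : μ B ≠ 0) (hB' : μ B ≠ ⊤) :
    ‖(⨍ x in A, f x ∂μ) - ⨍ y in B, f y ∂μ‖ₑ ^ 2 ≤
      (μ A)⁻¹ * (μ B)⁻¹ * ∫⁻ x in A, ∫⁻ y in B, ‖f x - f y‖ₑ ^ 2 ∂μ ∂μ := by
  have hprob (s : Set α) (h0 : μ s ≠ 0) (h1 : μ s ≠ ⊤) :
      IsProbabilityMeasure ((μ s)⁻¹ • μ.restrict s) := ⟨by simp [ENNReal.inv_mul_cancel h0 h1]⟩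
  have := hprob A hA hA'
  have := hprob B hB hB'
  simp only [average, Measure.restrict_apply_univ]
  refine (sq_enorm_integral_sub_integral_le (hfA.smul_measure (ENNReal.inv_ne_top.2 hA))
    (hfB.smul_measure (ENNReal.inv_ne_top.2 hB))).trans_eq ?_
  simp only [lintegral_smul_measure, smul_eq_mul]
  rw [lintegral_const_mul' _ _ (ENNReal.inv_ne_top.2 hB), mul_assoc]

end Jensen

section GagliardoEnergy

/-- The energy `∫_I ∫_I D(s, t) / |s - t|^p dt ds` of a squared distance `D` on the line; for
`D(s, t) = |f(s) - f(t)|²` and `p = 1 + 2θ` it is the squared Gagliardo semi-norm of order `θ`. -/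
def gagliardoEnergy (I : Set ℝ) (p : ℝ) (D : ℝ → ℝ → ℝ≥0∞) : ℝ≥0∞ :=
  ∫⁻ s in I, ∫⁻ t in I, D s t / ‖s - t‖ₑ ^ p

variable {I : Set ℝ} {p : ℝ} {D : ℝ → ℝ → ℝ≥0∞}

theorem gagliardoEnergy_mono_set {I J : Set ℝ} (hIJ : I ⊆ J) (p : ℝ) (D : ℝ → ℝ → ℝ≥0∞) :
    gagliardoEnergy I p D ≤ gagliardoEnergy J p D :=
  (lintegral_mono fun _ => lintegral_mono_set hIJ).trans (lintegral_mono_set hIJ)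

theorem gagliardoEnergy_le_mul {D' : ℝ → ℝ → ℝ≥0∞} {C : ℝ≥0∞} (hC : C ≠ ⊤)
    (h : ∀ᵐ s ∂volume.restrict I, ∀ᵐ t ∂volume.restrict I, D s t ≤ C * D' s t) :
    gagliardoEnergy I p D ≤ C * gagliardoEnergy I p D' := by
  simp only [gagliardoEnergy, ← lintegral_const_mul' _ _ hC, ← mul_div_assoc]
  exact lintegral_mono_ae <| h.mono fun s hs => lintegral_mono_ae <|
    hs.mono fun t ht => ENNReal.div_le_div_right ht _

theorem lintegral_lintegral_le_mul_gagliardoEnergy (hp : 0 ≤ p) (hD : ∀ t, D t t = 0)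
    {A B : Set ℝ} (hAm : MeasurableSet A) (hBm : MeasurableSet B) (hA : A ⊆ I) (hB : B ⊆ I)
    {r : ℝ} (hr : ∀ s ∈ A, ∀ t ∈ B, |s - t| ≤ r) :
    ∫⁻ s in A, ∫⁻ t in B, D s t ≤ ENNReal.ofReal r ^ p * gagliardoEnergy I p D := by
  have hrp : ENNReal.ofReal r ^ p ≠ ⊤ := ENNReal.rpow_ne_top_of_nonneg hp ENNReal.ofReal_ne_top
  have hpoint (s : ℝ) (hs : s ∈ A) (t : ℝ) (ht : t ∈ B) :
      D s t ≤ ENNReal.ofReal r ^ p * (D s t / ‖s - t‖ₑ ^ p) := by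
    rcases eq_or_ne s t with rfl | hst
    · simp [hD]
    have hne : ‖s - t‖ₑ ^ p ≠ 0 := by simp [ENNReal.rpow_eq_zero_iff, sub_eq_zero, hst]
    have htop : ‖s - t‖ₑ ^ p ≠ ⊤ := ENNReal.rpow_ne_top_of_nonneg hp enorm_ne_top
    have hle : ‖s - t‖ₑ ^ p ≤ ENNReal.ofReal r ^ p := by
      rw [Real.enorm_eq_ofReal_abs]
      gcongr
      exact hr s hs t ht
    calc D s t = ‖s - t‖ₑ ^ p * (D s t / ‖s - t‖ₑ ^ p) := (ENNReal.mul_div_cancel hne htop).symm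
      _ ≤ _ := by gcongr
  simp only [gagliardoEnergy, ← lintegral_const_mul' _ _ hrp]
  exact (setLIntegral_mono' hAm fun s hs => (setLIntegral_mono' hBm (hpoint s hs)).trans
    (lintegral_mono_set hB)).trans (lintegral_mono_set hA)

end GagliardoEnergy

section HolderExtension

theorem exists_eqOn_forall_closure_dist_le {X Y : Type*} [PseudoMetricSpace X] [MetricSpace Y]
    [CompleteSpace Y] {A : Set X} {f : X → Y} {m : ℝ → ℝ} (hm : Continuous m) (hm0 : m 0 = 0)
    (hf : ∀ s ∈ A, ∀ t ∈ A, dist (f s) (f t) ≤ m (dist s t)) :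
    ∃ g : X → Y, Set.EqOn f g A ∧
      ∀ s ∈ closure A, ∀ t ∈ closure A, dist (g s) (g t) ≤ m (dist s t) := by
  have hunif : UniformContinuousOn f A := by
    refine Metric.uniformContinuousOn_iff.2 fun ε hε => ?_
    obtain ⟨δ, hδ, hδε⟩ := Metric.eventually_nhds_iff.1
      (hm.continuousAt.eventually_lt continuousAt_const (hm0 ▸ hε))
    exact ⟨δ, hδ, fun s hs t ht hst => (hf s hs t ht).trans_lt (hδε (by simpa using hst))⟩
  have hlim (s : X) (hs : s ∈ closure A) : Tendsto f (𝓝[A] s) (𝓝 (extendFrom A f s)) := by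
    have := mem_closure_iff_nhdsWithin_neBot.1 hs
    exact tendsto_extendFrom <| CompleteSpace.complete <|
      (cauchy_nhds.mono nhdsWithin_le_nhds).map_of_le hunif inf_le_right
  refine ⟨extendFrom A f, fun s hs => ?_, fun s hs t ht => ?_⟩
  · exact (extendFrom_eq (subset_closure hs) (hunif.continuousOn s hs)).symm
  · have := mem_closure_iff_nhdsWithin_neBot.1 hs
    have := mem_closure_iff_nhdsWithin_neBot.1 ht
    have hdist : Tendsto (fun z : X × X => dist z.1 z.2) (𝓝[A] s ×ˢ 𝓝[A] t) (𝓝 (dist s t)) :=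
      (tendsto_fst.mono_right nhdsWithin_le_nhds).dist (tendsto_snd.mono_right nhdsWithin_le_nhds)
    refine le_of_tendsto_of_tendsto (((hlim s hs).comp tendsto_fst).dist
      ((hlim t ht).comp tendsto_snd)) ((hm.tendsto _).comp hdist) ?_
    filter_upwards [prod_mem_prod self_mem_nhdsWithin self_mem_nhdsWithin] with z hz
    exact hf _ hz.1 _ hz.2

theorem continuousOn_of_norm_sub_le_rpow {E : Type*} [SeminormedAddCommGroup E] {g : ℝ → E}
    {I : Set ℝ} {C β : ℝ} (hβ : 0 < β)
    (hg : ∀ s ∈ I, ∀ t ∈ I, ‖g s - g t‖ ≤ C * |s - t| ^ β) : ContinuousOn g I := by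
  intro t ht
  refine tendsto_iff_norm_sub_tendsto_zero.2 (squeeze_zero' (Eventually.of_forall fun _ =>
    norm_nonneg _) (eventually_mem_nhdsWithin.mono fun s hs => hg s hs t ht) ?_)
  have hcont : Continuous fun s => C * |s - t| ^ β :=
    ((continuous_sub_right t).abs.rpow_const fun _ => Or.inr hβ.le).const_mul C
  simpa [Real.zero_rpow hβ.ne'] using (hcont.tendsto t).mono_left nhdsWithin_le_nhds

end HolderExtension

section Morrey

variable {E : Type*} [NormedAddCommGroup E] [NormedSpace ℝ E] [CompleteSpace E]

theorem abs_sub_le_of_mem_uIoc_of_mem_uIoc_half {t h x y : ℝ} (hx : x ∈ Set.uIoc t (t + h))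
    (hy : y ∈ Set.uIoc t (t + h / 2)) : |x - y| ≤ |h| := by
  rw [Set.mem_uIoc] at hx hy
  rw [abs_le]
  rcases abs_cases h with ⟨hh, _⟩ | ⟨hh, _⟩ <;> rw [hh] <;>
    rcases hx with hx | hx <;> rcases hy with hy | hy <;> constructor <;> linarith

theorem dist_average_uIoc_half_le {f : ℝ → E} {a b t h p : ℝ} (hf : IntegrableOn f (Set.Icc a b))
    (hp : 0 ≤ p) (hE : gagliardoEnergy (Set.Icc a b) p (fun s t => ‖f s - f t‖ₑ ^ 2) ≠ ⊤)
    (hh : h ≠ 0) (ht : t ∈ Set.Icc a b) (hth : t + h ∈ Set.Icc a b) :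
    dist (⨍ u in Set.uIoc t (t + h), f u) (⨍ u in Set.uIoc t (t + h / 2), f u) ≤
      √(2 * (gagliardoEnergy (Set.Icc a b) p fun s t => ‖f s - f t‖ₑ ^ 2).toReal) *
        |h| ^ ((p - 2) / 2) := by
  have hvol (h : ℝ) : volume (Set.uIoc t (t + h)) = ENNReal.ofReal |h| := by
    rw [Real.volume_uIoc, add_sub_cancel_left]
  have hpos : 0 < |h| := abs_pos.2 hh
  have hmid : t + h / 2 ∈ Set.Icc a b := by
    simpa [div_eq_inv_mul] using (convex_Icc a b).add_smul_mem ht hth (t := (2 : ℝ)⁻¹) (by norm_num)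
  have hsub {h : ℝ} (hth : t + h ∈ Set.Icc a b) : Set.uIoc t (t + h) ⊆ Set.Icc a b :=
    Set.uIoc_subset_uIcc.trans (Set.uIcc_subset_Icc ht hth)
  have hsq := (sq_enorm_average_sub_average_le (hf.mono_set (hsub hth)) (hf.mono_set (hsub hmid))
    (by simpa [hvol] using hh) (by simp [hvol]) (by simpa [hvol] using hh) (by simp [hvol])).trans
      (mul_le_mul_right (lintegral_lintegral_le_mul_gagliardoEnergy hp (by simp) measurableSet_uIoc
        measurableSet_uIoc (hsub hth) (hsub hmid)
        fun _ hx _ hy => abs_sub_le_of_mem_uIoc_of_mem_uIoc_half hx hy) _)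
  rw [hvol, hvol, ← ENNReal.ofReal_toReal hE, ENNReal.ofReal_rpow_of_pos hpos,
    ← ENNReal.ofReal_inv_of_pos hpos, ← ENNReal.ofReal_inv_of_pos (by positivity),
    ← ENNReal.ofReal_mul (by positivity), ← ENNReal.ofReal_mul (by positivity),
    ← ENNReal.ofReal_mul (by positivity), ← ofReal_norm, ← ENNReal.ofReal_pow (norm_nonneg _),
    ENNReal.ofReal_le_ofReal_iff (by positivity), ← dist_eq_norm] at hsq
  refine (sq_le_sq₀ dist_nonneg (by positivity)).1 (hsq.trans_eq ?_)
  have hpow : |h| ^ p = |h| ^ 2 * (|h| ^ ((p - 2) / 2)) ^ 2 := by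
    rw [← Real.rpow_mul_natCast hpos.le, ← Real.rpow_natCast, ← Real.rpow_add hpos]
    congr 1
    push_cast
    ring
  rw [mul_pow, Real.sq_sqrt (by positivity), hpow, abs_div, Nat.abs_ofNat]
  field_simp

omit [CompleteSpace E] in
theorem tendsto_average_uIoc {f : ℝ → E} {t : ℝ}
    (hd : HasDerivAt (fun x => ∫ u in t..x, f u) (f t) t) :
    Tendsto (fun h => ⨍ u in Set.uIoc t (t + h), f u) (𝓝[≠] 0) (𝓝 (f t)) :=
  hd.tendsto_slope_zero.congr fun h => by
    rw [interval_average_eq, add_sub_cancel_left, intervalIntegral.integral_same, sub_zero]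

/-- The constant of the one-dimensional Morrey embedding `norm_sub_le_of_hasDerivAt_integral`,
obtained by summing a geometric series over dyadic scales. -/
def holderConst (p : ℝ) : ℝ := 2 * (√2 / (1 - (1 / 2) ^ ((p - 2) / 2)))

theorem holderConst_nonneg {p : ℝ} (hp : 2 < p) : 0 ≤ holderConst p := by
  have hpow : (1 / 2 : ℝ) ^ ((p - 2) / 2) ≤ 1 :=
    Real.rpow_le_one (by norm_num) (by norm_num) (by linarith)
  exact mul_nonneg zero_le_two (div_nonneg (Real.sqrt_nonneg _) (sub_nonneg.2 hpow))

theorem dist_average_uIoc_le {f : ℝ → E} {a b t h p : ℝ} (hf : IntegrableOn f (Set.Icc a b))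
    (hp : 2 < p) (hE : gagliardoEnergy (Set.Icc a b) p (fun s t => ‖f s - f t‖ₑ ^ 2) ≠ ⊤)
    (hh : h ≠ 0) (ht : t ∈ Set.Icc a b) (hth : t + h ∈ Set.Icc a b)
    (hd : HasDerivAt (fun x => ∫ u in t..x, f u) (f t) t) :
    dist (⨍ u in Set.uIoc t (t + h), f u) (f t) ≤ holderConst p / 2 *
      √(gagliardoEnergy (Set.Icc a b) p fun s t => ‖f s - f t‖ₑ ^ 2).toReal *
        |h| ^ ((p - 2) / 2) := by
  set S := (gagliardoEnergy (Set.Icc a b) p fun s t => ‖f s - f t‖ₑ ^ 2).toReal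
  set β := (p - 2) / 2
  have hβ : 0 < β := by simp only [β]; linarith
  let m (k : ℕ) : E := ⨍ u in Set.uIoc t (t + h * (1 / 2) ^ k), f u
  have hne (k : ℕ) : h * (1 / 2 : ℝ) ^ k ≠ 0 := by positivity
  have hmem (k : ℕ) : t + h * (1 / 2) ^ k ∈ Set.Icc a b := by
    have hk : (1 / 2 : ℝ) ^ k ∈ Set.Icc 0 1 :=
      ⟨by positivity, pow_le_one₀ (by norm_num) (by norm_num)⟩
    simpa only [smul_eq_mul, mul_comm] using (convex_Icc a b).add_smul_mem ht hth hk
  have hlim : Tendsto m atTop (𝓝 (f t)) := by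
    refine (tendsto_average_uIoc hd).comp
      (tendsto_nhdsWithin_iff.2 ⟨?_, Eventually.of_forall hne⟩)
    simpa using (tendsto_pow_atTop_nhds_zero_of_lt_one (r := (1 / 2 : ℝ)) (by norm_num)
      (by norm_num)).const_mul h
  have hstep (k : ℕ) : dist (m k) (m (k + 1)) ≤ √(2 * S) * |h| ^ β * ((1 / 2) ^ β) ^ k := by
    have hk := dist_average_uIoc_half_le hf (by linarith) hE (hne k) ht (hmem k)
    rw [abs_mul, abs_of_pos (by positivity : (0 : ℝ) < (1 / 2) ^ k),
      Real.mul_rpow (abs_nonneg h) (by positivity), ← Real.rpow_pow_comm (by norm_num),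
      ← mul_assoc] at hk
    rwa [show h * (1 / 2) ^ k / 2 = h * (1 / 2) ^ (k + 1) by ring] at hk
  have hsum := dist_le_of_le_geometric_of_tendsto₀ _ _
    (Real.rpow_lt_one (by norm_num) (by norm_num) hβ) hstep hlim
  simp only [m, pow_zero, mul_one] at hsum
  refine hsum.trans_eq ?_
  rw [holderConst, Real.sqrt_mul zero_le_two]
  ring

theorem norm_sub_le_of_hasDerivAt_integral {f : ℝ → E} {a b s t p : ℝ}
    (hf : IntegrableOn f (Set.Icc a b)) (hp : 2 < p)
    (hE : gagliardoEnergy (Set.Icc a b) p (fun s t => ‖f s - f t‖ₑ ^ 2) ≠ ⊤)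
    (hs : s ∈ Set.Icc a b) (ht : t ∈ Set.Icc a b)
    (hds : HasDerivAt (fun x => ∫ u in s..x, f u) (f s) s)
    (hdt : HasDerivAt (fun x => ∫ u in t..x, f u) (f t) t) :
    ‖f s - f t‖ ≤ holderConst p *
      √(gagliardoEnergy (Set.Icc a b) p fun s t => ‖f s - f t‖ₑ ^ 2).toReal *
        |s - t| ^ ((p - 2) / 2) := by
  rcases eq_or_ne s t with rfl | hst
  · simp [Real.zero_rpow (by linarith : (p - 2) / 2 ≠ 0)]
  have hs' := dist_average_uIoc_le hf hp hE (sub_ne_zero.2 hst.symm) hs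
    (by rwa [add_sub_cancel]) hds
  have ht' := dist_average_uIoc_le hf hp hE (sub_ne_zero.2 hst) ht (by rwa [add_sub_cancel]) hdt
  rw [add_sub_cancel, abs_sub_comm] at hs'
  rw [add_sub_cancel, Set.uIoc_comm] at ht'
  rw [← dist_eq_norm]
  linarith [dist_triangle_left (f s) (f t) (⨍ u in Set.uIoc s t, f u)]

theorem exists_ae_eq_forall_norm_sub_le {f : ℝ → E} {a b p : ℝ} (hab : a < b)
    (hf : IntegrableOn f (Set.Icc a b)) (hp : 2 < p)
    (hE : gagliardoEnergy (Set.Icc a b) p (fun s t => ‖f s - f t‖ₑ ^ 2) ≠ ⊤) :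
    ∃ g : ℝ → E, f =ᵐ[volume.restrict (Set.Icc a b)] g ∧
      ∀ s ∈ Set.Icc a b, ∀ t ∈ Set.Icc a b, ‖g s - g t‖ ≤ holderConst p *
        √(gagliardoEnergy (Set.Icc a b) p fun s t => ‖f s - f t‖ₑ ^ 2).toReal *
          |s - t| ^ ((p - 2) / 2) := by
  let A : Set ℝ := {t | t ∈ Set.Icc a b ∧ HasDerivAt (fun x => ∫ u in t..x, f u) (f t) t}
  have hA : ∀ᵐ t, t ∈ Set.Icc a b → t ∈ A := by
    have hint := (intervalIntegrable_iff_integrableOn_Icc_of_le hab.le).2 hf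
    filter_upwards [hint.ae_hasDerivAt_integral] with t ht htI
    rw [Set.uIcc_of_le hab.le] at ht
    exact ⟨htI, ht htI t htI⟩
  have hdense : Set.Icc a b ⊆ closure A := by
    rw [← closure_Ioo hab.ne]
    refine closure_minimal (((Measure.dense_of_ae hA).open_subset_closure_inter isOpen_Ioo).trans
      (closure_mono ?_)) isClosed_closure
    exact fun t ht => ht.2 (Set.Ioo_subset_Icc_self ht.1)
  have hmod : Continuous fun r : ℝ => holderConst p *
      √(gagliardoEnergy (Set.Icc a b) p fun s t => ‖f s - f t‖ₑ ^ 2).toReal *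
        r ^ ((p - 2) / 2) :=
    (Real.continuous_rpow_const (by linarith)).const_mul _
  obtain ⟨g, hfg, hg⟩ := exists_eqOn_forall_closure_dist_le (A := A) (f := f) hmod
    (by simp [Real.zero_rpow (by linarith : (p - 2) / 2 ≠ 0)]) fun s hs t ht => by
      simpa only [dist_eq_norm, Real.norm_eq_abs] using
        norm_sub_le_of_hasDerivAt_integral hf hp hE hs.1 ht.1 hs.2 ht.2
  refine ⟨g, (ae_restrict_iff' measurableSet_Icc).2 (hA.mono fun t ht htI => hfg (ht htI)), ?_⟩
  intro s hs t ht
  simpa only [dist_eq_norm, Real.norm_eq_abs] using hg s (hdense hs) t (hdense ht)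

theorem exists_ae_eq_const_of_gagliardoEnergy_ne_top {r : ℝ → ℕ} {a b p : ℝ} (hab : a < b)
    (hr : IntegrableOn (fun t => (r t : ℝ)) (Set.Icc a b)) (hp : 2 < p)
    (hE : gagliardoEnergy (Set.Icc a b) p (fun s t => ‖(r s : ℝ) - r t‖ₑ ^ 2) ≠ ⊤) :
    ∃ k, ∀ᵐ t ∂volume.restrict (Set.Icc a b), r t = k := by
  obtain ⟨g, hrg, hg⟩ := exists_ae_eq_forall_norm_sub_le hab hr hp hE
  have hcont : ContinuousOn g (Set.Icc a b) :=
    continuousOn_of_norm_sub_le_rpow (by linarith : 0 < (p - 2) / 2) hg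
  have hclosed : IsClosed (Set.range (Nat.cast : ℕ → ℝ)) :=
    Nat.isClosedEmbedding_coe_real.isClosed_range
  have hnat : Set.MapsTo g (Set.Icc a b) (Set.range (Nat.cast : ℕ → ℝ)) := by
    have hdist : (fun t => Metric.infDist (g t) (Set.range (Nat.cast : ℕ → ℝ)))
        =ᵐ[volume.restrict (Set.Icc a b)] fun _ => 0 := by
      filter_upwards [hrg] with t ht
      exact ht ▸ Metric.infDist_zero_of_mem ⟨r t, rfl⟩
    intro t ht
    exact (hclosed.mem_iff_infDist_zero (Set.range_nonempty _)).2
      (Measure.eqOn_Icc_of_ae_eq volume hab.ne hdist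
        ((Metric.continuous_infDist_pt _).comp_continuousOn hcont) continuousOn_const ht)
  have hdisc : IsDiscrete (Set.range (Nat.cast : ℕ → ℝ)) :=
    ⟨Nat.isClosedEmbedding_coe_real.isEmbedding.toHomeomorph.symm.isEmbedding.discreteTopology⟩
  obtain ⟨k, hk⟩ := hnat (Set.left_mem_Icc.2 hab.le)
  refine ⟨k, ?_⟩
  filter_upwards [hrg, ae_restrict_mem measurableSet_Icc] with t ht htI
  rw [← Nat.cast_inj (R := ℝ), ht, hk]
  exact isPreconnected_Icc.constant_of_mapsTo hdisc hcont hnat htI (Set.left_mem_Icc.2 hab.le)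

end Morrey

section ShiftDist

/-- The squared `L²`-modulus of continuity `‖g(· + h) - g‖²`. -/
def shiftDistSq {V E : Type*} [Add V] [MeasureSpace V] [NormedAddCommGroup E] (g : V → E) (h : V) :
    ℝ≥0∞ :=
  ∫⁻ x, ‖g (x + h) - g x‖ₑ ^ 2

theorem enorm_sub_sq_le {E : Type*} [NormedAddCommGroup E] (a b c : E) :
    ‖a - c‖ₑ ^ 2 ≤ 2 * ‖a - b‖ₑ ^ 2 + 2 * ‖b - c‖ₑ ^ 2 := by
  have hsq := ENNReal.rpow_add_le_mul_rpow_add_rpow ‖a - b‖ₑ ‖b - c‖ₑ one_le_two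
  rw [show (2 : ℝ≥0∞) ^ ((2 : ℝ) - 1) = 2 by norm_num] at hsq
  simp only [ENNReal.rpow_two, mul_add] at hsq
  calc ‖a - c‖ₑ ^ 2 = ‖(a - b) + (b - c)‖ₑ ^ 2 := by rw [sub_add_sub_cancel]
    _ ≤ (‖a - b‖ₑ + ‖b - c‖ₑ) ^ 2 := by gcongr; exact enorm_add_le _ _
    _ ≤ _ := hsq

variable {d : ℕ} {E : Type*} [NormedAddCommGroup E] [MeasurableSpace E] [BorelSpace E]
  [SecondCountableTopology E] {g : Rd d → E}

theorem measurable_enorm_shift_sub_sq (hg : Measurable g) :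
    Measurable fun p : Rd d × Rd d => ‖g (p.1 + p.2) - g p.1‖ₑ ^ 2 :=
  ((hg.comp (measurable_fst.add measurable_snd)).sub (hg.comp measurable_fst)).enorm.pow_const 2

theorem measurable_shiftDistSq (hg : Measurable g) : Measurable (shiftDistSq g) :=
  (measurable_enorm_shift_sub_sq hg).lintegral_prod_left'

theorem shiftDistSq_le (hg : Measurable g) (h y : Rd d) :
    shiftDistSq g h ≤ 2 * shiftDistSq g (h - y) + 2 * shiftDistSq g y := by
  have hshift : shiftDistSq g (h - y) = ∫⁻ x, ‖g (x + h) - g (x + y)‖ₑ ^ 2 := by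
    rw [shiftDistSq, ← lintegral_add_right_eq_self _ y]
    exact lintegral_congr fun x => by rw [show x + y + (h - y) = x + h by abel]
  have hm : Measurable fun x => 2 * ‖g (x + h) - g (x + y)‖ₑ ^ 2 := by fun_prop
  rw [hshift, shiftDistSq, shiftDistSq, ← lintegral_const_mul' _ _ (by simp),
    ← lintegral_const_mul' _ _ (by simp), ← lintegral_add_left hm]
  exact lintegral_mono fun x => enorm_sub_sq_le _ _ _

theorem shiftDistSq_mul_volume_ball_le (hg : Measurable g) (h : Rd d) (r : ℝ) :
    shiftDistSq g h * volume (Metric.ball (0 : Rd d) r) ≤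
      4 * ∫⁻ y in Metric.ball (0 : Rd d) (‖h‖ + r), shiftDistSq g y := by
  set I := ∫⁻ y in Metric.ball (0 : Rd d) (‖h‖ + r), shiftDistSq g y
  have hnear : ∫⁻ y in Metric.ball (0 : Rd d) r, shiftDistSq g y ≤ I :=
    lintegral_mono_set (Metric.ball_subset_ball (by linarith [norm_nonneg h]))
  have hfar : ∫⁻ y in Metric.ball (0 : Rd d) r, shiftDistSq g (h - y) ≤ I := by
    simp only [I, ← lintegral_indicator measurableSet_ball]
    rw [← lintegral_sub_left_eq_self (Set.indicator _ (shiftDistSq g)) h]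
    refine lintegral_mono (Set.indicator_le fun y hy => ?_)
    have hmem : h - y ∈ Metric.ball (0 : Rd d) (‖h‖ + r) := by
      rw [mem_ball_zero_iff] at hy ⊢
      linarith [norm_sub_le h y]
    rw [Set.indicator_of_mem hmem]
  calc shiftDistSq g h * volume (Metric.ball (0 : Rd d) r)
      = ∫⁻ _ in Metric.ball (0 : Rd d) r, shiftDistSq g h := (setLIntegral_const _ _).symm
    _ ≤ ∫⁻ y in Metric.ball (0 : Rd d) r, (2 * shiftDistSq g (h - y) + 2 * shiftDistSq g y) :=
        lintegral_mono fun y => shiftDistSq_le hg h y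
    _ = 2 * (∫⁻ y in Metric.ball (0 : Rd d) r, shiftDistSq g (h - y)) +
        2 * ∫⁻ y in Metric.ball (0 : Rd d) r, shiftDistSq g y := by
        rw [lintegral_add_right _ ((measurable_shiftDistSq hg).const_mul 2),
          lintegral_const_mul' _ _ (by simp), lintegral_const_mul' _ _ (by simp)]
    _ ≤ 2 * I + 2 * I := by gcongr
    _ = 4 * I := by ring

end ShiftDist

section Slobodeckij

variable {d : ℕ} {g : Rd d → ℂ} {θ : ℝ}

theorem slobodeckijSeminormSq_eq_lintegral_shiftDistSq (hg : Measurable g) (θ : ℝ) :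
    slobodeckijSeminormSq θ g = ∫⁻ y, shiftDistSq g y / ‖y‖ₑ ^ ((d : ℝ) + 2 * θ) := by
  have hm : Measurable fun p : Rd d × Rd d =>
      ‖g (p.1 + p.2) - g p.1‖ₑ ^ 2 / ‖p.2‖ₑ ^ ((d : ℝ) + 2 * θ) :=
    (measurable_enorm_shift_sub_sq hg).div (measurable_snd.enorm.pow_const _)
  calc slobodeckijSeminormSq θ g
      = ∫⁻ x, ∫⁻ y, ‖g (x + y) - g x‖ₑ ^ 2 / ‖y‖ₑ ^ ((d : ℝ) + 2 * θ) := by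
        refine lintegral_congr fun x => ?_
        rw [← lintegral_add_left_eq_self _ x]
        refine lintegral_congr fun y => ?_
        rw [← enorm_neg, neg_sub, sub_add_cancel_left, enorm_neg]
    _ = ∫⁻ y, ∫⁻ x, ‖g (x + y) - g x‖ₑ ^ 2 / ‖y‖ₑ ^ ((d : ℝ) + 2 * θ) :=
        lintegral_lintegral_swap hm.aemeasurable
    _ = _ := lintegral_congr fun y => by
        simp only [div_eq_mul_inv]
        rw [shiftDistSq, lintegral_mul_const _ (by fun_prop)]

theorem lintegral_ball_shiftDistSq_le (hg : Measurable g) (hθ : 0 ≤ θ) (r : ℝ) :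
    ∫⁻ y in Metric.ball (0 : Rd d) r, shiftDistSq g y ≤
      ENNReal.ofReal r ^ ((d : ℝ) + 2 * θ) * slobodeckijSeminormSq θ g := by
  have hp : 0 ≤ (d : ℝ) + 2 * θ := by positivity
  rw [slobodeckijSeminormSq_eq_lintegral_shiftDistSq hg,
    ← lintegral_const_mul' _ _ (ENNReal.rpow_ne_top_of_nonneg hp ENNReal.ofReal_ne_top)]
  refine (setLIntegral_mono' measurableSet_ball fun y hy => ?_).trans
    (setLIntegral_le_lintegral _ _)
  rcases eq_or_ne y 0 with rfl | hy0
  · simp [shiftDistSq]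
  have hle : ‖y‖ₑ ≤ ENNReal.ofReal r := by
    rw [← ofReal_norm]
    exact ENNReal.ofReal_le_ofReal (mem_ball_zero_iff.1 hy).le
  calc shiftDistSq g y
      = ‖y‖ₑ ^ ((d : ℝ) + 2 * θ) * (shiftDistSq g y / ‖y‖ₑ ^ ((d : ℝ) + 2 * θ)) :=
        (ENNReal.mul_div_cancel (by simp [ENNReal.rpow_eq_zero_iff, hy0])
          (ENNReal.rpow_ne_top_of_nonneg hp enorm_ne_top)).symm
    _ ≤ _ := by gcongr

theorem exists_shiftDistSq_le_of_slobodeckijSeminormSq_ne_top (hg : Measurable g) (hθ : 0 < θ)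
    (hS : slobodeckijSeminormSq θ g ≠ ⊤) :
    ∃ C : ℝ≥0∞, C ≠ ⊤ ∧ ∀ h : Rd d, shiftDistSq g h ≤ C * ‖h‖ₑ ^ (2 * θ) := by
  set p : ℝ := (d : ℝ) + 2 * θ
  have hp0 : 0 < p := by positivity
  set v := volume (Metric.ball (0 : Rd d) 1)
  have hv0 : v ≠ 0 := (Metric.measure_ball_pos _ _ one_pos).ne'
  have hvt : v ≠ ⊤ := measure_ball_lt_top.ne
  have h2p : (2 : ℝ≥0∞) ^ p ≠ ⊤ := ENNReal.rpow_ne_top_of_nonneg hp0.le (by simp)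
  refine ⟨4 * 2 ^ p * slobodeckijSeminormSq θ g / v, by finiteness, fun h => ?_⟩
  rcases eq_or_ne h 0 with rfl | hh
  · simp [shiftDistSq]
  have hn0 : ‖h‖ₑ ≠ 0 := enorm_ne_zero.2 hh
  have hvol : volume (Metric.ball (0 : Rd d) ‖h‖) = ‖h‖ₑ ^ d * v := by
    rw [Measure.addHaar_ball_of_pos _ _ (norm_pos_iff.2 hh), finrank_euclideanSpace_fin,
      ENNReal.ofReal_pow (norm_nonneg h), ofReal_norm]
  have hdouble : ENNReal.ofReal (‖h‖ + ‖h‖) = 2 * ‖h‖ₑ := by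
    rw [← two_mul, ENNReal.ofReal_mul zero_le_two, ofReal_norm, ENNReal.ofReal_ofNat]
  have hball := (shiftDistSq_mul_volume_ball_le hg h ‖h‖).trans
    (mul_le_mul_right (lintegral_ball_shiftDistSq_le hg hθ.le (‖h‖ + ‖h‖)) 4)
  rw [hvol, hdouble, ENNReal.mul_rpow_of_nonneg _ _ hp0.le, ENNReal.rpow_add _ _ hn0 enorm_ne_top,
    ENNReal.rpow_natCast] at hball
  refine (ENNReal.mul_le_mul_iff_left (mul_ne_zero (pow_ne_zero d hn0) hv0)
    (by finiteness : ‖h‖ₑ ^ d * v ≠ ⊤)).1 (hball.trans_eq ?_)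
  calc 4 * (2 ^ p * (‖h‖ₑ ^ d * ‖h‖ₑ ^ (2 * θ)) * slobodeckijSeminormSq θ g)
      = 4 * 2 ^ p * slobodeckijSeminormSq θ g * ‖h‖ₑ ^ (2 * θ) * ‖h‖ₑ ^ d := by ring
    _ = 4 * 2 ^ p * slobodeckijSeminormSq θ g / v * v * ‖h‖ₑ ^ (2 * θ) * ‖h‖ₑ ^ d := by
        rw [ENNReal.div_mul_cancel hv0 hvt]
    _ = _ := by ring

end Slobodeckij

section WeakDerivative

variable {d : ℕ} {g D : Rd d → ℂ} {φ : Rd d → ℝ}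

theorem hasDerivAt_integral_comp_sub_smul (hg : LocallyIntegrable g) (hφ : ContDiff ℝ 1 φ)
    (hc : HasCompactSupport φ) (e : Rd d) (t : ℝ) :
    HasDerivAt (fun t : ℝ => ∫ x, φ (x - t • e) • g x)
      (-∫ x, fderiv ℝ φ (x - t • e) e • g x) t := by
  set ψ : Rd d → ℝ := fun y => φ (-y) with hψ
  have hψs : ContDiff ℝ 1 ψ := hφ.comp contDiff_neg
  have hψc : HasCompactSupport ψ := hc.comp_homeomorph (Homeomorph.neg _)
  have hψ' (y : Rd d) : fderiv ℝ ψ y e = -fderiv ℝ φ (-y) e := by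
    have hchain := ((hφ.differentiable one_ne_zero (-y)).hasFDerivAt.comp y
      (hasFDerivAt_id (𝕜 := ℝ) y).neg).fderiv
    rw [show fderiv ℝ ψ y = _ from hchain]
    simp
  have hconv := hψc.hasFDerivAt_convolution_left (ContinuousLinearMap.lsmul ℝ ℝ) (μ := volume)
    hψs hg (t • e)
  have hline : HasDerivAt (fun t : ℝ => t • e) e t := by
    simpa using (hasDerivAt_id t).smul_const e
  have hex := (hψc.fderiv ℝ).convolutionExists_left
    ((ContinuousLinearMap.lsmul ℝ ℝ (E := ℂ)).precompL (Rd d)) (μ := volume)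
    (hψs.continuous_fderiv one_ne_zero) hg (t • e)
  have hcomp := hconv.comp_hasDerivAt t hline
  rw [convolution_eq_swap, ContinuousLinearMap.integral_apply hex.integrable_swap] at hcomp
  simp only [ContinuousLinearMap.precompL_apply, ContinuousLinearMap.lsmul_apply, hψ', neg_sub,
    neg_smul, integral_neg] at hcomp
  simpa only [Function.comp_def, convolution_eq_swap, ContinuousLinearMap.lsmul_apply, hψ,
    neg_sub] using hcomp

theorem IsWeakPartialDeriv.hasDerivAt_integral {i : Fin d} (hD : IsWeakPartialDeriv i g D)
    (hg : LocallyIntegrable g) (hφ : ContDiff ℝ ∞ φ) (hc : HasCompactSupport φ) (t : ℝ) :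
    HasDerivAt (fun t : ℝ => ∫ x, φ (x - t • EuclideanSpace.single i 1) • g x)
      (∫ x, φ (x - t • EuclideanSpace.single i 1) • D x) t := by
  set e : Rd d := EuclideanSpace.single i 1
  have hweak := hD (fun x => φ (x - t • e)) (hφ.comp (contDiff_id.sub contDiff_const))
    (hc.comp_homeomorph (Homeomorph.subRight _))
  simp only [fderiv_comp_sub] at hweak
  rw [← neg_eq_iff_eq_neg.2 hweak]
  exact hasDerivAt_integral_comp_sub_smul hg (hφ.of_le (by simp)) hc e t

theorem norm_integral_smul_le_mul_eLpNorm {α E : Type*} [MeasurableSpace α] {μ : Measure α}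
    [NormedAddCommGroup E] [NormedSpace ℝ E] {φ : α → ℝ} {f : α → E} (hφ : MemLp φ 2 μ)
    (hf : MemLp f 2 μ) :
    ‖∫ x, φ x • f x ∂μ‖ ≤ (eLpNorm φ 2 μ).toReal * (eLpNorm f 2 μ).toReal := by
  have hholder : ‖∫ x, φ x • f x ∂μ‖ₑ ≤ eLpNorm φ 2 μ * eLpNorm f 2 μ := by
    refine (enorm_integral_le_lintegral_enorm _).trans ?_
    rw [← eLpNorm_one_eq_lintegral_enorm]
    exact eLpNorm_smul_le_mul_eLpNorm hf.1 hφ.1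
  rw [← toReal_enorm, ← ENNReal.toReal_mul]
  exact ENNReal.toReal_mono (ENNReal.mul_ne_top hφ.eLpNorm_ne_top hf.eLpNorm_ne_top) hholder

theorem IsWeakPartialDeriv.norm_integral_smul_shift_sub_le {i : Fin d}
    (hD : IsWeakPartialDeriv i g D) (hg : MemLp g 2 volume) (hDL : MemLp D 2 volume)
    (hφ : ContDiff ℝ ∞ φ) (hc : HasCompactSupport φ) (t : ℝ) :
    ‖∫ x, φ x • (g (x + t • EuclideanSpace.single i 1) - g x)‖ ≤
      |t| * (eLpNorm D 2 volume).toReal * (eLpNorm φ 2 volume).toReal := by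
  set e : Rd d := EuclideanSpace.single i 1
  have hφL : MemLp φ 2 volume := hφ.continuous.memLp_of_hasCompactSupport hc
  have hint {u : Rd d → ℂ} (hu : MemLp u 2 volume) : Integrable (fun x => φ x • u x) :=
    memLp_one_iff_integrable.1 (hu.smul hφL)
  have hbound (s : ℝ) : ‖∫ x, φ (x - s • e) • D x‖ ≤
      (eLpNorm D 2 volume).toReal * (eLpNorm φ 2 volume).toReal := by
    have hsub := measurePreserving_sub_right (volume : Measure (Rd d)) (s • e)
    have h := norm_integral_smul_le_mul_eLpNorm (hφL.comp_measurePreserving hsub) hDL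
    rwa [eLpNorm_comp_measurePreserving hφL.1 hsub, mul_comm] at h
  have hmoved : ∫ x, φ x • g (x + t • e) = ∫ x, φ (x - t • e) • g x := by
    rw [← integral_add_right_eq_self (fun x => φ (x - t • e) • g x) (t • e)]
    simp only [add_sub_cancel_right]
  have hmvt := Convex.norm_image_sub_le_of_norm_hasDerivWithin_le
    (f := fun t : ℝ => ∫ x, φ (x - t • e) • g x)
    (fun s _ => (hD.hasDerivAt_integral (hg.locallyIntegrable (by norm_num)) hφ hc
      s).hasDerivWithinAt)
    (fun s _ => hbound s) convex_univ (Set.mem_univ 0) (Set.mem_univ t)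
  simp only [zero_smul, sub_zero, Real.norm_eq_abs] at hmvt
  have hshift : Integrable fun x => φ x • g (x + t • e) :=
    hint (hg.comp_measurePreserving (measurePreserving_add_right volume (t • e)))
  simp_rw [smul_sub]
  rw [integral_sub hshift (hint hg), hmoved]
  exact hmvt.trans_eq (by ring)

end WeakDerivative

section Duality

variable {V : Type*} [NormedAddCommGroup V] [NormedSpace ℝ V] [FiniteDimensional ℝ V]
  [MeasurableSpace V] [BorelSpace V] {μ : Measure V} [IsFiniteMeasureOnCompacts μ] {M : ℝ}

theorem eLpNorm_two_le_of_forall_abs_integral_mul_le {u : V → ℝ} (hu : MemLp u 2 μ)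
    (h : ∀ φ : V → ℝ, ContDiff ℝ ∞ φ → HasCompactSupport φ →
      |∫ x, φ x * u x ∂μ| ≤ M * (eLpNorm φ 2 μ).toReal) :
    eLpNorm u 2 μ ≤ ENNReal.ofReal M := by
  set U : Lp ℝ 2 μ := hu.toLp
  have hclosed : IsClosed {f : Lp ℝ 2 μ | |⟪f, U⟫_ℝ| ≤ M * ‖f‖} :=
    isClosed_le (by fun_prop) (by fun_prop)
  have htest : {f : Lp ℝ 2 μ | ∃ g : V → ℝ, f =ᵐ[μ] g ∧ HasCompactSupport g ∧ ContDiff ℝ ∞ g} ⊆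
      {f | |⟪f, U⟫_ℝ| ≤ M * ‖f‖} := by
    rintro f ⟨φ, hf, hc, hφ⟩
    have hinner : ⟪f, U⟫_ℝ = ∫ x, φ x * u x ∂μ := by
      rw [L2.inner_def]
      refine integral_congr_ae ?_
      filter_upwards [hf, hu.coeFn_toLp] with x hx hx'
      rw [hx, hx', real_inner_eq_re_inner, RCLike.inner_apply, conj_trivial, mul_comm]
      rfl
    rw [Set.mem_ofPred_eq, hinner, Lp.norm_def, eLpNorm_congr_ae hf]
    exact h φ hφ hc
  have hU : |⟪U, U⟫_ℝ| ≤ M * ‖U‖ := hclosed.closure_subset_iff.2 htest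
    (Lp.dense_hasCompactSupport_contDiff (F := ℝ) (by norm_num) U)
  rw [real_inner_self_eq_norm_sq, abs_of_nonneg (sq_nonneg _), sq] at hU
  have hnorm : ENNReal.ofReal ‖U‖ = eLpNorm u 2 μ := by
    rw [Lp.norm_def, ENNReal.ofReal_toReal (Lp.eLpNorm_ne_top _), eLpNorm_congr_ae hu.coeFn_toLp]
  rw [← hnorm]
  rcases (norm_nonneg U).eq_or_lt with hzero | hpos
  · simp [← hzero]
  · exact ENNReal.ofReal_le_ofReal (le_of_mul_le_mul_right hU hpos)

theorem eLpNorm_two_le_of_forall_norm_integral_smul_le {u : V → ℂ} (hu : MemLp u 2 μ)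
    (h : ∀ φ : V → ℝ, ContDiff ℝ ∞ φ → HasCompactSupport φ →
      ‖∫ x, φ x • u x ∂μ‖ ≤ M * (eLpNorm φ 2 μ).toReal) :
    eLpNorm u 2 μ ≤ 2 * ENNReal.ofReal M := by
  have hint {φ : V → ℝ} (hφ : ContDiff ℝ ∞ φ) (hc : HasCompactSupport φ) :
      Integrable (fun x => φ x • u x) μ :=
    memLp_one_iff_integrable.1 (hu.smul (p := 2) (hφ.continuous.memLp_of_hasCompactSupport hc))
  have hre : eLpNorm (fun x => (u x).re) 2 μ ≤ ENNReal.ofReal M := by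
    refine eLpNorm_two_le_of_forall_abs_integral_mul_le hu.re fun φ hφ hc => ?_
    have hpart : ∫ x, φ x * (u x).re ∂μ = (∫ x, φ x • u x ∂μ).re := by
      simpa using integral_re (hint hφ hc)
    exact hpart ▸ (Complex.abs_re_le_norm _).trans (h φ hφ hc)
  have him : eLpNorm (fun x => (u x).im) 2 μ ≤ ENNReal.ofReal M := by
    refine eLpNorm_two_le_of_forall_abs_integral_mul_le hu.im fun φ hφ hc => ?_
    have hpart : ∫ x, φ x * (u x).im ∂μ = (∫ x, φ x • u x ∂μ).im := by
      simpa using integral_im (hint hφ hc)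
    exact hpart ▸ (Complex.abs_im_le_norm _).trans (h φ hφ hc)
  calc eLpNorm u 2 μ ≤ eLpNorm (fun x => ‖(u x).re‖ + ‖(u x).im‖) 2 μ :=
        eLpNorm_mono_real fun x => Complex.norm_le_abs_re_add_abs_im _
    _ ≤ eLpNorm (fun x => ‖(u x).re‖) 2 μ + eLpNorm (fun x => ‖(u x).im‖) 2 μ :=
        eLpNorm_add_le hu.re.1.norm hu.im.1.norm (by norm_num)
    _ = eLpNorm (fun x => (u x).re) 2 μ + eLpNorm (fun x => (u x).im) 2 μ := by
        rw [eLpNorm_norm, eLpNorm_norm]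
    _ ≤ _ := by rw [two_mul]; gcongr

end Duality

section MemSlobodeckij

variable {d : ℕ} {g D : Rd d → ℂ}

theorem IsWeakPartialDeriv.exists_shiftDistSq_le {i : Fin d} (hD : IsWeakPartialDeriv i g D)
    (hg : MemLp g 2 volume) (hDL : MemLp D 2 volume) :
    ∃ C : ℝ≥0∞, C ≠ ⊤ ∧ ∀ t : ℝ, shiftDistSq g (t • EuclideanSpace.single i 1) ≤ C * ‖t‖ₑ ^ 2 := by
  set M := (eLpNorm D 2 volume).toReal
  refine ⟨(2 * ENNReal.ofReal M) ^ 2, by finiteness, fun t => ?_⟩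
  have hnorm := eLpNorm_two_le_of_forall_norm_integral_smul_le
    ((hg.comp_measurePreserving (measurePreserving_add_right volume _)).sub hg)
    fun φ hφ hc => hD.norm_integral_smul_shift_sub_le hg hDL hφ hc t
  rw [shiftDistSq, ← sq_eLpNorm_two]
  refine (pow_le_pow_left' hnorm 2).trans_eq ?_
  rw [ENNReal.ofReal_mul (abs_nonneg t), ← Real.norm_eq_abs, ofReal_norm]
  ring

theorem MemSlobodeckijAux.memLp {θ : ℝ} {n : ℕ} (hg : MemSlobodeckijAux θ n g) :
    MemLp g 2 volume := by
  cases n <;> exact hg.1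

theorem MemSlobodeckij.exists_shiftDistSq_le {s : ℝ} (hs : 0 < s) (hm : Measurable g)
    (hg : MemSlobodeckij s g) (i : Fin d) :
    ∃ C : ℝ≥0∞, C ≠ ⊤ ∧ ∀ t : ℝ,
      shiftDistSq g (t • EuclideanSpace.single i 1) ≤ C * ‖t‖ₑ ^ (2 * min s 1) := by
  rcases lt_or_ge s 1 with hlt | hge
  · rw [MemSlobodeckij, Nat.floor_eq_zero.2 hlt, MemSlobodeckijAux, Nat.cast_zero, sub_zero] at hg
    obtain ⟨C, hC, h⟩ := exists_shiftDistSq_le_of_slobodeckijSeminormSq_ne_top hm hs (hg.2 hs).ne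
    refine ⟨C, hC, fun t => (h _).trans_eq ?_⟩
    rw [min_eq_left hlt.le, enorm_smul, ← ofReal_norm (EuclideanSpace.single i (1 : ℝ))]
    simp
  · obtain ⟨n, hn⟩ := Nat.exists_eq_succ_of_ne_zero (Nat.floor_pos.2 hge).ne'
    rw [MemSlobodeckij, hn] at hg
    obtain ⟨D, hD, hDmem⟩ := hg.2 i
    simpa [min_eq_right hge] using hD.exists_shiftDistSq_le hg.1 hDmem.memLp

end MemSlobodeckij

section Translation

variable {d : ℕ}

theorem translateL2_coeFn (a : Rd d) (f : L2 d) :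
    (translateL2 a f : Rd d → ℂ) =ᵐ[volume] fun x => (f : Rd d → ℂ) (x - a) :=
  Lp.coeFn_compMeasurePreserving f (measurePreserving_sub_right volume a)

theorem continuous_translateL2 (a : Rd d) : Continuous (translateL2 a) :=
  (Lp.isometry_compMeasurePreserving (measurePreserving_sub_right volume a)).continuous

theorem continuous_fourier_L2 : Continuous fun f : L2 d => (𝓕 f : L2 d) :=
  (Lp.fourierTransformₗᵢ (Rd d) ℂ).continuous

theorem translateL2_schwartz_toLp (a : Rd d) (f : SchwartzMap (Rd d) ℂ) :
    translateL2 a (f.toLp 2 : L2 d) = (f.compSubConstCLM ℂ a).toLp 2 := by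
  refine Lp.ext ?_
  filter_upwards [translateL2_coeFn a (f.toLp 2 : L2 d),
    (measurePreserving_sub_right volume a).quasiMeasurePreserving.ae (f.coeFn_toLp 2 volume),
    (f.compSubConstCLM ℂ a).coeFn_toLp 2 volume] with x htranslate hf hcomp
  rw [htranslate, hcomp, hf, SchwartzMap.compSubConstCLM_apply]

theorem fourier_compSubConstCLM (a : Rd d) (f : SchwartzMap (Rd d) ℂ) (ξ : Rd d) :
    (𝓕 (f.compSubConstCLM ℂ a)) ξ = (Real.fourierChar (-⟪a, ξ⟫_ℝ) : ℂ) * (𝓕 f) ξ := by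
  rw [SchwartzMap.fourier_coe, SchwartzMap.fourier_coe, Real.fourier_eq, Real.fourier_eq,
    ← integral_const_mul, ← integral_add_right_eq_self _ a]
  refine integral_congr_ae (Eventually.of_forall fun v => ?_)
  simp only [SchwartzMap.compSubConstCLM_apply, add_sub_cancel_right, Circle.smul_def, smul_eq_mul]
  rw [inner_add_left, neg_add, AddChar.map_add_eq_mul, Circle.coe_mul]
  ring

theorem isClosed_setOf_ae_eq_mul {α : Type*} [MeasurableSpace α] {μ : Measure α} (c : α → ℂ) :
    IsClosed {p : Lp ℂ 2 μ × Lp ℂ 2 μ | ∀ᵐ x ∂μ, p.2 x = c x * p.1 x} := by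
  refine IsSeqClosed.isClosed fun u p hu hlim => ?_
  obtain ⟨ns, hns, hfst⟩ := (tendstoInMeasure_of_tendsto_Lp
    ((continuous_fst.tendsto p).comp hlim)).exists_seq_tendsto_ae
  obtain ⟨ms, hms, hsnd⟩ := (tendstoInMeasure_of_tendsto_Lp
    ((continuous_snd.tendsto p).comp (hlim.comp hns.tendsto_atTop))).exists_seq_tendsto_ae
  filter_upwards [hfst, hsnd, ae_all_iff.2 hu] with x hx₁ hx₂ hx
  exact tendsto_nhds_unique hx₂
    (((hx₁.comp hms.tendsto_atTop).const_mul _).congr fun i => (hx _).symm)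

theorem fourier_translateL2 (a : Rd d) (f : L2 d) :
    ∀ᵐ ξ, (𝓕 (translateL2 a f) : L2 d) ξ =
      (Real.fourierChar (-⟪a, ξ⟫_ℝ) : ℂ) * (𝓕 f : L2 d) ξ := by
  refine (SchwartzMap.denseRange_toLpCLM (E := Rd d) (F := ℂ) (p := 2)
    ENNReal.ofNat_ne_top).induction_on
    (p := fun f : L2 d => ∀ᵐ ξ, (𝓕 (translateL2 a f) : L2 d) ξ =
      (Real.fourierChar (-⟪a, ξ⟫_ℝ) : ℂ) * (𝓕 f : L2 d) ξ) f ?_ fun f => ?_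
  · exact (isClosed_setOf_ae_eq_mul _).preimage
      (continuous_fourier_L2.prodMk (continuous_fourier_L2.comp (continuous_translateL2 a)))
  · rw [SchwartzMap.toLpCLM_apply, translateL2_schwartz_toLp, SchwartzMap.toLp_fourier_eq,
      SchwartzMap.toLp_fourier_eq]
    filter_upwards [(𝓕 (f.compSubConstCLM ℂ a)).coeFn_toLp 2 volume,
      (𝓕 f).coeFn_toLp 2 volume] with ξ htranslate hf
    rw [htranslate, hf, fourier_compSubConstCLM]

end Translation

section LatticeRestriction

variable {d : ℕ}

theorem latticePoint_add (m n : Fin d → ℤ) :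
    (latticePoint (m + n) : Rd d) = latticePoint m + latticePoint n := by
  ext i
  simp [latticePoint]

theorem latticePoint_zero : (latticePoint (0 : Fin d → ℤ) : Rd d) = 0 := by
  ext i
  simp [latticePoint]

theorem ae_forall_latticePoint {P : Rd d → Prop} (h : ∀ᵐ x, P x) :
    ∀ᵐ x, ∀ n : Fin d → ℤ, P (x + latticePoint n) :=
  ae_all_iff.2 fun n => (measurePreserving_add_right volume
    (latticePoint n : Rd d)).quasiMeasurePreserving.ae h

/-- The restriction of `f` to the coset `x + ℤ^d`. -/
def latticeRestriction (f : Rd d → ℂ) (x : Rd d) : (Fin d → ℤ) → ℂ :=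
  fun n => f (x + latticePoint n)

/-- The functions in `L²(ℝ^d)` whose restriction to almost every coset `x + ℤ^d` lies in `W x`. -/
def latticeFiberedSubmodule (W : Rd d → Submodule ℂ ((Fin d → ℤ) → ℂ)) : Submodule ℂ (L2 d) where
  carrier := {f | ∀ᵐ x, latticeRestriction f x ∈ W x}
  zero_mem' := by
    filter_upwards [ae_forall_latticePoint (Lp.coeFn_zero ℂ 2 (volume : Measure (Rd d)))] with x hx
    have hzero : latticeRestriction (0 : L2 d) x = 0 := funext hx
    exact hzero ▸ (W x).zero_mem
  add_mem' {f g} hf hg := by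
    filter_upwards [hf, hg, ae_forall_latticePoint (Lp.coeFn_add f g)] with x hfx hgx hx
    have hadd : latticeRestriction (f + g : L2 d) x =
        latticeRestriction f x + latticeRestriction g x := funext hx
    exact hadd ▸ (W x).add_mem hfx hgx
  smul_mem' c f hf := by
    filter_upwards [hf, ae_forall_latticePoint (Lp.coeFn_smul c f)] with x hfx hx
    have hsmul : latticeRestriction (c • f : L2 d) x = c • latticeRestriction f x := funext hx
    exact hsmul ▸ (W x).smul_mem c hfx

theorem isClosed_latticeFiberedSubmodule {W : Rd d → Submodule ℂ ((Fin d → ℤ) → ℂ)}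
    (hW : ∀ x, IsClosed (W x : Set ((Fin d → ℤ) → ℂ))) :
    IsClosed (latticeFiberedSubmodule W : Set (L2 d)) := by
  refine IsSeqClosed.isClosed fun u f hu hlim => ?_
  obtain ⟨ns, -, hns⟩ := (tendstoInMeasure_of_tendsto_Lp hlim).exists_seq_tendsto_ae
  filter_upwards [ae_forall_latticePoint hns, ae_all_iff.2 hu] with x hx hmem
  exact (hW x).mem_of_tendsto (tendsto_pi_nhds.2 hx) (Eventually.of_forall fun i => hmem (ns i))

end LatticeRestriction

section ShiftInvariantSpace

variable {d K : ℕ}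

/-- The character `n ↦ exp (-2πi ⟨γ, n⟩)` of the lattice. -/
def latticeChar (γ : Rd d) (n : Fin d → ℤ) : ℂ :=
  (Real.fourierChar (-⟪γ, (latticePoint n : Rd d)⟫_ℝ) : ℂ)

theorem latticeChar_ne_zero (γ : Rd d) (n : Fin d → ℤ) : latticeChar γ n ≠ 0 :=
  Circle.coe_ne_zero _

theorem latticeChar_add (γ : Rd d) (n m : Fin d → ℤ) :
    latticeChar γ (n + m) = latticeChar γ n * latticeChar γ m := by
  simp only [latticeChar, latticePoint_add, inner_add_right, neg_add, AddChar.map_add_eq_mul,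
    Circle.coe_mul]

theorem latticeChar_latticePoint (m n : Fin d → ℤ) : latticeChar (latticePoint m) n = 1 := by
  have hint : -⟪(latticePoint m : Rd d), latticePoint n⟫_ℝ = ((-∑ i, n i * m i : ℤ) : ℝ) := by
    simp [latticePoint, PiLp.inner_apply]
  rw [latticeChar, hint, Real.fourierChar_apply, Complex.exp_eq_one_iff]
  exact ⟨-∑ i, n i * m i, by push_cast; ring⟩

theorem ae_latticeRestriction_fourier_translateL2 (a : Rd d) (f : L2 d) :
    ∀ᵐ x, latticeRestriction (𝓕 (translateL2 a f) : L2 d) x =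
      (Real.fourierChar (-⟪a, x⟫_ℝ) : ℂ) •
        (latticeChar a * latticeRestriction (𝓕 f : L2 d) x) := by
  filter_upwards [ae_forall_latticePoint (fourier_translateL2 a f)] with x hx
  funext n
  simp only [latticeRestriction, hx n, latticeChar, inner_add_right, neg_add,
    AddChar.map_add_eq_mul, Circle.coe_mul, Pi.smul_apply, Pi.mul_apply, smul_eq_mul, mul_assoc]

theorem subset_shiftInvariantSpace (G : Set (L2 d)) : G ⊆ shiftInvariantSpace G := by
  intro g hg
  refine Submodule.le_topologicalClosure _ (Submodule.subset_span ⟨g, hg, 0, Lp.ext ?_⟩)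
  filter_upwards [translateL2_coeFn (latticePoint (0 : Fin d → ℤ)) g] with x hx
  rw [hx, latticePoint_zero, sub_zero]

/-- On the Fourier side an integer translation is the multiplication by a function which is constant
on the cosets of the lattice. -/
theorem ae_latticeRestriction_fourier_mem_span {κ : Type*} [Finite κ] (g : κ → L2 d) {f : L2 d}
    (hf : f ∈ shiftInvariantSpace (Set.range g)) :
    ∀ᵐ x, latticeRestriction (𝓕 f : L2 d) x ∈
      Submodule.span ℂ (Set.range fun k => latticeRestriction (𝓕 (g k) : L2 d) x) := by
  set W : Rd d → Submodule ℂ ((Fin d → ℤ) → ℂ) := fun x =>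
    Submodule.span ℂ (Set.range fun k => latticeRestriction (𝓕 (g k) : L2 d) x)
  have hW (x : Rd d) : IsClosed (W x : Set ((Fin d → ℤ) → ℂ)) :=
    have := FiniteDimensional.span_of_finite ℂ
      (Set.finite_range fun k => latticeRestriction (𝓕 (g k) : L2 d) x)
    (W x).closed_of_finiteDimensional
  have hle : shiftInvariantSpace (Set.range g) ≤
      (latticeFiberedSubmodule W).comap (Lp.fourierTransformₗᵢ (Rd d) ℂ).toLinearMap := by
    refine Submodule.topologicalClosure_minimal _ (Submodule.span_le.2 ?_)
      ((isClosed_latticeFiberedSubmodule hW).preimage continuous_fourier_L2)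
    rintro _ ⟨_, ⟨k, rfl⟩, m, rfl⟩
    change ∀ᵐ x, _ ∈ W x
    filter_upwards [ae_latticeRestriction_fourier_translateL2 (latticePoint m) (g k)] with x hx
    have hone : latticeChar (latticePoint m : Rd d) = 1 := funext (latticeChar_latticePoint m)
    rw [hone, one_mul] at hx
    exact hx ▸ (W x).smul_mem _ (Submodule.subset_span ⟨k, rfl⟩)
  exact hle hf

/-- The Fourier transforms of a finite family in `L²`. -/
abbrev fourierFamily (F : Fin K → L2 d) : Fin K → Rd d → ℂ := fun k => ((𝓕 (F k) : L2 d) : Rd d → ℂ)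

theorem ae_finrank_span_fiber_le (F : Fin K → L2 d) (G : Finset (L2 d))
    (hG : shiftInvariantSpace (G : Set (L2 d)) = shiftInvariantSpace (Set.range F)) :
    ∀ᵐ x, Module.finrank ℂ (Submodule.span ℂ (Set.range (fiber (fourierFamily F) x))) ≤ G.card := by
  have hmem (k : Fin K) : F k ∈ shiftInvariantSpace (Set.range (Subtype.val : G → L2 d)) := by
    rw [Subtype.range_coe, hG]
    exact subset_shiftInvariantSpace _ ⟨k, rfl⟩
  filter_upwards [ae_all_iff.2 fun k => ae_latticeRestriction_fourier_mem_span _ (hmem k)] with x hx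
  simp only [Submodule.mem_span_range_iff_exists_fun] at hx
  choose c hc using hx
  let v : G → EuclideanSpace ℂ (Fin K) := fun j => WithLp.toLp 2 fun k => c k j
  have hle : Submodule.span ℂ (Set.range (fiber (fourierFamily F) x)) ≤
      Submodule.span ℂ (Set.range v) := by
    rw [Submodule.span_le]
    rintro _ ⟨n, rfl⟩
    have hsum : fiber (fourierFamily F) x n =
        ∑ j : G, (𝓕 (j : L2 d) : L2 d) (x + latticePoint n) • v j := by
      ext k
      have hck := (congrFun (hc k) n).symm
      simpa [fiber, latticeRestriction, v, mul_comm] using hck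
    rw [hsum]
    exact Submodule.sum_mem _ fun j _ => Submodule.smul_mem _ _ (Submodule.subset_span ⟨j, rfl⟩)
  calc _ ≤ _ := Submodule.finrank_mono hle
    _ ≤ Fintype.card G := finrank_range_le_card v
    _ = G.card := Fintype.card_coe G

theorem ae_exists_linearMap_fiber_eq (F : Fin K → L2 d) {γ : Rd d}
    (hγ : ∀ h ∈ shiftInvariantSpace (Set.range F), translateL2 γ h ∈
      shiftInvariantSpace (Set.range F)) :
    ∀ᵐ x, ∃ B : EuclideanSpace ℂ (Fin K) →ₗ[ℂ] EuclideanSpace ℂ (Fin K),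
      ∀ n, B (fiber (fourierFamily F) x n) = latticeChar γ n • fiber (fourierFamily F) x n := by
  have hmem (k : Fin K) : translateL2 γ (F k) ∈ shiftInvariantSpace (Set.range F) :=
    hγ _ (subset_shiftInvariantSpace _ ⟨k, rfl⟩)
  filter_upwards [ae_all_iff.2 fun k => ae_latticeRestriction_fourier_mem_span F (hmem k),
    ae_all_iff.2 fun k => ae_latticeRestriction_fourier_translateL2 γ (F k)] with x hx htranslate
  simp only [htranslate, Submodule.mem_span_range_iff_exists_fun] at hx
  choose c hc using hx
  set ε : ℂ := (Real.fourierChar (-⟪γ, x⟫_ℝ) : ℂ)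
  have hε : ε ≠ 0 := Circle.coe_ne_zero _
  refine ⟨ε⁻¹ • Matrix.toEuclideanLin (Matrix.of c), fun n => ?_⟩
  rw [LinearMap.smul_apply, inv_smul_eq_iff₀ hε]
  ext k
  have hck := congrFun (hc k) n
  simpa [fiber, latticeRestriction, Matrix.toLpLin_apply, Matrix.mulVec, dotProduct] using hck

end ShiftInvariantSpace

section Periodization

theorem measurableSet_cube {d : ℕ} (x : Rd d) (τ : ℝ) : MeasurableSet (cube x τ) := by
  have hcube : cube x τ = ⋂ i, {y : Rd d | |y i - x i| ≤ τ} := by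
    ext y
    simp only [cube, Set.mem_ofPred_eq, Set.mem_iInter]
  rw [hcube]
  exact MeasurableSet.iInter fun i => measurableSet_le (by fun_prop) measurable_const

theorem tsum_indicator_cube_sub_latticePoint_le {d : ℕ} (N : ℕ) (x : Rd d) :
    ∑' n : Fin d → ℤ, (cube (0 : Rd d) N).indicator (1 : Rd d → ℝ≥0∞) (x - latticePoint n) ≤
      (2 * N + 3) ^ d := by
  set S := Fintype.piFinset fun _ : Fin d => Finset.Icc (-(N + 1) : ℤ) (N + 1)
  have hcard : (S.card : ℝ≥0∞) = (2 * N + 3) ^ d := by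
    have hIcc : (N + 1 + 1 - -(N + 1) : ℤ).toNat = 2 * N + 3 := by lia
    rw [Fintype.card_piFinset_const, Int.card_Icc, hIcc]
    push_cast
    rfl
  rw [← (Equiv.addLeft fun i => round (x i)).tsum_eq, tsum_eq_sum (s := S), ← hcard]
  · refine (Finset.sum_le_sum (g := fun _ => 1) fun n _ => ?_).trans (by simp)
    exact Set.indicator_le_self' (fun _ _ => zero_le_one) _
  · refine fun n hn => Set.indicator_of_notMem (fun hx => hn (Fintype.mem_piFinset.2 fun i => ?_)) _
    have hcube := hx i
    simp only [latticePoint, Equiv.coe_addLeft, Pi.add_apply, PiLp.sub_apply, PiLp.zero_apply,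
      Int.cast_add, sub_zero] at hcube
    have hround := abs_le.1 (abs_sub_round (x i))
    have hlt : ((n i : ℤ) : ℝ) < ((N + 2 : ℤ) : ℝ) := by
      push_cast
      linarith [(abs_le.1 hcube).1]
    have hgt : ((-(N + 2) : ℤ) : ℝ) < ((n i : ℤ) : ℝ) := by
      push_cast
      linarith [(abs_le.1 hcube).2]
    rw [Finset.mem_Icc]
    have := Int.cast_lt.1 hlt
    have := Int.cast_lt.1 hgt
    lia

theorem setLIntegral_cube_tsum_add_latticePoint_le {d : ℕ} (N : ℕ) {G : Rd d → ℝ≥0∞}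
    (hG : Measurable G) :
    ∫⁻ x in cube (0 : Rd d) N, ∑' n : Fin d → ℤ, G (x + latticePoint n) ≤
      (2 * N + 3) ^ d * ∫⁻ x, G x := by
  have hm := measurableSet_cube (0 : Rd d) N
  set χ := (cube (0 : Rd d) N).indicator (1 : Rd d → ℝ≥0∞)
  have hχm : Measurable χ := measurable_one.indicator hm
  have hshift (n : Fin d → ℤ) : ∫⁻ x in cube (0 : Rd d) N, G (x + latticePoint n) =
      ∫⁻ x, χ (x - latticePoint n) * G x := by
    rw [← lintegral_indicator hm, ← lintegral_add_right_eq_self (μ := volume)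
      (fun x => χ (x - latticePoint n) * G x) (latticePoint n)]
    refine lintegral_congr fun x => ?_
    by_cases hx : x ∈ cube (0 : Rd d) N <;> simp [χ, hx]
  calc ∫⁻ x in cube (0 : Rd d) N, ∑' n : Fin d → ℤ, G (x + latticePoint n)
      = ∑' n : Fin d → ℤ, ∫⁻ x, χ (x - latticePoint n) * G x := by
        rw [← tsum_congr hshift]
        exact lintegral_tsum fun n => by fun_prop
    _ = ∫⁻ x, (∑' n : Fin d → ℤ, χ (x - latticePoint n)) * G x := by
        simp only [← ENNReal.tsum_mul_right]
        exact (lintegral_tsum fun n => by fun_prop).symm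
    _ ≤ ∫⁻ x, (2 * N + 3) ^ d * G x := by
        gcongr with x
        exact tsum_indicator_cube_sub_latticePoint_le N x
    _ = _ := lintegral_const_mul _ hG

theorem enorm_toLp_sq {K : ℕ} (v : Fin K → ℂ) :
    ‖(WithLp.toLp 2 v : EuclideanSpace ℂ (Fin K))‖ₑ ^ 2 = ∑ k, ‖v k‖ₑ ^ 2 := by
  rw [← ofReal_norm, ← ENNReal.ofReal_pow (norm_nonneg _), EuclideanSpace.norm_sq_eq,
    ENNReal.ofReal_sum_of_nonneg fun _ _ => sq_nonneg _]
  refine Finset.sum_congr rfl fun k _ => ?_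
  rw [ENNReal.ofReal_pow (norm_nonneg _), ofReal_norm]

variable {d K : ℕ} {H : Fin K → Rd d → ℂ}

theorem setLIntegral_cube_fiberNormSq_le (hm : ∀ k, Measurable (H k)) (N : ℕ) :
    ∫⁻ x in cube (0 : Rd d) N, fiberNormSq H x ≤
      (2 * N + 3) ^ d * ∑ k, ∫⁻ x, ‖H k x‖ₑ ^ 2 := by
  have hle := setLIntegral_cube_tsum_add_latticePoint_le (G := fun x => ∑ k, ‖H k x‖ₑ ^ 2) N
    (by fun_prop)
  rw [lintegral_finsetSum _ fun k _ => (hm k).enorm.pow_const 2] at hle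
  refine le_trans (le_of_eq ?_) hle
  refine lintegral_congr fun x => tsum_congr fun n => ?_
  rw [fiber, enorm_toLp_sq]

theorem ae_fiberNormSq_ne_top (hm : ∀ k, Measurable (H k))
    (hH : ∀ k, ∫⁻ x, ‖H k x‖ₑ ^ 2 ≠ ⊤) : ∀ᵐ x, fiberNormSq H x ≠ ⊤ := by
  have hcube : ∀ᵐ x, ∀ N : ℕ, x ∈ cube (0 : Rd d) N → fiberNormSq H x < ⊤ := by
    refine ae_all_iff.2 fun N => (ae_restrict_iff' (measurableSet_cube _ _)).1 ?_
    refine ae_lt_top (measurable_fiberNormSq hm)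
      (ne_top_of_le_ne_top ?_ (setLIntegral_cube_fiberNormSq_le hm N))
    exact ENNReal.mul_ne_top (by finiteness) (ENNReal.sum_ne_top.2 fun k _ => hH k)
  filter_upwards [hcube] with x hx
  obtain ⟨N, hN⟩ := exists_nat_ge ‖x‖
  refine (hx N fun i => ?_).ne
  rw [PiLp.zero_apply, sub_zero, ← Real.norm_eq_abs]
  exact (PiLp.norm_apply_le x i).trans hN

theorem setLIntegral_cube_fiberDistSq_le (hm : ∀ k, Measurable (H k)) (N : ℕ) (h : Rd d) :
    ∫⁻ x in cube (0 : Rd d) N, fiberDistSq H x (x + h) ≤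
      (2 * N + 3) ^ d * ∑ k, shiftDistSq (H k) h := by
  have hmeas (k : Fin K) : Measurable fun x => ‖H k (x + h) - H k x‖ₑ ^ 2 :=
    (((hm k).comp (measurable_id.add_const _)).sub (hm k)).enorm.pow_const 2
  have hle := setLIntegral_cube_tsum_add_latticePoint_le
    (G := fun x => ∑ k, ‖H k (x + h) - H k x‖ₑ ^ 2) N
    (Finset.measurable_fun_sum _ fun k _ => hmeas k)
  rw [lintegral_finsetSum _ fun k _ => hmeas k] at hle
  refine le_trans (le_of_eq ?_) hle
  refine lintegral_congr fun x => tsum_congr fun n => ?_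
  rw [← enorm_neg, neg_sub, fiber, fiber, ← WithLp.toLp_sub, enorm_toLp_sq]
  refine Finset.sum_congr rfl fun k _ => ?_
  rw [Pi.sub_apply, add_right_comm]

end Periodization

section Lines

variable {m : ℕ}

/-- The point of `ℝ^{m+1}` with `i`-th coordinate `t` and remaining coordinates `z`: as `t` varies,
it runs through the line over `z` parallel to the `i`-th axis. -/
def linePoint (i : Fin (m + 1)) (t : ℝ) (z : Fin m → ℝ) : Rd (m + 1) :=
  WithLp.toLp 2 (i.insertNth t z)

theorem measurePreserving_linePoint (i : Fin (m + 1)) :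
    MeasurePreserving fun p : ℝ × (Fin m → ℝ) => linePoint i p.1 p.2 :=
  (PiLp.volume_preserving_toLp (Fin (m + 1))).comp
    (volume_preserving_piFinSuccAbove (fun _ : Fin (m + 1) => ℝ) i).symm

theorem measurable_linePoint (i : Fin (m + 1)) :
    Measurable fun p : ℝ × (Fin m → ℝ) => linePoint i p.1 p.2 :=
  (measurePreserving_linePoint i).measurable

theorem linePoint_zero (i : Fin (m + 1)) : linePoint i 0 (0 : Fin m → ℝ) = 0 := by
  ext j
  cases j using i.succAboveCases <;> simp [linePoint]

theorem linePoint_add (i : Fin (m + 1)) (t h : ℝ) (z : Fin m → ℝ) :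
    linePoint i (t + h) z = linePoint i t z + h • EuclideanSpace.single i 1 := by
  ext j
  cases j using i.succAboveCases <;> simp [linePoint, Fin.succAbove_ne]

theorem linePoint_mem_cube_iff {i : Fin (m + 1)} {t t' τ : ℝ} {z z' : Fin m → ℝ} :
    linePoint i t z ∈ cube (linePoint i t' z') τ ↔ |t - t'| ≤ τ ∧ ∀ k, |z k - z' k| ≤ τ := by
  simp only [cube, Set.mem_ofPred_eq, Fin.forall_iff_succAbove i, linePoint,
    Fin.insertNth_apply_same, Fin.insertNth_apply_succAbove]

theorem preimage_linePoint_cube (i : Fin (m + 1)) (t : ℝ) (z : Fin m → ℝ) {τ : ℝ} (hτ : 0 ≤ τ) :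
    (fun p : ℝ × (Fin m → ℝ) => linePoint i p.1 p.2) ⁻¹' cube (linePoint i t z) τ =
      Metric.closedBall t τ ×ˢ Metric.closedBall z τ := by
  ext p
  rw [Set.mem_preimage, linePoint_mem_cube_iff, Set.mem_prod, Metric.mem_closedBall,
    Metric.mem_closedBall, Real.dist_eq, dist_pi_le_iff hτ]
  simp only [Real.dist_eq]

theorem ae_linePoint (i : Fin (m + 1)) {P : Rd (m + 1) → Prop} (h : ∀ᵐ x, P x) :
    ∀ᵐ z : Fin m → ℝ, ∀ᵐ t : ℝ, P (linePoint i t z) :=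
  Measure.ae_ae_of_ae_prod <| (Measure.measurePreserving_swap
    (μ := (volume : Measure (Fin m → ℝ))) (ν := (volume : Measure ℝ))).quasiMeasurePreserving.ae
      ((measurePreserving_linePoint i).quasiMeasurePreserving.ae h)

theorem setLIntegral_cube_linePoint (i : Fin (m + 1)) {f : Rd (m + 1) → ℝ≥0∞} (hf : Measurable f)
    (t : ℝ) (z : Fin m → ℝ) {τ : ℝ} (hτ : 0 ≤ τ) :
    ∫⁻ x in cube (linePoint i t z) τ, f x = ∫⁻ z' in Metric.closedBall z τ,
      ∫⁻ t' in Metric.closedBall t τ, f (linePoint i t' z') := by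
  rw [← (measurePreserving_linePoint i).setLIntegral_comp_preimage (measurableSet_cube _ _) hf,
    preimage_linePoint_cube i t z hτ, Measure.volume_eq_prod, setLIntegral_prod_symm]
  exact (hf.comp (measurable_linePoint i)).aemeasurable

end Lines

section LineEnergy

theorem gagliardoEnergy_Icc_le (a b p : ℝ) (D : ℝ → ℝ → ℝ≥0∞) :
    gagliardoEnergy (Set.Icc a b) p D ≤
      ∫⁻ t in Set.Icc a b, ∫⁻ h in Set.Icc (a - b) (b - a), D t (t + h) / ‖h‖ₑ ^ p := by
  refine setLIntegral_mono' measurableSet_Icc fun t ht => ?_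
  rw [← lintegral_indicator measurableSet_Icc, ← lintegral_indicator measurableSet_Icc,
    ← lintegral_add_left_eq_self _ t]
  refine lintegral_mono fun h => ?_
  by_cases hmem : t + h ∈ Set.Icc a b
  · have hdiff : h ∈ Set.Icc (a - b) (b - a) :=
      ⟨by linarith [ht.2, hmem.1], by linarith [ht.1, hmem.2]⟩
    rw [Set.indicator_of_mem hmem, Set.indicator_of_mem hdiff, sub_add_cancel_left, enorm_neg]
  · rw [Set.indicator_of_notMem hmem]
    exact zero_le

theorem lintegral_Icc_enorm_rpow_ne_top {q : ℝ} (hq : -1 < q) (R : ℝ) :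
    ∫⁻ h in Set.Icc (-R) R, ‖h‖ₑ ^ q ≠ ⊤ := by
  have hpos : IntervalIntegrable (fun x : ℝ => |x| ^ q) volume 0 |R| := by
    refine (intervalIntegral.intervalIntegrable_rpow' hq).congr fun x hx => ?_
    rw [Set.uIoc_of_le (abs_nonneg R)] at hx
    simp only [abs_of_pos hx.1]
  have hneg : IntervalIntegrable (fun x : ℝ => |x| ^ q) volume (-|R|) 0 := by
    rw [IntervalIntegrable.iff_comp_neg]
    simpa using hpos.symm
  have hint : IntegrableOn (fun x : ℝ => |x| ^ q) (Set.Icc (-R) R) :=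
    ((intervalIntegrable_iff_integrableOn_Icc_of_le (by linarith [abs_nonneg R])).1
      (hneg.trans hpos)).mono_set (Set.Icc_subset_Icc (neg_le_neg (le_abs_self R)) (le_abs_self R))
  refine ne_top_of_le_ne_top hint.2.ne (lintegral_mono_ae (ae_restrict_of_ae ?_))
  filter_upwards [Measure.ae_ne volume (0 : ℝ)] with h hh
  rw [← ofReal_norm h, ENNReal.ofReal_rpow_of_pos (norm_pos_iff.2 hh), Real.norm_eq_abs,
    ← ofReal_norm (|h| ^ q), Real.norm_of_nonneg (Real.rpow_nonneg (abs_nonneg h) q)]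

variable {m : ℕ} {D : Rd (m + 1) → Rd (m + 1) → ℝ≥0∞}

theorem measurable_comp_linePoint_linePoint
    (hD : Measurable fun x : Rd (m + 1) × Rd (m + 1) => D x.1 x.2) (i : Fin (m + 1)) :
    Measurable fun q : ((Fin m → ℝ) × ℝ) × ℝ =>
      D (linePoint i q.1.2 q.1.1) (linePoint i q.2 q.1.1) := by
  have hleft : Measurable fun q : ((Fin m → ℝ) × ℝ) × ℝ => linePoint i q.1.2 q.1.1 :=
    (measurable_linePoint i).comp (Measurable.prodMk (by fun_prop) (by fun_prop))
  have hright : Measurable fun q : ((Fin m → ℝ) × ℝ) × ℝ => linePoint i q.2 q.1.1 :=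
    (measurable_linePoint i).comp (Measurable.prodMk (by fun_prop) (by fun_prop))
  exact hD.comp (hleft.prodMk hright)

theorem measurable_gagliardoEnergy_linePoint
    (hD : Measurable fun x : Rd (m + 1) × Rd (m + 1) => D x.1 x.2) (i : Fin (m + 1))
    (I : Set ℝ) (p : ℝ) :
    Measurable fun z => gagliardoEnergy I p fun s t => D (linePoint i s z) (linePoint i t z) := by
  have hm : Measurable fun q : ((Fin m → ℝ) × ℝ) × ℝ =>
      D (linePoint i q.1.2 q.1.1) (linePoint i q.2 q.1.1) / ‖q.1.2 - q.2‖ₑ ^ p :=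
    (measurable_comp_linePoint_linePoint hD i).div (by fun_prop)
  exact (hm.lintegral_prod_right' (ν := volume.restrict I)).lintegral_prod_right'
    (ν := volume.restrict I)

theorem lintegral_lintegral_linePoint_add
    (hD : Measurable fun x : Rd (m + 1) × Rd (m + 1) => D x.1 x.2) (i : Fin (m + 1)) {R : ℝ}
    (hR : 0 ≤ R) (h : ℝ) :
    ∫⁻ z in Metric.closedBall (0 : Fin m → ℝ) R, ∫⁻ t in Set.Icc (-R) R,
        D (linePoint i t z) (linePoint i (t + h) z) =
      ∫⁻ x in cube (0 : Rd (m + 1)) R, D x (x + h • EuclideanSpace.single i 1) := by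
  have hm : Measurable fun x => D x (x + h • EuclideanSpace.single i 1) :=
    hD.comp (measurable_id.prodMk (measurable_id.add_const _))
  have hline := setLIntegral_cube_linePoint i hm 0 0 hR
  rw [linePoint_zero, Real.closedBall_eq_Icc, zero_sub, zero_add] at hline
  simp only [hline, linePoint_add]

theorem lintegral_gagliardoEnergy_linePoint_le
    (hD : Measurable fun x : Rd (m + 1) × Rd (m + 1) => D x.1 x.2) (i : Fin (m + 1)) {R : ℝ}
    (hR : 0 ≤ R) (p : ℝ) :
    ∫⁻ z in Metric.closedBall (0 : Fin m → ℝ) R,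
        gagliardoEnergy (Set.Icc (-R) R) p (fun s t => D (linePoint i s z) (linePoint i t z)) ≤
      ∫⁻ h in Set.Icc (-(2 * R)) (2 * R),
        (∫⁻ x in cube (0 : Rd (m + 1)) R, D x (x + h • EuclideanSpace.single i 1)) / ‖h‖ₑ ^ p := by
  set Z := Metric.closedBall (0 : Fin m → ℝ) R
  have hmD : Measurable fun q : ((Fin m → ℝ) × ℝ) × ℝ =>
      D (linePoint i q.1.2 q.1.1) (linePoint i (q.1.2 + q.2) q.1.1) :=
    (measurable_comp_linePoint_linePoint hD i).comp
      (by fun_prop : Measurable fun q : ((Fin m → ℝ) × ℝ) × ℝ => (q.1, q.1.2 + q.2))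
  have hm : Measurable fun q : ((Fin m → ℝ) × ℝ) × ℝ =>
      D (linePoint i q.1.2 q.1.1) (linePoint i (q.1.2 + q.2) q.1.1) / ‖q.2‖ₑ ^ p :=
    hmD.div (by fun_prop)
  calc ∫⁻ z in Z, gagliardoEnergy (Set.Icc (-R) R) p
        (fun s t => D (linePoint i s z) (linePoint i t z))
      ≤ ∫⁻ z in Z, ∫⁻ t in Set.Icc (-R) R, ∫⁻ h in Set.Icc (-(2 * R)) (2 * R),
          D (linePoint i t z) (linePoint i (t + h) z) / ‖h‖ₑ ^ p := by
        refine lintegral_mono fun z => (gagliardoEnergy_Icc_le _ _ _ _).trans_eq ?_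
        rw [show -R - R = -(2 * R) by ring, show R - -R = 2 * R by ring]
    _ = ∫⁻ h in Set.Icc (-(2 * R)) (2 * R), ∫⁻ z in Z, ∫⁻ t in Set.Icc (-R) R,
          D (linePoint i t z) (linePoint i (t + h) z) / ‖h‖ₑ ^ p := by
        rw [← lintegral_prod (μ := volume.restrict Z) (ν := volume.restrict (Set.Icc (-R) R))
          (fun u => ∫⁻ h in Set.Icc (-(2 * R)) (2 * R),
            D (linePoint i u.2 u.1) (linePoint i (u.2 + h) u.1) / ‖h‖ₑ ^ p)
          hm.lintegral_prod_right'.aemeasurable, lintegral_lintegral_swap hm.aemeasurable]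
        exact lintegral_congr fun h => lintegral_prod _
          (hm.comp measurable_prodMk_right).aemeasurable
    _ = _ := by
        refine lintegral_congr_ae (ae_restrict_of_ae ?_)
        filter_upwards [Measure.ae_ne volume (0 : ℝ)] with h hh
        have hinv : (‖h‖ₑ ^ p)⁻¹ ≠ ⊤ :=
          ENNReal.inv_ne_top.2 (ENNReal.rpow_pos (enorm_pos.2 hh) enorm_ne_top).ne'
        rw [← lintegral_lintegral_linePoint_add hD i hR]
        simp only [div_eq_mul_inv, lintegral_mul_const' _ _ hinv, Z]

theorem lintegral_gagliardoEnergy_linePoint_ne_top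
    (hD : Measurable fun x : Rd (m + 1) × Rd (m + 1) => D x.1 x.2) {i : Fin (m + 1)} {p q R : ℝ}
    {C : ℝ≥0∞} (hR : 0 ≤ R) (hC : C ≠ ⊤)
    (h : ∀ t : ℝ, ∫⁻ x in cube (0 : Rd (m + 1)) R, D x (x + t • EuclideanSpace.single i 1) ≤
      C * ‖t‖ₑ ^ q) (hpq : p < 1 + q) :
    ∫⁻ z in Metric.closedBall (0 : Fin m → ℝ) R, gagliardoEnergy (Set.Icc (-R) R) p
      (fun s t => D (linePoint i s z) (linePoint i t z)) ≠ ⊤ := by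
  have hle : ∫⁻ t in Set.Icc (-(2 * R)) (2 * R), (∫⁻ x in cube (0 : Rd (m + 1)) R,
      D x (x + t • EuclideanSpace.single i 1)) / ‖t‖ₑ ^ p ≤
      ∫⁻ t in Set.Icc (-(2 * R)) (2 * R), C * ‖t‖ₑ ^ (q - p) := by
    refine lintegral_mono_ae (ae_restrict_of_ae ?_)
    filter_upwards [Measure.ae_ne volume (0 : ℝ)] with t ht
    rw [ENNReal.rpow_sub _ _ (enorm_ne_zero.2 ht) enorm_ne_top, ← mul_div_assoc]
    gcongr
    exact h t
  refine ne_top_of_le_ne_top ?_ ((lintegral_gagliardoEnergy_linePoint_le hD i hR p).trans hle)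
  rw [lintegral_const_mul' _ _ hC]
  exact ENNReal.mul_ne_top hC (lintegral_Icc_enorm_rpow_ne_top (by linarith) _)

end LineEnergy

section RegularPoint

variable {d K : ℕ} {H : Fin K → Rd d → ℂ} {γ : Rd d} {j : Fin K}

theorem fiber_add_latticePoint (H : Fin K → Rd d → ℂ) (x : Rd d) (m : Fin d → ℤ) :
    fiber H (x + latticePoint m) = fun n => fiber H x (n + m) := by
  funext n
  rw [fiber, fiber, add_assoc, ← latticePoint_add, add_comm m]

/-- A regular point for the `j`-th eigenvalue of the Gramian (the `j + 1`-st largest one): the fiber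
is square summable, spans a space of dimension at most `j + 1`, and its multiplication by the
character `n ↦ e^{-2πi⟨γ, n⟩}` is induced by a linear map. For a shift-invariant space with at most
`j + 1` generators and invariant under translation by `γ`, almost every point is regular. -/
structure IsRegularPoint (H : Fin K → Rd d → ℂ) (γ : Rd d) (j : Fin K) (x : Rd d) : Prop where
  fiberNormSq_ne_top : fiberNormSq H x ≠ ⊤
  finrank_span_le : Module.finrank ℂ (Submodule.span ℂ (Set.range (fiber H x))) ≤ j + 1
  exists_linearMap : ∃ B : EuclideanSpace ℂ (Fin K) →ₗ[ℂ] EuclideanSpace ℂ (Fin K),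
    ∀ n, B (fiber H x n) = latticeChar γ n • fiber H x n

theorem IsRegularPoint.finrank_span_eq {x : Rd d} (hx : IsRegularPoint H γ j x)
    (hpos : 0 < gramianEigenvalue H j x) :
    Module.finrank ℂ (Submodule.span ℂ (Set.range (fiber H x))) = j + 1 :=
  hx.finrank_span_le.antisymm <| Nat.succ_le_of_lt <| not_le.1 fun hle =>
    hpos.ne' (gramianEigenvalue_eq_zero_of_finrank_le hx.fiberNormSq_ne_top hle)

theorem IsRegularPoint.ofReal_le_fiberDistSq {x y : Rd d} (hx : IsRegularPoint H γ j x)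
    (hy : IsRegularPoint H γ j y) {δ : ℝ} (hδx : δ ≤ gramianEigenvalue H j x)
    (hδy : δ ≤ gramianEigenvalue H j y) {a : ℂ}
    (ha : Module.finrank ℂ (classSpan (latticeChar γ) (fiber H x) a) ≠
      Module.finrank ℂ (classSpan (latticeChar γ) (fiber H y) a)) :
    ENNReal.ofReal δ ≤ fiberDistSq H x y := by
  obtain ⟨Bx, hBx⟩ := hx.exists_linearMap
  obtain ⟨By, hBy⟩ := hy.exists_linearMap
  rcases ha.lt_or_gt with hlt | hgt
  · rw [fiberDistSq_comm]
    exact (ENNReal.ofReal_le_ofReal hδy).trans <|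
      ofReal_gramianEigenvalue_le_fiberDistSq hy.fiberNormSq_ne_top hBy hy.finrank_span_le hlt
  · exact (ENNReal.ofReal_le_ofReal hδx).trans <|
      ofReal_gramianEigenvalue_le_fiberDistSq hx.fiberNormSq_ne_top hBx hx.finrank_span_le hgt

theorem enorm_natCast_sub_natCast_sq_le {r r' N : ℕ} (hr : r ≤ N) (hr' : r' ≤ N) {δ : ℝ}
    (hδ : 0 < δ) {D : ℝ≥0∞} (h : r ≠ r' → ENNReal.ofReal δ ≤ D) :
    ‖(r : ℝ) - r'‖ₑ ^ 2 ≤ ENNReal.ofReal (N ^ 2 / δ) * D := by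
  rcases eq_or_ne r r' with rfl | hne
  · simp
  have hnorm : ‖(r : ℝ) - r'‖ ≤ N := by
    rw [Real.norm_eq_abs, abs_le]
    have hcast : (r : ℝ) ≤ N := Nat.cast_le.2 hr
    have hcast' : (r' : ℝ) ≤ N := Nat.cast_le.2 hr'
    constructor <;> linarith [Nat.cast_nonneg (α := ℝ) r, Nat.cast_nonneg (α := ℝ) r']
  calc ‖(r : ℝ) - r'‖ₑ ^ 2 = ENNReal.ofReal (‖(r : ℝ) - r'‖ ^ 2) := by
        rw [← ofReal_norm, ENNReal.ofReal_pow (norm_nonneg _)]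
    _ ≤ ENNReal.ofReal ((N : ℝ) ^ 2) := by gcongr
    _ = ENNReal.ofReal (N ^ 2 / δ) * ENNReal.ofReal δ := by
        rw [← ENNReal.ofReal_mul (by positivity), div_mul_cancel₀ _ hδ.ne']
    _ ≤ _ := by gcongr; exact h hne

end RegularPoint

section Path

variable {d K : ℕ} {H : Fin K → Rd d → ℂ} {γ : Rd d} {j : Fin K} {x : ℝ → Rd d} {a b p : ℝ}

theorem exists_ae_finrank_classSpan_eq (hm : ∀ k, Measurable (H k)) (hx : Measurable x)
    (hab : a < b) (hreg : ∀ᵐ t, IsRegularPoint H γ j (x t)) {δ : ℝ} (hδ : 0 < δ)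
    (hle : ∀ᵐ t ∂volume.restrict (Set.Icc a b), δ ≤ gramianEigenvalue H j (x t)) (hp : 2 < p)
    (hE : gagliardoEnergy (Set.Icc a b) p (fun s t => fiberDistSq H (x s) (x t)) ≠ ⊤) (z : ℂ) :
    ∃ k, ∀ᵐ t ∂volume.restrict (Set.Icc a b),
      Module.finrank ℂ (classSpan (latticeChar γ) (fiber H (x t)) z) = k := by
  set r : ℝ → ℕ := fun t => Module.finrank ℂ (classSpan (latticeChar γ) (fiber H (x t)) z)
  have hr : Measurable r := (measurable_finrank_span_image (measurable_fiber hm) _).comp hx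
  have hrK (t : ℝ) : r t ≤ K := (Submodule.finrank_le _).trans_eq finrank_euclideanSpace_fin
  refine exists_ae_eq_const_of_gagliardoEnergy_ne_top hab ?_ hp <|
    ne_top_of_le_ne_top (ENNReal.mul_ne_top ENNReal.ofReal_ne_top hE) <|
      gagliardoEnergy_le_mul (C := ENNReal.ofReal (K ^ 2 / δ)) ENNReal.ofReal_ne_top ?_
  · refine IntegrableOn.of_bound (C := K) measure_Icc_lt_top
      (measurable_from_top.comp hr).aestronglyMeasurable (Eventually.of_forall fun t => ?_)
    rw [Real.norm_natCast]
    exact Nat.cast_le.2 (hrK t)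
  · filter_upwards [ae_restrict_of_ae hreg, hle] with s hs hsδ
    filter_upwards [ae_restrict_of_ae hreg, hle] with t ht htδ
    exact enorm_natCast_sub_natCast_sq_le (hrK s) (hrK t) hδ (hs.ofReal_le_fiberDistSq ht hsδ htδ)

/-- The class ranks are constant along the path, while a step by the lattice vector `m` multiplies
the colours of the classes by `latticeChar γ m`. -/
theorem latticeChar_pow_eq_one_of_forall_le (hm : ∀ k, Measurable (H k)) (hx : Measurable x)
    {m : Fin d → ℤ} (hper : ∀ t, x (t + 1) = x t + latticePoint m) (hab : a + 1 < b)
    (hreg : ∀ᵐ t, IsRegularPoint H γ j (x t)) {δ : ℝ} (hδ : 0 < δ)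
    (hle : ∀ᵐ t ∂volume.restrict (Set.Icc a b), δ ≤ gramianEigenvalue H j (x t)) (hp : 2 < p)
    (hE : gagliardoEnergy (Set.Icc a b) p (fun s t => fiberDistSq H (x s) (x t)) ≠ ⊤) :
    latticeChar γ m ^ ((j : ℕ) + 1) = 1 := by
  set c := latticeChar γ
  choose k hk using exists_ae_finrank_classSpan_eq hm hx (by linarith) hreg hδ hle hp hE
  have hrank : ∀ᵐ t, t ∈ Set.Icc a b → ∀ z ∈ Set.range c,
      Module.finrank ℂ (classSpan c (fiber H (x t)) z) = k z :=
    (ae_restrict_iff' measurableSet_Icc).1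
      ((ae_ball_iff (Set.countable_range c)).2 fun z _ => hk z)
  have hrank_add : ∀ᵐ t : ℝ, t + 1 ∈ Set.Icc a b → ∀ z ∈ Set.range c,
      Module.finrank ℂ (classSpan c (fiber H (x (t + 1))) z) = k z :=
    (measurePreserving_add_right volume (1 : ℝ)).quasiMeasurePreserving.ae hrank
  have hfreq : ∃ᵐ t : ℝ, t ∈ Set.Icc a (b - 1) := frequently_ae_mem_iff.2 <| by
    rw [Real.volume_Icc]
    exact (ENNReal.ofReal_pos.2 (by linarith)).ne'
  obtain ⟨t, ⟨hat, htb⟩, ⟨htreg, htle⟩, ht, ht_add⟩ := (hfreq.and_eventually <|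
    (hreg.and ((ae_restrict_iff' measurableSet_Icc).1 hle)).and (hrank.and hrank_add)).exists
  have htI : t ∈ Set.Icc a b := ⟨hat, by linarith⟩
  have htI_add : t + 1 ∈ Set.Icc a b := ⟨by linarith, by linarith⟩
  have hl : c m ≠ 0 := latticeChar_ne_zero γ m
  obtain ⟨B, hB⟩ := htreg.exists_linearMap
  rw [← htreg.finrank_span_eq (hδ.trans_le (htle htI))]
  refine pow_finrank_eq_one_of_finrank_classSpan_mul_eq hB (latticeChar_ne_zero γ) hl fun z => ?_
  rw [← classSpan_add_right hl (fun n => latticeChar_add γ n m), ← fiber_add_latticePoint, ← hper]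
  by_cases hz : z ∈ Set.range c
  · rw [ht htI z hz, ht_add htI_add z hz]
  · rw [classSpan_eq_bot_of_notMem_range hz, classSpan_eq_bot_of_notMem_range hz]

theorem exists_ae_sqrt_gramianEigenvalue_eq (hm : ∀ k, Measurable (H k)) (hx : Measurable x)
    (hab : a < b) (hreg : ∀ᵐ t, fiberNormSq H (x t) ≠ ⊤) (j : Fin K) (hp : 2 < p)
    (hE : gagliardoEnergy (Set.Icc a b) p (fun s t => fiberDistSq H (x s) (x t)) ≠ ⊤)
    (hint : ∫⁻ t in Set.Icc a b, fiberNormSq H (x t) ≠ ⊤) :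
    ∃ g : ℝ → ℝ, (fun t => √(gramianEigenvalue H j (x t))) =ᵐ[volume.restrict (Set.Icc a b)] g ∧
      ∀ s ∈ Set.Icc a b, ∀ t ∈ Set.Icc a b, ‖g s - g t‖ ≤ holderConst p *
        √(gagliardoEnergy (Set.Icc a b) p fun s t => fiberDistSq H (x s) (x t)).toReal *
          |s - t| ^ ((p - 2) / 2) := by
  set f : ℝ → ℝ := fun t => √(gramianEigenvalue H j (x t))
  have henorm (u : ℝ) : ‖u‖ₑ ^ 2 = ENNReal.ofReal (u ^ 2) := by
    rw [← ofReal_norm, ← ENNReal.ofReal_pow (norm_nonneg _), Real.norm_eq_abs, sq_abs]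
  have hle : gagliardoEnergy (Set.Icc a b) p (fun s t => ‖f s - f t‖ₑ ^ 2) ≤
      gagliardoEnergy (Set.Icc a b) p (fun s t => fiberDistSq H (x s) (x t)) := by
    refine (gagliardoEnergy_le_mul ENNReal.one_ne_top ?_).trans_eq (one_mul _)
    filter_upwards [ae_restrict_of_ae hreg] with s hs
    filter_upwards [ae_restrict_of_ae hreg] with t ht
    rw [one_mul, henorm]
    exact ofReal_sq_sqrt_gramianEigenvalue_sub_le hs ht j
  have hfI : IntegrableOn f (Set.Icc a b) := by
    refine MemLp.integrable one_le_two ⟨?_, ?_⟩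
    · exact ((measurable_gramianEigenvalue hm j).comp hx).sqrt.aestronglyMeasurable
    refine (ENNReal.pow_lt_top_iff.1 (?_ : _ ^ 2 < ⊤)).resolve_right two_ne_zero
    rw [sq_eLpNorm_two]
    refine lt_of_le_of_lt (lintegral_mono_ae (ae_restrict_of_ae ?_)) hint.lt_top
    filter_upwards [hreg] with t ht
    rw [henorm, Real.sq_sqrt (gramianEigenvalue_nonneg ht j)]
    exact ofReal_gramianEigenvalue_le_fiberNormSq ht j
  obtain ⟨g, hfg, hg⟩ := exists_ae_eq_forall_norm_sub_le hab hfI hp (ne_top_of_le_ne_top hE hle)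
  refine ⟨g, hfg, fun s hs t ht => (hg s hs t ht).trans ?_⟩
  gcongr
  exact holderConst_nonneg hp

theorem exists_eq_zero_of_latticeChar_pow_ne_one (hm : ∀ k, Measurable (H k)) (hx : Measurable x)
    {m : Fin d → ℤ} (hper : ∀ t, x (t + 1) = x t + latticePoint m) (hab : a + 1 < b)
    (hreg : ∀ᵐ t, IsRegularPoint H γ j (x t)) (hl : latticeChar γ m ^ ((j : ℕ) + 1) ≠ 1)
    (hp : 2 < p)
    (hE : gagliardoEnergy (Set.Icc a b) p (fun s t => fiberDistSq H (x s) (x t)) ≠ ⊤)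
    {g : ℝ → ℝ} (hg : ContinuousOn g (Set.Icc a b))
    (hζg : (fun t => √(gramianEigenvalue H j (x t))) =ᵐ[volume.restrict (Set.Icc a b)] g) :
    ∃ t₀ ∈ Set.Icc a b, g t₀ = 0 := by
  obtain ⟨t₀, ht₀, hmin⟩ := isCompact_Icc.exists_isMinOn
    (Set.nonempty_Icc.2 (by linarith : a ≤ b)) (hg.pow 2)
  refine ⟨t₀, ht₀, by_contra fun hne => hl ?_⟩
  refine latticeChar_pow_eq_one_of_forall_le hm hx hper hab hreg
    (pow_pos (abs_pos.2 hne) 2) ?_ hp hE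
  filter_upwards [ae_restrict_of_ae hreg, hζg, ae_restrict_mem measurableSet_Icc] with t ht hgt htI
  rw [← Real.sq_sqrt (gramianEigenvalue_nonneg ht.fiberNormSq_ne_top j), hgt, sq_abs]
  exact hmin htI

end Path

section LebesgueDifferentiation

theorem ae_tendsto_setLAverage_closedBall {β : Type*} [MetricSpace β] [MeasurableSpace β]
    [BorelSpace β] [SecondCountableTopology β] [HasBesicovitchCovering β] {μ : Measure β}
    [IsLocallyFiniteMeasure μ] {Z : Set β} (hZ : MeasurableSet Z) {f : β → ℝ≥0∞}
    (hf : AEMeasurable f (μ.restrict Z)) (hfZ : ∫⁻ z in Z, f z ∂μ ≠ ⊤) :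
    ∀ᵐ z ∂μ, z ∈ interior Z →
      Tendsto (fun τ => ⨍⁻ z' in Metric.closedBall z τ, f z' ∂μ) (𝓝[>] 0) (𝓝 (f z)) := by
  have hind : ∫⁻ z, Z.indicator f z ∂μ ≠ ⊤ := by rwa [lintegral_indicator hZ]
  filter_upwards [(Besicovitch.vitaliFamily μ).ae_tendsto_lintegral_div
    ((aemeasurable_indicator_iff hZ).2 hf) hind] with z hz hzZ
  have hlim := hz.comp (Besicovitch.tendsto_filterAt μ z)
  rw [Set.indicator_of_mem (interior_subset hzZ)] at hlim
  refine hlim.congr' ?_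
  obtain ⟨ε, hε, hsub⟩ := Metric.isOpen_iff.1 isOpen_interior z hzZ
  filter_upwards [Ioo_mem_nhdsGT hε] with τ hτ
  rw [Function.comp_apply, setLAverage_eq]
  congr 1
  refine setLIntegral_congr_fun Metric.isClosed_closedBall.measurableSet fun z' hz' => ?_
  exact Set.indicator_of_mem (interior_subset (hsub (Metric.closedBall_subset_ball hτ.2 hz'))) f

theorem le_two_mul_laverage_add {α : Type*} [MeasurableSpace α] {μ : Measure α} [IsFiniteMeasure μ]
    [NeZero μ] {f : α → ℝ≥0∞} {a c : ℝ≥0∞} (h : ∀ᵐ x ∂μ, a ≤ 2 * f x + c) :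
    a ≤ 2 * ⨍⁻ x, f x ∂μ + c :=
  calc a = ⨍⁻ _, a ∂μ := (laverage_const μ a).symm
    _ ≤ ⨍⁻ x, (2 * f x + c) ∂μ := laverage_mono_ae h
    _ = 2 * ⨍⁻ x, f x ∂μ + ⨍⁻ _, c ∂μ := by
      simp only [laverage_eq']
      rw [lintegral_add_right _ measurable_const, lintegral_const_mul' _ _ ENNReal.ofNat_ne_top]
    _ = 2 * ⨍⁻ x, f x ∂μ + c := by rw [laverage_const]

theorem laverage_le_of_ae_le {α : Type*} [MeasurableSpace α] {μ : Measure α} {f : α → ℝ≥0∞}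
    {c : ℝ≥0∞} (h : ∀ᵐ x ∂μ, f x ≤ c) : ⨍⁻ x, f x ∂μ ≤ c :=
  (laverage_le_essSup f).trans (essSup_le_of_ae_le c h)

theorem neZero_restrict_Icc {a b : ℝ} (hab : a < b) :
    NeZero ((volume : Measure ℝ).restrict (Set.Icc a b)) :=
  ⟨by simp [Measure.restrict_eq_zero, hab]⟩

end LebesgueDifferentiation

section HolderMajorant

/-- An upper bound on `[a, b]` for a function `v` with `v s ≤ 2 v t + S |s - t| ^ q` for almost all
`s` and `t`, which unlike the values of `v` depends measurably on parameters of `v`. -/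
def holderMajorant (v : ℝ → ℝ≥0∞) (S : ℝ≥0∞) (q a b : ℝ) : ℝ≥0∞ :=
  2 * (⨍⁻ t in Set.Icc a b, v t ∂volume) + S * ENNReal.ofReal ((b - a) ^ q)

variable {v : ℝ → ℝ≥0∞} {S : ℝ≥0∞} {q a b : ℝ}

theorem ofReal_abs_sub_rpow_le (hq : 0 ≤ q) {s t : ℝ} (hs : s ∈ Set.Icc a b)
    (ht : t ∈ Set.Icc a b) : ENNReal.ofReal (|s - t| ^ q) ≤ ENNReal.ofReal ((b - a) ^ q) := by
  gcongr
  rw [abs_sub_le_iff]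
  constructor <;> linarith [hs.1, hs.2, ht.1, ht.2]

theorem ae_le_holderMajorant (hab : a < b) (hq : 0 ≤ q)
    (hv : ∀ᵐ s ∂volume.restrict (Set.Icc a b), ∀ᵐ t ∂volume.restrict (Set.Icc a b),
      v s ≤ 2 * v t + S * ENNReal.ofReal (|s - t| ^ q)) :
    ∀ᵐ s ∂volume.restrict (Set.Icc a b), v s ≤ holderMajorant v S q a b := by
  have := neZero_restrict_Icc hab
  filter_upwards [hv, ae_restrict_mem measurableSet_Icc] with s hs hsI
  refine le_two_mul_laverage_add ?_
  filter_upwards [hs, ae_restrict_mem measurableSet_Icc] with t ht htI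
  refine ht.trans ?_
  gcongr _ + S * ?_
  exact ofReal_abs_sub_rpow_le hq hsI htI

theorem holderMajorant_le {t₀ : ℝ} (hq : 0 ≤ q) (ht₀ : t₀ ∈ Set.Icc a b)
    (hv : ∀ᵐ t ∂volume.restrict (Set.Icc a b), v t ≤ S * ENNReal.ofReal (|t - t₀| ^ q)) :
    holderMajorant v S q a b ≤ 3 * (S * ENNReal.ofReal ((b - a) ^ q)) := by
  have hmean : ⨍⁻ t in Set.Icc a b, v t ∂volume ≤ S * ENNReal.ofReal ((b - a) ^ q) := by
    refine laverage_le_of_ae_le ?_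
    filter_upwards [hv, ae_restrict_mem measurableSet_Icc] with t ht htI
    refine ht.trans ?_
    gcongr S * ?_
    exact ofReal_abs_sub_rpow_le hq htI ht₀
  calc holderMajorant v S q a b
      ≤ 2 * (S * ENNReal.ofReal ((b - a) ^ q)) + S * ENNReal.ofReal ((b - a) ^ q) := by
        rw [holderMajorant]
        gcongr
    _ = _ := by ring

theorem exists_rat_Icc_rpow_lt (hS : S ≠ ⊤) (hq : 0 < q) {t₀ : ℝ} (ht₀ : t₀ ∈ Set.Ioo a b)
    {ε : ℝ≥0∞} (hε : 0 < ε) :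
    ∃ c e : ℚ, t₀ ∈ Set.Ioo (c : ℝ) e ∧ Set.Icc (c : ℝ) e ⊆ Set.Icc a b ∧
      3 * (S * ENNReal.ofReal (((e : ℝ) - c) ^ q)) < ε := by
  have hlim : Tendsto (fun κ : ℝ => 3 * (S * ENNReal.ofReal ((2 * κ) ^ q))) (𝓝[>] 0) (𝓝 0) := by
    have hrpow : Tendsto (fun κ : ℝ => (2 * κ) ^ q) (𝓝 0) (𝓝 0) := by
      have hcont : Continuous fun κ : ℝ => (2 * κ) ^ q :=
        (continuous_const.mul continuous_id).rpow_const fun _ => Or.inr hq.le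
      simpa [Real.zero_rpow hq.ne'] using hcont.tendsto 0
    have hofReal := ENNReal.tendsto_ofReal (hrpow.mono_left (nhdsWithin_le_nhds (s := Set.Ioi 0)))
    rw [ENNReal.ofReal_zero] at hofReal
    simpa using ENNReal.Tendsto.const_mul (a := 3)
      (ENNReal.Tendsto.const_mul (a := S) hofReal (Or.inr hS)) (Or.inr ENNReal.ofNat_ne_top)
  obtain ⟨κ, hκε, hκ : 0 < κ⟩ := ((hlim.eventually (gt_mem_nhds hε)).and self_mem_nhdsWithin).exists
  obtain ⟨c, hac, hct⟩ := exists_rat_btwn (max_lt ht₀.1 (sub_lt_self t₀ hκ))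
  obtain ⟨e, hte, heb⟩ := exists_rat_btwn (lt_min ht₀.2 (lt_add_of_pos_right t₀ hκ))
  obtain ⟨hac, hκc⟩ := max_lt_iff.1 hac
  obtain ⟨heb, heκ⟩ := lt_min_iff.1 heb
  refine ⟨c, e, ⟨hct, hte⟩, Set.Icc_subset_Icc hac.le heb.le, lt_of_le_of_lt ?_ hκε⟩
  gcongr
  · linarith
  · linarith

variable {β : Type*} [MeasurableSpace β] {u : ℝ → β → ℝ≥0∞} {R : β → ℝ≥0∞}

theorem measurable_holderMajorant (hu : Measurable fun p : ℝ × β => u p.1 p.2)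
    (hR : Measurable R) : Measurable fun z => holderMajorant (u · z) (R z) q a b := by
  have hint : Measurable fun z => ∫⁻ t in Set.Icc a b, u t z :=
    hu.lintegral_prod_left' (μ := volume.restrict (Set.Icc a b))
  simp only [holderMajorant, setLAverage_eq]
  exact ((hint.div_const _).const_mul 2).add (hR.mul_const _)

theorem setLIntegral_holderMajorant_ne_top {μ : Measure β} (hR : Measurable R) {Z : Set β}
    (hRZ : ∫⁻ z in Z, R z ∂μ ≠ ⊤) {I : Set ℝ} (huZ : ∫⁻ z in Z, (∫⁻ t in I, u t z) ∂μ ≠ ⊤)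
    (hab : a < b) (hI : Set.Icc a b ⊆ I) :
    ∫⁻ z in Z, holderMajorant (u · z) (R z) q a b ∂μ ≠ ⊤ := by
  have hvol : (volume (Set.Icc a b))⁻¹ ≠ ⊤ := by simp [hab]
  simp only [holderMajorant, setLAverage_eq, div_eq_mul_inv]
  rw [lintegral_add_right _ (hR.mul_const _), lintegral_const_mul' _ _ ENNReal.ofNat_ne_top,
    lintegral_mul_const' _ _ hvol, lintegral_mul_const' _ _ ENNReal.ofReal_ne_top]
  have hmono : ∫⁻ z in Z, (∫⁻ t in Set.Icc a b, u t z) ∂μ ≤ ∫⁻ z in Z, (∫⁻ t in I, u t z) ∂μ :=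
    lintegral_mono fun z => lintegral_mono_set hI
  have := ne_top_of_le_ne_top huZ hmono
  finiteness

end HolderMajorant

section ZeroOfAverages

variable {β : Type*} [MeasurableSpace β] {μ : Measure β} {u : ℝ → β → ℝ≥0∞} {Z : Set β}

theorem setLAverage_setLAverage_le {I : Set ℝ} {M : β → ℝ≥0∞}
    (hu : ∀ᵐ z ∂μ.restrict Z, ∀ᵐ t ∂volume.restrict I, u t z ≤ M z)
    {A : Set ℝ} (hA : A ⊆ I) {B : Set β} (hB : B ⊆ Z) :
    ⨍⁻ z in B, ⨍⁻ t in A, u t z ∂volume ∂μ ≤ ⨍⁻ z in B, M z ∂μ := by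
  refine laverage_mono_ae ?_
  filter_upwards [ae_restrict_of_ae_restrict_of_subset hB hu] with z hz
  exact laverage_le_of_ae_le (ae_restrict_of_ae_restrict_of_subset hA hz)

theorem ae_tendsto_setLAverage_setLAverage_zero [MetricSpace β] [BorelSpace β]
    [SecondCountableTopology β] [HasBesicovitchCovering β] [IsLocallyFiniteMeasure μ]
    (hu : Measurable fun p : ℝ × β => u p.1 p.2) {R : β → ℝ≥0∞} (hR : Measurable R)
    (hZ : MeasurableSet Z) (hRZ : ∫⁻ z in Z, R z ∂μ ≠ ⊤) {a b q : ℝ} (hq : 0 < q)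
    (huZ : ∫⁻ z in Z, (∫⁻ t in Set.Icc a b, u t z) ∂μ ≠ ⊤)
    (hosc : ∀ᵐ z ∂μ.restrict Z, ∀ᵐ s ∂volume.restrict (Set.Icc a b),
      ∀ᵐ t ∂volume.restrict (Set.Icc a b),
        u s z ≤ 2 * u t z + R z * ENNReal.ofReal (|s - t| ^ q)) :
    ∀ᵐ z ∂μ, z ∈ interior Z → ∀ t₀ ∈ Set.Ioo a b,
      (∀ᵐ t ∂volume.restrict (Set.Icc a b), u t z ≤ R z * ENNReal.ofReal (|t - t₀| ^ q)) →
      Tendsto (fun τ => ⨍⁻ z' in Metric.closedBall z τ,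
        ⨍⁻ t in Metric.closedBall t₀ τ, u t z' ∂volume ∂μ) (𝓝[>] 0) (𝓝 0) := by
  let M (c e : ℝ) (z : β) : ℝ≥0∞ := holderMajorant (u · z) (R z) q c e
  have hbound (c e : ℝ) (hce : c < e) (hsub : Set.Icc c e ⊆ Set.Icc a b) :
      ∀ᵐ z ∂μ.restrict Z, ∀ᵐ t ∂volume.restrict (Set.Icc c e), u t z ≤ M c e z := by
    filter_upwards [hosc] with z hz
    exact ae_le_holderMajorant hce hq.le <| (ae_restrict_of_ae_restrict_of_subset hsub hz).mono
      fun s hs => ae_restrict_of_ae_restrict_of_subset hsub hs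
  have hdiff : ∀ᵐ z ∂μ, ∀ c e : ℚ, (c : ℝ) < e → Set.Icc (c : ℝ) e ⊆ Set.Icc a b →
      z ∈ interior Z →
        Tendsto (fun τ => ⨍⁻ z' in Metric.closedBall z τ, M c e z' ∂μ) (𝓝[>] 0) (𝓝 (M c e z)) := by
    simp only [ae_all_iff]
    exact fun c e hce hsub => ae_tendsto_setLAverage_closedBall hZ
      (measurable_holderMajorant hu hR).aemeasurable
      (setLIntegral_holderMajorant_ne_top hR hRZ huZ hce hsub)
  have hRfin : ∀ᵐ z ∂μ, z ∈ Z → R z < ⊤ := (ae_restrict_iff' hZ).1 (ae_lt_top hR hRZ)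
  filter_upwards [hdiff, hRfin] with z hzM hzR hzZ t₀ ht₀ hzero
  refine ENNReal.tendsto_nhds_zero.2 fun ε hε => ?_
  obtain ⟨c, e, htce, hsub, hsmall⟩ :=
    exists_rat_Icc_rpow_lt (hzR (interior_subset hzZ)).ne hq ht₀ hε
  have hce : (c : ℝ) < e := htce.1.trans htce.2
  have hMε : M c e z < ε := (holderMajorant_le hq.le (Set.Ioo_subset_Icc_self htce)
    (ae_restrict_of_ae_restrict_of_subset hsub hzero)).trans_lt hsmall
  have hballs : ∀ᶠ τ in 𝓝[>] (0 : ℝ), Metric.closedBall z τ ⊆ Z ∧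
      Metric.closedBall t₀ τ ⊆ Set.Icc (c : ℝ) e :=
    nhdsWithin_le_nhds <| (eventually_closedBall_subset (mem_interior_iff_mem_nhds.1 hzZ)).and
      (eventually_closedBall_subset (Icc_mem_nhds htce.1 htce.2))
  filter_upwards [(hzM c e hce hsub hzZ).eventually (gt_mem_nhds hMε), hballs]
    with τ hτ ⟨hzτ, htτ⟩
  exact (setLAverage_setLAverage_le (hbound c e hce hsub) htτ hzτ).trans hτ.le

end ZeroOfAverages

section Periodicity

variable {d K : ℕ}

theorem gramian_add_latticePoint (H : Fin K → Rd d → ℂ) (x : Rd d) (m : Fin d → ℤ) :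
    gramian H (x + latticePoint m) = gramian H x := by
  simp only [gramian, add_assoc, ← latticePoint_add]
  exact (Equiv.addLeft m).tsum_eq fun n =>
    Matrix.vecMulVec (fun k => H k (x + latticePoint n)) (star fun k => H k (x + latticePoint n))

theorem gramianEigenvalue_add_latticePoint (H : Fin K → Rd d → ℂ) (j : Fin K) (x : Rd d)
    (m : Fin d → ℤ) : gramianEigenvalue H j (x + latticePoint m) = gramianEigenvalue H j x := by
  simp only [gramianEigenvalue, gramian_add_latticePoint]

theorem preimage_add_right_cube (x a : Rd d) (τ : ℝ) : (· + a) ⁻¹' cube (x + a) τ = cube x τ := by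
  ext y
  simp [cube]

theorem setLAverage_cube_add {w : Rd d → ℝ≥0∞} {a : Rd d} (hw : ∀ y, w (y + a) = w y) (x : Rd d)
    (τ : ℝ) : ⨍⁻ y in cube (x + a) τ, w y ∂volume = ⨍⁻ y in cube x τ, w y ∂volume := by
  have htrans := measurePreserving_add_right (volume : Measure (Rd d)) a
  have hemb := measurableEmbedding_addRight a
  rw [setLAverage_eq, setLAverage_eq, ← htrans.setLIntegral_comp_preimage_emb hemb,
    ← htrans.measure_preimage_emb hemb, preimage_add_right_cube]
  simp only [hw]

end Periodicity

section ProjectionOfZeroSet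

variable {m : ℕ} {i : Fin (m + 1)} {t : ℝ} {z : Fin m → ℝ}

theorem volume_cube_linePoint (i : Fin (m + 1)) (t : ℝ) (z : Fin m → ℝ) {τ : ℝ} (hτ : 0 ≤ τ) :
    volume (cube (linePoint i t z) τ) =
      volume (Metric.closedBall t τ) * volume (Metric.closedBall z τ) := by
  simpa only [setLIntegral_const, one_mul] using
    setLIntegral_cube_linePoint i (measurable_const (a := (1 : ℝ≥0∞))) t z hτ

theorem setLAverage_cube_linePoint (i : Fin (m + 1)) {f : Rd (m + 1) → ℝ≥0∞} (hf : Measurable f)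
    (t : ℝ) (z : Fin m → ℝ) {τ : ℝ} (hτ : 0 < τ) :
    ⨍⁻ x in cube (linePoint i t z) τ, f x ∂volume = ⨍⁻ z' in Metric.closedBall z τ,
      ⨍⁻ t' in Metric.closedBall t τ, f (linePoint i t' z') ∂volume ∂volume := by
  have hball : (volume (Metric.closedBall t τ))⁻¹ ≠ ⊤ :=
    ENNReal.inv_ne_top.2 (Metric.measure_closedBall_pos volume t hτ).ne'
  simp only [setLAverage_eq, div_eq_mul_inv]
  rw [lintegral_mul_const' _ _ hball, setLIntegral_cube_linePoint i hf t z hτ.le,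
    volume_cube_linePoint i t z hτ.le, mul_assoc,
    ENNReal.mul_inv (Or.inr measure_closedBall_lt_top.ne) (Or.inl measure_closedBall_lt_top.ne)]

theorem latticePoint_single {d : ℕ} (i : Fin d) (n : ℤ) :
    (latticePoint (Pi.single i n) : Rd d) = (n : ℝ) • EuclideanSpace.single i 1 := by
  ext k
  by_cases hk : k = i
  · subst hk; simp [latticePoint]
  · simp [latticePoint, hk]

theorem linePoint_mem_torusDomain (ht : t ∈ Set.Ico (-(1 / 2) : ℝ) (1 / 2))
    (hz : z ∈ Metric.ball (0 : Fin m → ℝ) (1 / 2)) : linePoint i t z ∈ torusDomain (m + 1) := by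
  refine (Fin.forall_iff_succAbove i).2 ⟨by simpa [linePoint] using ht, fun k => ?_⟩
  have hk : |z k| < 1 / 2 :=
    (norm_le_pi_norm z k).trans_lt (mem_ball_zero_iff.1 hz)
  simpa [linePoint] using And.intro (neg_le_of_abs_le hk.le) (lt_of_abs_lt hk)

theorem linePoint_mem_zeroSet {w : Rd (m + 1) → ℝ} (ht : t ∈ Set.Ico (-(1 / 2) : ℝ) (1 / 2))
    (hz : z ∈ Metric.ball (0 : Fin m → ℝ) (1 / 2))
    (hlim : Tendsto (fun τ : ℝ => ⨍⁻ y in cube (linePoint i t z) τ, ‖w y‖ₑ ∂volume)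
      (𝓝[>] 0) (𝓝 0)) : linePoint i t z ∈ zeroSet w :=
  ⟨linePoint_mem_torusDomain ht hz, by simpa only [setLAverage_eq] using hlim.limsup_eq⟩

theorem exists_linePoint_mem_zeroSet {w : Rd (m + 1) → ℝ}
    (hw : ∀ x n, w (x + latticePoint n) = w x) (ht : t ∈ Set.Ico (-(1 / 2) : ℝ) (3 / 2))
    (hz : z ∈ Metric.ball (0 : Fin m → ℝ) (1 / 2))
    (hlim : Tendsto (fun τ : ℝ => ⨍⁻ y in cube (linePoint i t z) τ, ‖w y‖ₑ ∂volume)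
      (𝓝[>] 0) (𝓝 0)) : ∃ t', linePoint i t' z ∈ zeroSet w := by
  rcases lt_or_ge t (1 / 2) with hlt | hge
  · exact ⟨t, linePoint_mem_zeroSet ⟨ht.1, hlt⟩ hz hlim⟩
  · refine ⟨t + ((-1 : ℤ) : ℝ), linePoint_mem_zeroSet ⟨?_, ?_⟩ hz ?_⟩
    · push_cast; linarith
    · push_cast; linarith [ht.2]
    · rw [linePoint_add, ← latticePoint_single]
      exact hlim.congr fun τ =>
        (setLAverage_cube_add (w := fun y => ‖w y‖ₑ) (fun y => by rw [hw]) _ τ).symm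

theorem hausdorffMeasure_pos_of_ae_exists_linePoint_mem {E : Set (Rd (m + 1))}
    {Q : Set (Fin m → ℝ)} (hQ : 0 < volume Q) (h : ∀ᵐ z, z ∈ Q → ∃ t, linePoint i t z ∈ E) :
    0 < Measure.hausdorffMeasure (((m + 1 : ℕ) : ℝ) - 1) E := by
  let proj : Rd (m + 1) → Fin m → ℝ := fun x k => x (i.succAbove k)
  have hproj : LipschitzWith 1 proj := LipschitzWith.mk_one fun x y =>
    (dist_pi_le_iff dist_nonneg).2 fun k => by
      rw [dist_eq_norm, dist_eq_norm]
      exact PiLp.norm_apply_le (x - y) (i.succAbove k)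
  have hQE : volume Q ≤ volume (proj '' E) := by
    refine measure_mono_ae ?_
    filter_upwards [h] with z hz hzQ
    obtain ⟨t, ht⟩ := hz hzQ
    exact ⟨_, ht, by ext k; simp [proj, linePoint]⟩
  have hvol : (Measure.hausdorffMeasure (m : ℝ) : Measure (Fin m → ℝ)) = volume := by
    simpa only [Fintype.card_fin] using hausdorffMeasure_pi_real (ι := Fin m)
  have himage := hproj.hausdorffMeasure_image_le (d := (m : ℝ)) (Nat.cast_nonneg m) E
  rw [hvol, ENNReal.coe_one, ENNReal.one_rpow, one_mul] at himage
  rw [Nat.cast_add, Nat.cast_one, add_sub_cancel_right]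
  exact hQ.trans_le (hQE.trans himage)

end ProjectionOfZeroSet

section EigenvalueAlongPath

theorem enorm_sq_le_of_norm_sub_le {E : Type*} [SeminormedAddCommGroup E] {a b : E} {c r β : ℝ}
    {S : ℝ≥0∞} (hS : S ≠ ⊤) (hr : 0 ≤ r) (h : ‖a - b‖ ≤ c * √S.toReal * r ^ (β / 2)) :
    ‖a‖ₑ ^ 2 ≤ 2 * ‖b‖ₑ ^ 2 + ENNReal.ofReal (2 * c ^ 2) * S * ENNReal.ofReal (r ^ β) := by
  have hsq : ‖a - b‖ ^ 2 ≤ c ^ 2 * S.toReal * r ^ β := by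
    calc ‖a - b‖ ^ 2 ≤ (c * √S.toReal * r ^ (β / 2)) ^ 2 := by gcongr
      _ = c ^ 2 * S.toReal * r ^ β := by
        rw [mul_pow, mul_pow, Real.sq_sqrt ENNReal.toReal_nonneg, ← Real.rpow_mul_natCast hr,
          Nat.cast_ofNat, div_mul_cancel₀ _ two_ne_zero]
  have hnorm : ‖a‖ ^ 2 ≤ 2 * ‖b‖ ^ 2 + 2 * c ^ 2 * S.toReal * r ^ β := by
    nlinarith [norm_le_insert' a b, norm_nonneg a, sq_nonneg (‖b‖ - ‖a - b‖)]
  have hreal := ENNReal.ofReal_le_ofReal hnorm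
  rw [ENNReal.ofReal_add (by positivity) (by positivity), ENNReal.ofReal_mul (by positivity),
    ENNReal.ofReal_mul (by positivity), ENNReal.ofReal_mul (by positivity),
    ENNReal.ofReal_toReal hS, ENNReal.ofReal_ofNat] at hreal
  simpa only [← ofReal_norm, ← ENNReal.ofReal_pow (norm_nonneg _)] using hreal

variable {d K : ℕ} {H : Fin K → Rd d → ℂ} {γ : Rd d} {j : Fin K} {x : ℝ → Rd d} {a b p : ℝ}

theorem ae_enorm_gramianEigenvalue_le_and_exists_zero (hm : ∀ k, Measurable (H k))
    (hx : Measurable x) {n : Fin d → ℤ} (hper : ∀ t, x (t + 1) = x t + latticePoint n)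
    {c e : ℝ} (hce : c + 1 < e) (hsub : Set.Icc c e ⊆ Set.Icc a b)
    (hreg : ∀ᵐ t, IsRegularPoint H γ j (x t)) (hl : latticeChar γ n ^ ((j : ℕ) + 1) ≠ 1)
    (hp : 2 < p)
    (hE : gagliardoEnergy (Set.Icc a b) p (fun s t => fiberDistSq H (x s) (x t)) ≠ ⊤)
    (hint : ∫⁻ t in Set.Icc a b, fiberNormSq H (x t) ≠ ⊤) :
    let S := ENNReal.ofReal (2 * holderConst p ^ 2) *
      gagliardoEnergy (Set.Icc a b) p (fun s t => fiberDistSq H (x s) (x t))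
    (∀ᵐ s ∂volume.restrict (Set.Icc a b), ∀ᵐ t ∂volume.restrict (Set.Icc a b),
      ‖gramianEigenvalue H j (x s)‖ₑ ≤
        2 * ‖gramianEigenvalue H j (x t)‖ₑ + S * ENNReal.ofReal (|s - t| ^ (p - 2))) ∧
    ∃ t₀ ∈ Set.Icc c e, ∀ᵐ t ∂volume.restrict (Set.Icc a b),
      ‖gramianEigenvalue H j (x t)‖ₑ ≤ S * ENNReal.ofReal (|t - t₀| ^ (p - 2)) := by
  intro S
  have hfin : ∀ᵐ t, fiberNormSq H (x t) ≠ ⊤ := hreg.mono fun t ht => ht.fiberNormSq_ne_top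
  have ⟨hac, heb⟩ := (Set.Icc_subset_Icc_iff (by linarith)).1 hsub
  obtain ⟨g, hζg, hg⟩ :=
    exists_ae_sqrt_gramianEigenvalue_eq hm hx (by linarith) hfin j hp hE hint
  have hsq : ∀ᵐ t ∂volume.restrict (Set.Icc a b),
      ‖gramianEigenvalue H j (x t)‖ₑ = ‖g t‖ₑ ^ 2 := by
    filter_upwards [ae_restrict_of_ae hfin, hζg] with t ht hgt
    rw [← hgt, ← enorm_pow, Real.sq_sqrt (gramianEigenvalue_nonneg ht j)]
  obtain ⟨t₀, ht₀, hgt₀⟩ := exists_eq_zero_of_latticeChar_pow_ne_one hm hx hper hce hreg hl hp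
    (ne_top_of_le_ne_top hE (gagliardoEnergy_mono_set hsub p _))
    ((continuousOn_of_norm_sub_le_rpow (by linarith) hg).mono hsub)
    (ae_restrict_of_ae_restrict_of_subset hsub hζg)
  refine ⟨?_, t₀, ht₀, ?_⟩
  · filter_upwards [hsq, ae_restrict_mem measurableSet_Icc] with s hs hsI
    filter_upwards [hsq, ae_restrict_mem measurableSet_Icc] with t ht htI
    rw [hs, ht]
    exact enorm_sq_le_of_norm_sub_le hE (abs_nonneg _) (hg s hsI t htI)
  · filter_upwards [hsq, ae_restrict_mem measurableSet_Icc] with t ht htI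
    have hle := enorm_sq_le_of_norm_sub_le hE (abs_nonneg _) (hg t htI t₀ (hsub ht₀))
    rwa [← ht, hgt₀, enorm_zero, zero_pow two_ne_zero, mul_zero, zero_add] at hle

end EigenvalueAlongPath

section ExtraInvariance

variable {d K : ℕ}

theorem fourierChar_eq_one_iff {x : ℝ} : Real.fourierChar x = 1 ↔ ∃ n : ℤ, x = n := by
  rw [← Circle.coe_eq_one, Real.fourierChar_apply, Complex.exp_eq_one_iff]
  refine exists_congr fun n => ?_
  rw [Complex.ofReal_mul, Complex.ofReal_mul, Complex.ofReal_ofNat, mul_right_comm, mul_comm,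
    mul_left_inj' Complex.two_pi_I_ne_zero, ← Complex.ofReal_intCast, Complex.ofReal_inj]

theorem latticeChar_single_pow_eq_one_iff (γ : Rd d) (i : Fin d) (J : ℕ) :
    latticeChar γ (Pi.single i 1) ^ J = 1 ↔ ∃ n : ℤ, (J • γ) i = n := by
  have hinner : ⟪γ, (latticePoint (Pi.single i 1) : Rd d)⟫_ℝ = γ i := by
    simp [latticePoint_single, EuclideanSpace.inner_single_right]
  rw [latticeChar, hinner, AddChar.map_neg_eq_inv, Circle.coe_inv, inv_pow, inv_eq_one,
    ← Circle.coe_pow, ← AddChar.map_nsmul_eq_pow, Circle.coe_eq_one, fourierChar_eq_one_iff,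
    PiLp.smul_apply]

theorem exists_coord_of_notMem_integerLattice {x : Rd d} (hx : x ∉ integerLattice d) :
    ∃ i, ∀ n : ℤ, x i ≠ n := by
  by_contra! hcon
  choose n hn using hcon
  exact hx ⟨n, by ext i; simp [latticePoint, hn]⟩

theorem exists_card_le_shiftInvariantSpace_eq (F : Fin K → L2 d) :
    ∃ G : Finset (L2 d), G.card ≤ K ∧
      shiftInvariantSpace (G : Set (L2 d)) = shiftInvariantSpace (Set.range F) := by
  classical
  exact ⟨Finset.univ.image F, Finset.card_image_le.trans_eq (Finset.card_fin K),
    by rw [Finset.coe_image, Finset.coe_univ, Set.image_univ]⟩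

theorem minGenerators_shiftInvariantSpace_range_le (F : Fin K → L2 d) :
    minGenerators (shiftInvariantSpace (Set.range F)) ≤ K := by
  obtain ⟨G, hcard, hG⟩ := exists_card_le_shiftInvariantSpace_eq F
  exact (show minGenerators _ ≤ G.card from Nat.sInf_le ⟨G, rfl, hG⟩).trans hcard

theorem exists_card_eq_minGenerators (F : Fin K → L2 d) :
    ∃ G : Finset (L2 d), G.card = minGenerators (shiftInvariantSpace (Set.range F)) ∧
      shiftInvariantSpace (G : Set (L2 d)) = shiftInvariantSpace (Set.range F) := by
  obtain ⟨G, -, hG⟩ := exists_card_le_shiftInvariantSpace_eq F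
  have hne : {n : ℕ | ∃ G : Finset (L2 d), G.card = n ∧ shiftInvariantSpace (G : Set (L2 d)) =
      shiftInvariantSpace (Set.range F)}.Nonempty := ⟨_, G, rfl, hG⟩
  exact Nat.sInf_mem hne

theorem ae_isRegularPoint (F : Fin K → L2 d) {γ : Rd d}
    (hγ : ∀ h ∈ shiftInvariantSpace (Set.range F), translateL2 γ h ∈
      shiftInvariantSpace (Set.range F)) {j : Fin K}
    (hj : (j : ℕ) + 1 = minGenerators (shiftInvariantSpace (Set.range F)))
    (hfin : ∀ᵐ x, fiberNormSq (fourierFamily F) x ≠ ⊤) :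
    ∀ᵐ x, IsRegularPoint (fourierFamily F) γ j x := by
  obtain ⟨G, hcard, hG⟩ := exists_card_eq_minGenerators F
  filter_upwards [hfin, ae_finrank_span_fiber_le F G hG, ae_exists_linearMap_fiber_eq F hγ]
    with x hx hrank hlin
  exact ⟨hx, by rwa [hj, ← hcard], hlin⟩

end ExtraInvariance

section EnergyOfLines

variable {m K : ℕ} {H : Fin K → Rd (m + 1) → ℂ} {i : Fin (m + 1)} {s p : ℝ}

/-- The fractional energy of the fibers of `H` along the segment of the line through `z` in the
direction of the `i`-th axis on which `|t| ≤ R`; for `p = 1 + 2s` it is the squared Slobodeckij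
seminorm of order `s`. -/
def lineEnergy (H : Fin K → Rd (m + 1) → ℂ) (i : Fin (m + 1)) (R p : ℝ) (z : Fin m → ℝ) : ℝ≥0∞ :=
  gagliardoEnergy (Set.Icc (-R) R) p fun s t => fiberDistSq H (linePoint i s z) (linePoint i t z)

theorem measurable_lineEnergy (hm : ∀ k, Measurable (H k)) (i : Fin (m + 1)) (R p : ℝ) :
    Measurable (lineEnergy H i R p) :=
  measurable_gagliardoEnergy_linePoint (measurable_fiberDistSq hm) i _ p

theorem setLIntegral_lineEnergy_ne_top (hm : ∀ k, Measurable (H k))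
    (hHs : ∀ k, ∃ C : ℝ≥0∞, C ≠ ⊤ ∧ ∀ t : ℝ,
      shiftDistSq (H k) (t • EuclideanSpace.single i 1) ≤ C * ‖t‖ₑ ^ (2 * s))
    (hps : p < 1 + 2 * s) (N : ℕ) :
    ∫⁻ z in Metric.closedBall (0 : Fin m → ℝ) N, lineEnergy H i N p z ≠ ⊤ := by
  choose C hC hCH using hHs
  have hsum : (2 * N + 3) ^ (m + 1) * ∑ k, C k ≠ ⊤ :=
    ENNReal.mul_ne_top (by finiteness) (ENNReal.sum_ne_top.2 fun k _ => hC k)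
  refine lintegral_gagliardoEnergy_linePoint_ne_top (measurable_fiberDistSq hm) N.cast_nonneg hsum
    (fun t => (setLIntegral_cube_fiberDistSq_le hm N _).trans ?_) hps
  rw [mul_assoc, Finset.sum_mul]
  gcongr with k
  exact hCH k t

theorem setLIntegral_fiberNormSq_linePoint_ne_top (hm : ∀ k, Measurable (H k))
    (hH : ∀ k, ∫⁻ x, ‖H k x‖ₑ ^ 2 ≠ ⊤) (i : Fin (m + 1)) (N : ℕ) :
    ∫⁻ z in Metric.closedBall (0 : Fin m → ℝ) N, ∫⁻ t in Set.Icc (-N : ℝ) N,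
      fiberNormSq H (linePoint i t z) ≠ ⊤ := by
  have hcube := setLIntegral_cube_linePoint i (measurable_fiberNormSq hm) 0 0 N.cast_nonneg
  rw [linePoint_zero, Real.closedBall_eq_Icc, zero_sub, zero_add] at hcube
  rw [← hcube]
  exact ne_top_of_le_ne_top (ENNReal.mul_ne_top (by finiteness) (ENNReal.sum_ne_top.2 fun k _ =>
    hH k)) (setLIntegral_cube_fiberNormSq_le hm N)

end EnergyOfLines

section PositivityOfZeroSet

variable {m K : ℕ} {H : Fin K → Rd (m + 1) → ℂ} {i : Fin (m + 1)} {γ : Rd (m + 1)} {j : Fin K}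

theorem setLIntegral_gramianEigenvalue_linePoint_ne_top {Z : Set (Fin m → ℝ)} {I : Set ℝ}
    (hfin : ∀ᵐ x, fiberNormSq H x ≠ ⊤)
    (hint : ∫⁻ z in Z, ∫⁻ t in I, fiberNormSq H (linePoint i t z) ≠ ⊤) (j : Fin K) :
    ∫⁻ z in Z, ∫⁻ t in I, ‖gramianEigenvalue H j (linePoint i t z)‖ₑ ≠ ⊤ := by
  refine ne_top_of_le_ne_top hint (lintegral_mono_ae (ae_restrict_of_ae ?_))
  filter_upwards [ae_linePoint i hfin] with z hz
  refine lintegral_mono_ae (ae_restrict_of_ae ?_)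
  filter_upwards [hz] with t ht
  rw [Real.enorm_of_nonneg (gramianEigenvalue_nonneg ht j)]
  exact ofReal_gramianEigenvalue_le_fiberNormSq ht j

theorem ae_enorm_gramianEigenvalue_linePoint_le_and_exists_zero (hm : ∀ k, Measurable (H k))
    {Z : Set (Fin m → ℝ)} {R p : ℝ} (hR : 1 ≤ R) (hp : 2 < p)
    (hE : ∫⁻ z in Z, lineEnergy H i R p z ≠ ⊤)
    (hint : ∫⁻ z in Z, ∫⁻ t in Set.Icc (-R) R, fiberNormSq H (linePoint i t z) ≠ ⊤)
    (hreg : ∀ᵐ x, IsRegularPoint H γ j x)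
    (hl : latticeChar γ (Pi.single i 1) ^ ((j : ℕ) + 1) ≠ 1) :
    ∀ᵐ z ∂volume.restrict Z,
      (∀ᵐ s ∂volume.restrict (Set.Icc (-R) R), ∀ᵐ t ∂volume.restrict (Set.Icc (-R) R),
        ‖gramianEigenvalue H j (linePoint i s z)‖ₑ ≤
          2 * ‖gramianEigenvalue H j (linePoint i t z)‖ₑ +
            ENNReal.ofReal (2 * holderConst p ^ 2) * lineEnergy H i R p z *
              ENNReal.ofReal (|s - t| ^ (p - 2))) ∧
      ∃ t₀ ∈ Set.Icc (-(1 / 2) : ℝ) 1, ∀ᵐ t ∂volume.restrict (Set.Icc (-R) R),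
        ‖gramianEigenvalue H j (linePoint i t z)‖ₑ ≤
          ENNReal.ofReal (2 * holderConst p ^ 2) * lineEnergy H i R p z *
            ENNReal.ofReal (|t - t₀| ^ (p - 2)) := by
  filter_upwards [ae_lt_top (measurable_lineEnergy hm i R p) hE, ae_lt_top
    ((measurable_fiberNormSq hm).comp (measurable_linePoint i)).lintegral_prod_left' hint,
    ae_restrict_of_ae (ae_linePoint i hreg)] with z hEz hintz hregz
  exact ae_enorm_gramianEigenvalue_le_and_exists_zero hm (x := fun t => linePoint i t z)
    ((measurable_linePoint i).comp measurable_prodMk_right) (n := Pi.single i 1)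
    (fun t => by rw [linePoint_add, latticePoint_single, Int.cast_one])
    (show -(1 / 2) + 1 < (1 : ℝ) by norm_num) (Set.Icc_subset_Icc (by linarith) hR)
    hregz hl hp hEz.ne hintz.ne

theorem ae_exists_tendsto_setLAverage_cube_gramianEigenvalue (hm : ∀ k, Measurable (H k))
    {R p : ℝ} (hR : 1 < R) (hp : 2 < p)
    (hE : ∫⁻ z in Metric.closedBall (0 : Fin m → ℝ) R, lineEnergy H i R p z ≠ ⊤)
    (hint : ∫⁻ z in Metric.closedBall (0 : Fin m → ℝ) R, ∫⁻ t in Set.Icc (-R) R,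
      fiberNormSq H (linePoint i t z) ≠ ⊤)
    (hreg : ∀ᵐ x, IsRegularPoint H γ j x)
    (hl : latticeChar γ (Pi.single i 1) ^ ((j : ℕ) + 1) ≠ 1) :
    ∀ᵐ z : Fin m → ℝ, z ∈ Metric.ball 0 R → ∃ t₀ ∈ Set.Icc (-(1 / 2) : ℝ) 1,
      Tendsto (fun τ => ⨍⁻ y in cube (linePoint i t₀ z) τ, ‖gramianEigenvalue H j y‖ₑ ∂volume)
        (𝓝[>] 0) (𝓝 0) := by
  have hζ : Measurable fun x => ‖gramianEigenvalue H j x‖ₑ :=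
    (measurable_gramianEigenvalue hm j).enorm
  have hball := (Metric.isClosed_closedBall (x := (0 : Fin m → ℝ)) (ε := R)).measurableSet
  have hline := ae_enorm_gramianEigenvalue_linePoint_le_and_exists_zero hm hR.le hp hE hint hreg hl
  have haverage := ae_tendsto_setLAverage_setLAverage_zero (hζ.comp (measurable_linePoint i))
    ((measurable_lineEnergy hm i R p).const_mul (ENNReal.ofReal (2 * holderConst p ^ 2))) hball
    (by
      rw [lintegral_const_mul' _ _ ENNReal.ofReal_ne_top]
      exact ENNReal.mul_ne_top ENNReal.ofReal_ne_top hE)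
    (sub_pos.2 hp)
    (setLIntegral_gramianEigenvalue_linePoint_ne_top
      (hreg.mono fun x hx => hx.fiberNormSq_ne_top) hint j)
    (hline.mono fun z hz => hz.1)
  filter_upwards [haverage, (ae_restrict_iff' hball).1 hline] with z hz hzline hzR
  obtain ⟨t₀, ht₀, hzero⟩ := (hzline (Metric.ball_subset_closedBall hzR)).2
  refine ⟨t₀, ht₀, (hz (Metric.ball_subset_interior_closedBall hzR) t₀
    ⟨by linarith [ht₀.1], by linarith [ht₀.2]⟩ hzero).congr' ?_⟩
  filter_upwards [self_mem_nhdsWithin] with τ hτ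
  exact (setLAverage_cube_linePoint i hζ t₀ z hτ).symm

theorem hausdorffMeasure_zeroSet_pos (hm : ∀ k, Measurable (H k))
    (hH : ∀ k, ∫⁻ x, ‖H k x‖ₑ ^ 2 ≠ ⊤) {s : ℝ} (hs : 1 / 2 < s)
    (hHs : ∀ k, ∃ C : ℝ≥0∞, C ≠ ⊤ ∧ ∀ t : ℝ,
      shiftDistSq (H k) (t • EuclideanSpace.single i 1) ≤ C * ‖t‖ₑ ^ (2 * s))
    (hreg : ∀ᵐ x, IsRegularPoint H γ j x)
    (hl : latticeChar γ (Pi.single i 1) ^ ((j : ℕ) + 1) ≠ 1) :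
    0 < Measure.hausdorffMeasure (((m + 1 : ℕ) : ℝ) - 1) (zeroSet (gramianEigenvalue H j)) := by
  obtain ⟨p, hp, hps⟩ := exists_between (show 2 < 1 + 2 * s by linarith)
  refine hausdorffMeasure_pos_of_ae_exists_linePoint_mem (i := i)
    (Metric.measure_ball_pos volume (0 : Fin m → ℝ) one_half_pos) ?_
  filter_upwards [ae_exists_tendsto_setLAverage_cube_gramianEigenvalue hm (by norm_num) hp
    (setLIntegral_lineEnergy_ne_top hm hHs hps 2)
    (setLIntegral_fiberNormSq_linePoint_ne_top hm hH i 2) hreg hl] with z hz hzQ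
  obtain ⟨t₀, ht₀, hlim⟩ := hz (Metric.ball_subset_ball (by norm_num) hzQ)
  exact exists_linePoint_mem_zeroSet (gramianEigenvalue_add_latticePoint H j)
    ⟨ht₀.1, ht₀.2.trans_lt (by norm_num)⟩ hzQ hlim

end PositivityOfZeroSet

end

theorem mainTheorem12_general {d K : ℕ} (s : ℝ) (hs : 1 / 2 < s) (F : Fin K → L2 d)
    (hinv : HasNontrivialExtraInvariance (shiftInvariantSpace (Set.range F)))
    (hF : ∀ k, MemSlobodeckij s ((𝓕 (F k) : L2 d) : Rd d → ℂ)) :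
    ∃ j : Fin K, (j : ℕ) + 1 = minGenerators (shiftInvariantSpace (Set.range F)) ∧
      0 < Measure.hausdorffMeasure ((d : ℝ) - 1)
        (zeroSet (gramianEigenvalue (fun k => ((𝓕 (F k) : L2 d) : Rd d → ℂ)) j)) := by
  obtain ⟨γ, -, hγV, hγJ⟩ := hinv
  obtain ⟨i, hi⟩ := exists_coord_of_notMem_integerLattice hγJ
  obtain ⟨m, rfl⟩ := Nat.exists_eq_succ_of_ne_zero i.pos.ne'
  have hJ : minGenerators (shiftInvariantSpace (Set.range F)) ≠ 0 := fun h0 => hi 0 (by simp [h0])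
  have hj := Nat.sub_one_add_one hJ
  have hJK := hj.trans_le (minGenerators_shiftInvariantSpace_range_le F)
  have hm (k : Fin K) : Measurable (fourierFamily F k) :=
    (Lp.stronglyMeasurable (𝓕 (F k) : L2 (m + 1))).measurable
  have hH (k : Fin K) : ∫⁻ x, ‖fourierFamily F k x‖ₑ ^ 2 ≠ ⊤ := by
    rw [← sq_eLpNorm_two]
    exact ENNReal.pow_ne_top (Lp.eLpNorm_ne_top (𝓕 (F k) : L2 (m + 1)))
  have hreg := ae_isRegularPoint F hγV (j := ⟨_, hJK⟩) hj (ae_fiberNormSq_ne_top hm hH)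
  refine ⟨⟨_, hJK⟩, hj, hausdorffMeasure_zeroSet_pos (i := i) hm hH (lt_min hs one_half_lt_one)
    (fun k => (hF k).exists_shiftDistSq_le (by linarith) (hm k) i) hreg ?_⟩
  simpa only [hj, ne_eq, latticeChar_single_pow_eq_one_iff, not_exists] using hi

theorem mainTheorem12 {d K : ℕ} (s : ℝ) (hs : 1 / 2 < s) (hs' : s ≤ 1) (F : Fin K → L2 d)
    (hinv : HasNontrivialExtraInvariance (shiftInvariantSpace (Set.range F)))
    (hF : ∀ k, MemSlobodeckij s ((𝓕 (F k) : L2 d) : Rd d → ℂ)) :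
    ∃ j : Fin K, (j : ℕ) + 1 = minGenerators (shiftInvariantSpace (Set.range F)) ∧
      0 < Measure.hausdorffMeasure ((d : ℝ) - 1)
        (zeroSet (gramianEigenvalue (fun k => ((𝓕 (F k) : L2 d) : Rd d → ℂ)) j)) :=
  mainTheorem12_general s hs F hinv hF
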